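/- \textbf{Conventions.} Rings are associative with $1$; for a prime $p$ a \emph{$p$-ring} is a ring whose order is a power of $p$. A finite abelian group is encoded by positive integers $d_1,\dots,d_n$, standing for $\mathbf Z/d_1\times\dots\times\mathbf Z/d_n$, and its elements by integers $0\le x_i<d_i$. A finite ring $R$ is encoded by an encoding of its additive group together with the table of the products of the standard generators. Running times are measured in bit operations, as a function of the length of the input; a probabilistic algorithm is polynomial-time if its expected running time is polynomially bounded. For a ring $R$ let $K_1(R)=\mathrm{GL}(R)^{\mathrm{ab}}$, where $\mathrm{GL}(R)=\varinjlim \mathrm{GL}_n(R)$ along $A\mapsto\begin{pmatrix}A&0\\0&1\end{pmatrix}$, and let $c\colon R^\times\to\mathrm{GL}_1(R)\to\mathrm{GL}(R)\to K_1(R)$ be the canonical map. Let $N(R)$ be a normal subgroup of $R^\times$ for every ring $R$, and let $\mathcal C$ be a class of finite rings. \emph{Determining $R^\times/N(R)$ for $R\in\mathcal C$} means performing the following three tasks. (1) Given $R \in \mathcal C$, return a finite abelian group $A$ and a string $s$ of auxiliary data for which there is a surjective homomorphism $\varphi\colon R^\times\to A$ with kernel $N(R)$. (2) Given $R,A,s$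 and $u\in R^\times$, return $\varphi(u)$. (3) Given $R,A,s$ and $x\in A$, return some $u\in R^\times$ with $\varphi(u)=x$. \emph{Computing abelianizations of unit groups of rings in $\mathcal C$} is this problem for $N(R)=[R^\times,R^\times]$; \emph{computing $K_1$ of rings in $\mathcal C$} is this problem for $N(R)=\ker(c)$. \textbf{Proposition.} For every finite ring $R$ the map $c\colon R^\times\to K_1(R)$ is surjective (so that $R^\times/\ker(c)\cong K_1(R)$). Moreover, let $\mathcal C$ be the class of all finite rings, or the class of all $p$-rings where $p$ runs through all primes, or the class of $p$-rings for one fixed prime $p$. Then the problem of computing $K_1$ of rings in $\mathcal C$ reduces in probabilistic polynomial time to the problem of computing abelianizations of unit groups of rings in $\mathcal C$. Precisely: there is an algorithm $M$ such that for every polynomial $b$ there is a polynomial $q$ with the following property. Let $O$ be any (possibly randomized) oracle that computes abelianizations of unit groups of rings in $\mathcal C$ and whose answers to questions of length $l$ have length at most $b(l)$. Then $M$ with access to $O$ computes $K_1$ of rings in $\mathcal C$, all its outputs always being correct and of length at most $q(l)$ on inputs of length $l$; task (1) takes expected time at most $q(l)$, and tasks (2) and (3) toss no coins and take time at most $q(l)$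 in the worst case, where an oracle call costs the length of the question plus the length of the answer (plus one). -/

import Mathlib

open scoped ENNReal

noncomputable section

namespace FiniteRingAlg

/-! ### The infinite general linear group and `K₁` -/

section KOne

variable (R : Type) [Ring R]

/-- The `m × m` matrix with blocks `A`, `1` on the diagonal (for an `n × n` matrix `A`, `n ≤ m`). -/
def padMatrix {R : Type} [Ring R] {n : ℕ} (m : ℕ) (A : Matrix (Fin n) (Fin n) R) :
    Matrix (Fin m) (Fin m) R :=
  fun i j =>
    if h : (i : ℕ) < n ∧ (j : ℕ) < n then A ⟨i, h.1⟩ ⟨j, h.2⟩ else if i = j then 1 else 0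

theorem padMatrix_one {n m : ℕ} :
    padMatrix m (1 : Matrix (Fin n) (Fin n) R) = 1 := by
  ext i j
  by_cases h : (i : ℕ) < n ∧ (j : ℕ) < n
  · simp [padMatrix, h, Matrix.one_apply, Fin.ext_iff]
  · simp [padMatrix, h, Matrix.one_apply]

theorem padMatrix_mul {n m : ℕ} (hnm : n ≤ m) (A B : Matrix (Fin n) (Fin n) R) :
    padMatrix m (A * B) = padMatrix m A * padMatrix m B := by
  ext i k
  rw [Matrix.mul_apply]
  by_cases hi : (i : ℕ) < n
  · by_cases hk : (k : ℕ) < n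
    · have : padMatrix m (A * B) i k = ∑ j : Fin n, A ⟨i, hi⟩ j * B j ⟨k, hk⟩ := by
        simp [padMatrix, hi, hk, Matrix.mul_apply]
      rw [this]
      refine Fintype.sum_of_injective (Fin.castLE hnm) (Fin.castLE_injective hnm) _ _ ?_ ?_
      · intro j hj
        have hj' : ¬ (j : ℕ) < n := fun h => hj ⟨⟨j, h⟩, rfl⟩
        have hij : i ≠ j := by rintro rfl; exact hj' hi
        simp [padMatrix, hj', hij]
      · intro j
        simp [padMatrix, hi, hk]
    · have hik : i ≠ k := by rintro rfl; exact hk hi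
      have : padMatrix m (A * B) i k = 0 := by simp [padMatrix, hk, hik]
      rw [this]
      symm
      refine Finset.sum_eq_zero fun j _ => ?_
      by_cases hj : (j : ℕ) < n
      · have hjk : j ≠ k := by rintro rfl; exact hk hj
        simp [padMatrix, hk, hjk]
      · have hij : i ≠ j := by rintro rfl; exact hj hi
        simp [padMatrix, hj, hij]
  · rw [Finset.sum_eq_single i]
    · simp [padMatrix, hi]
    · intro j _ hj
      simp [padMatrix, hi, hj.symm]
    · simp

theorem padMatrix_self {n : ℕ} (A : Matrix (Fin n) (Fin n) R) : padMatrix n A = A := by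
  ext i j
  simp [padMatrix]

theorem padMatrix_padMatrix {n m l : ℕ} (hnm : n ≤ m)
    (A : Matrix (Fin n) (Fin n) R) :
    padMatrix l (padMatrix m A) = padMatrix l A := by
  ext i j
  by_cases h : (i : ℕ) < n ∧ (j : ℕ) < n
  · have h' : (i : ℕ) < m ∧ (j : ℕ) < m := ⟨by omega, by omega⟩
    simp [padMatrix, h, h']
  · by_cases h' : (i : ℕ) < m ∧ (j : ℕ) < m
    · simp [padMatrix, h, h', Fin.ext_iff]
    · simp [padMatrix, h, h']

/-- The embedding `GL_n(R) → GL_m(R)`, `A ↦ diag(A, 1, …, 1)`, for `n ≤ m`. -/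
def stabilize (n m : ℕ) (h : n ≤ m) :
    Matrix.GeneralLinearGroup (Fin n) R →* Matrix.GeneralLinearGroup (Fin m) R :=
  Units.map
    { toFun := padMatrix m
      map_one' := padMatrix_one R
      map_mul' := padMatrix_mul R h }

instance stabilize_directedSystem :
    DirectedSystem (fun n : ℕ => Matrix.GeneralLinearGroup (Fin n) R) (stabilize R · · ·) where
  map_self _ x := Units.ext (padMatrix_self R x.1)
  map_map _ _ _ hij _ x := Units.ext (padMatrix_padMatrix R hij x.1)

/-- The infinite general linear group `GL(R) = colim GL_n(R)`. -/
abbrev GLInf : Type :=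
  DirectLimit (fun n : ℕ => Matrix.GeneralLinearGroup (Fin n) R) (stabilize R)

/-- `K₁(R) = GL(R)^ab`. -/
abbrev K1 : Type := Abelianization (GLInf R)

/-- The structure map `GL_n(R) → GL(R)`. -/
def toGLInf (n : ℕ) : Matrix.GeneralLinearGroup (Fin n) R →* GLInf R where
  toFun A := ⟦⟨n, A⟩⟧
  map_one' := (DirectLimit.one_def (f := stabilize R) n).symm
  map_mul' A B := (DirectLimit.mul_def (f := stabilize R) n A B).symm

/-- The canonical map `Rˣ → GL_1(R) → GL(R) → K₁(R)`. -/
def unitsToK1 : Rˣ →* K1 R :=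
  (Abelianization.of.comp (toGLInf R 1)).comp
    (Units.map (Matrix.scalar (Fin 1) : R →+* Matrix (Fin 1) (Fin 1) R).toMonoidHom)

end KOne

/-! ### Encodings

All data are encoded as lists of lists of natural numbers, numbers being written in binary. -/

/-- A message: a finite sequence of finite sequences of natural numbers. -/
abbrev Msg : Type := List (List ℕ)

/-- Bit length of a list of natural numbers (with one separator per entry). -/
def bitLen (w : List ℕ) : ℕ := (w.map fun a => Nat.size a + 1).sum

/-- Bit length of a message. -/
def msgLen (x : Msg) : ℕ := (x.map fun w => bitLen w + 1).sum

/-- The group `ℤ/d₁ × ⋯ × ℤ/dₙ` specified by the list `d = [d₁, …, dₙ]`. -/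
abbrev AbGrp (d : List ℕ) : Type := ∀ i : Fin d.length, ZMod (d.get i)

/-- The encoding `[x₁, …, xₙ]`, `0 ≤ xᵢ < dᵢ`, of an element of `ℤ/d₁ × ⋯ × ℤ/dₙ` (`dᵢ > 0`). -/
def abCode {d : List ℕ} (x : AbGrp d) : List ℕ := List.ofFn fun i => (x i).val

/-- The `i`-th standard generator of `ℤ/d₁ × ⋯ × ℤ/dₙ`. -/
def abGen (d : List ℕ) (i : Fin d.length) : AbGrp d := Pi.single i 1

/-- An encoding of a finite ring `R`: an identification of its additive group with
`ℤ/d₁ × ⋯ × ℤ/dₙ`, and the table of the products of the standard generators `bᵢ`, that is,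
the codes of `b₁b₁, b₁b₂, …, bₙbₙ` one after the other. An algorithm sees only `dims` and
`table`. -/
structure RingCode (R : Type) [Ring R] where
  dims : List ℕ
  table : List ℕ
  dims_pos : ∀ a ∈ dims, 0 < a
  equiv : R ≃+ AbGrp dims
  table_eq : table =
    (List.finRange dims.length).flatMap fun i =>
      (List.finRange dims.length).flatMap fun j =>
        abCode (equiv (equiv.symm (abGen dims i) * equiv.symm (abGen dims j)))

/-- The message that encodes the ring. -/
def RingCode.msg {R : Type} [Ring R] (κ : RingCode R) : Msg := [κ.dims, κ.table]

/-- The encoding of an element of the ring. -/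
def RingCode.encode {R : Type} [Ring R] (κ : RingCode R) (r : R) : List ℕ := abCode (κ.equiv r)

/-! ### Computing a quotient of the unit group

A solution of such a problem consists of three tasks. `group`: given `R`, return an abelian
group `A`, together with a string `s` of auxiliary data for later use. `image`: given `R`, `A`, `s`
and a unit of `R`, return its image in `A`. `preimage`: given `R`, `A`, `s` and an element of `A`,
return a preimage in `Rˣ`. -/

inductive Task where
  | group
  | image
  | preimage

/-- `ans t x y`: on input `x`, task `t` may be answered by `y`. -/
abbrev Answers : Type := Task → Msg → Msg → Prop

/-- A class of rings. -/
abbrev RingClass : Type 1 := ∀ (R : Type) [Ring R], Prop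

/-- The class of finite rings. -/
def FiniteRings : RingClass := fun R _ => Finite R

/-- The class of `p`-rings: the order is a power of `p`. -/
def PRings (p : ℕ) : RingClass := fun R _ => ∃ k : ℕ, Nat.card R = p ^ k

/-- The class of rings that are `p`-rings for some prime `p`. -/
def PrimePowerRings : RingClass := fun R _ => ∃ p : ℕ, p.Prime ∧ PRings p R

/-- The admissible inputs of the three tasks, for rings in the class `C`. The data `A`, `s` in the
inputs of `image` and `preimage` have been returned by `group` before. -/
inductive IsInput (C : RingClass) (ans : Answers) : Task → Msg → Prop
  | group (R : Type) [Ring R] (hR : C R) (κ : RingCode R) :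
      IsInput C ans Task.group κ.msg
  | image (R : Type) [Ring R] (hR : C R) (κ : RingCode R) (A s : List ℕ)
      (h : ans Task.group κ.msg [A, s]) (u : Rˣ) :
      IsInput C ans Task.image (κ.msg ++ [A, s, κ.encode u])
  | preimage (R : Type) [Ring R] (hR : C R) (κ : RingCode R) (A s : List ℕ)
      (h : ans Task.group κ.msg [A, s]) (x : AbGrp A) :
      IsInput C ans Task.preimage (κ.msg ++ [A, s, abCode x])

/-- All possible answers are correct solutions of the problem of determining `Rˣ / N(R)` for the
rings `R` in the class `C`: every answer of `group` consists of a finite abelian group `A` and a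
string `s` for which there is a surjective homomorphism `φ : Rˣ → A` with kernel `N(R)` such that
`image` returns images and `preimage` returns preimages under `φ`. -/
def Determines (C : RingClass) (N : ∀ (R : Type) [Ring R], Subgroup Rˣ) (ans : Answers) : Prop :=
  ∀ (R : Type) [Ring R], C R → ∀ κ : RingCode R, ∀ out : Msg, ans Task.group κ.msg out →
    ∃ A s : List ℕ, out = [A, s] ∧ (∀ a ∈ A, 0 < a) ∧
      ∃ φ : Rˣ →* Multiplicative (AbGrp A),
        Function.Surjective φ ∧ φ.ker = N R ∧
        (∀ (u : Rˣ) (y : Msg), ans Task.image (κ.msg ++ [A, s, κ.encode u]) y →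
          y = [abCode (Multiplicative.toAdd (φ u))]) ∧
        (∀ (x : AbGrp A) (y : Msg), ans Task.preimage (κ.msg ++ [A, s, abCode x]) y →
          ∃ u : Rˣ, φ u = Multiplicative.ofAdd x ∧ y = [κ.encode u])

/-- The lengths of the possible answers are bounded by the polynomial `b` in the length of the
input. -/
def LengthBounded (C : RingClass) (ans : Answers) (b : Polynomial ℕ) : Prop :=
  ∀ (t : Task) (x : Msg), IsInput C ans t x → ∀ y : Msg, ans t x y → msgLen y ≤ b.eval (msgLen x)

/-! ### Probabilistic oracle programs with bit costs

A random access machine with finitely many (in each program) variables for natural numbers and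
for arrays of natural numbers, a coin and an oracle, given as structured programs. Each
step is charged at least the number of bit operations that the schoolbook methods need. -/

/-- The contents of the memory. -/
structure Store where
  num : ℕ → ℕ
  arr : ℕ → List ℕ

/-- Arithmetic expressions. -/
inductive Arith where
  | lit (n : ℕ)
  | var (x : ℕ)
  | len (a : ℕ)
  | get (a : ℕ) (i : Arith)
  | add (e f : Arith)
  | sub (e f : Arith)
  | mul (e f : Arith)
  | div (e f : Arith)
  | mod (e f : Arith)

/-- The value of an expression (truncated subtraction, division with remainder). -/
def Arith.eval (σ : Store) : Arith → ℕ
  | .lit n => n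
  | .var x => σ.num x
  | .len a => (σ.arr a).length
  | .get a i => (σ.arr a).getD (i.eval σ) 0
  | .add e f => e.eval σ + f.eval σ
  | .sub e f => e.eval σ - f.eval σ
  | .mul e f => e.eval σ * f.eval σ
  | .div e f => e.eval σ / f.eval σ
  | .mod e f => e.eval σ % f.eval σ

/-- Bit cost of an addition or subtraction. -/
def linCost (m n : ℕ) : ℕ := Nat.size m + Nat.size n + 1

/-- Bit cost of a multiplication or a division with remainder. -/
def mulCost (m n : ℕ) : ℕ := (Nat.size m + 1) * (Nat.size n + 1)

/-- Bit cost of evaluating an expression. -/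
def Arith.cost (σ : Store) : Arith → ℕ
  | .lit n => Nat.size n + 1
  | .var x => Nat.size (σ.num x) + 1
  | .len a => bitLen (σ.arr a) + 1
  | .get a i => i.cost σ + bitLen (σ.arr a) + 1
  | .add e f => e.cost σ + f.cost σ + linCost (e.eval σ) (f.eval σ)
  | .sub e f => e.cost σ + f.cost σ + linCost (e.eval σ) (f.eval σ)
  | .mul e f => e.cost σ + f.cost σ + mulCost (e.eval σ) (f.eval σ)
  | .div e f => e.cost σ + f.cost σ + mulCost (e.eval σ) (f.eval σ)
  | .mod e f => e.cost σ + f.cost σ + mulCost (e.eval σ) (f.eval σ)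

/-- Commands. Array names and variable names are natural numbers. -/
inductive Cmd where
  | skip
  /-- `x := e` -/
  | assign (x : ℕ) (e : Arith)
  /-- append `e` to the array `a` -/
  | push (a : ℕ) (e : Arith)
  /-- `a[i] := e`, without effect if `i` is out of range -/
  | put (a : ℕ) (i e : Arith)
  /-- `a := []` -/
  | clear (a : ℕ)
  /-- `a := b` for arrays -/
  | copy (a b : ℕ)
  /-- toss a fair coin, `x := 0` or `x := 1` -/
  | flip (x : ℕ)
  /-- ask the oracle to perform the task `t` on the arrays `args`, and store the components of
  the answer in the arrays `rets` -/
  | call (t : Task) (args rets : List ℕ)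
  | seq (c d : Cmd)
  /-- `c` if the value of `e` is not zero, otherwise `d` -/
  | branch (e : Arith) (c d : Cmd)
  /-- repeat `c` as long as the value of `e` is not zero -/
  | loop (e : Arith) (c : Cmd)

/-- The command contains no coin toss. -/
def Cmd.CoinFree : Cmd → Prop
  | .flip _ => False
  | .seq c d => c.CoinFree ∧ d.CoinFree
  | .branch _ c d => c.CoinFree ∧ d.CoinFree
  | .loop _ c => c.CoinFree
  | _ => True

/-- A randomized oracle: every question is answered by a random message. -/
abbrev Oracle : Type := Task → Msg → PMF Msg

/-- The possible answers of an oracle. -/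
def Oracle.answers (O : Oracle) : Answers := fun t x y => y ∈ (O t x).support

/-- A configuration: the commands that remain to be executed, the memory, and the number of bit
operations used so far. -/
structure Config where
  todo : List Cmd
  store : Store
  time : ℕ

def Store.setNum (σ : Store) (x v : ℕ) : Store := { σ with num := Function.update σ.num x v }

def Store.setArr (σ : Store) (a : ℕ) (w : List ℕ) : Store :=
  { σ with arr := Function.update σ.arr a w }

/-- Store the components of the message `y` in the arrays `rets`. -/
def Store.receive (σ : Store) (rets : List ℕ) (y : Msg) : Store :=
  { σ with arr := fun a => if a ∈ rets then y.getD (rets.idxOf a) [] else σ.arr a }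

/-- One step of a computation. A configuration without remaining commands is final. -/
def step (O : Oracle) (γ : Config) : PMF Config :=
  let σ := γ.store
  let τ := γ.time
  match γ.todo with
  | [] => PMF.pure γ
  | .skip :: k => PMF.pure ⟨k, σ, τ + 1⟩
  | .assign x e :: k => PMF.pure ⟨k, σ.setNum x (e.eval σ), τ + (e.cost σ + 1)⟩
  | .push a e :: k =>
      PMF.pure ⟨k, σ.setArr a (σ.arr a ++ [e.eval σ]), τ + (e.cost σ + bitLen (σ.arr a) + 1)⟩
  | .put a i e :: k =>
      PMF.pure ⟨k, σ.setArr a ((σ.arr a).set (i.eval σ) (e.eval σ)),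
        τ + (i.cost σ + e.cost σ + bitLen (σ.arr a) + 1)⟩
  | .clear a :: k => PMF.pure ⟨k, σ.setArr a [], τ + (bitLen (σ.arr a) + 1)⟩
  | .copy a b :: k =>
      PMF.pure ⟨k, σ.setArr a (σ.arr b), τ + (bitLen (σ.arr a) + bitLen (σ.arr b) + 1)⟩
  | .flip x :: k =>
      (PMF.uniformOfFintype Bool).bind fun b => PMF.pure ⟨k, σ.setNum x b.toNat, τ + 1⟩
  | .call t args rets :: k =>
      (O t (args.map σ.arr)).bind fun y =>
        PMF.pure ⟨k, σ.receive rets y, τ + (msgLen (args.map σ.arr) + msgLen y + 1)⟩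
  | .seq c d :: k => PMF.pure ⟨c :: d :: k, σ, τ + 1⟩
  | .branch e c d :: k =>
      PMF.pure ⟨(if e.eval σ ≠ 0 then c else d) :: k, σ, τ + (e.cost σ + 1)⟩
  | .loop e c :: k =>
      PMF.pure ⟨if e.eval σ ≠ 0 then c :: .loop e c :: k else k, σ, τ + (e.cost σ + 1)⟩

/-- A program: its body, and the names of the arrays that hold the output message at the end. The
components of the input message are in the arrays `0, 1, 2, …` at the start, all other arrays
are empty, and all number variables are zero. -/
structure Program where
  body : Cmd
  outs : List ℕ

def Program.init (P : Program) (x : Msg) : Config :=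
  ⟨[P.body], ⟨fun _ => 0, fun a => x.getD a []⟩, 0⟩

/-- The distribution of the configuration after `n` steps. -/
def Program.run (O : Oracle) (P : Program) (x : Msg) : ℕ → PMF Config
  | 0 => PMF.pure (P.init x)
  | n + 1 => (P.run O x n).bind (step O)

/-- `y` is a possible output of the program on input `x`. -/
def Program.Outputs (O : Oracle) (P : Program) (x y : Msg) : Prop :=
  ∃ n : ℕ, ∃ γ ∈ (P.run O x n).support, γ.todo = [] ∧ P.outs.map γ.store.arr = y

/-- The expected running time. As every step takes time at least one, a program with finite
expected running time halts with probability one. -/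
def Program.expectedTime (O : Oracle) (P : Program) (x : Msg) : ℝ≥0∞ :=
  ⨆ n : ℕ, ∑' γ : Config, P.run O x n γ * (γ.time : ℝ≥0∞)

/-- The running time is at most `T`, whatever the outcomes of coin tosses and oracle calls. As
every step takes time at least one, such a program halts after at most `T` steps. -/
def Program.TimeAtMost (O : Oracle) (P : Program) (x : Msg) (T : ℕ) : Prop :=
  ∀ n : ℕ, ∀ γ ∈ (P.run O x n).support, γ.time ≤ T

/-- One program for each of the three tasks. -/
abbrev Algorithm : Type := Task → Program

/-- The possible answers of an algorithm. -/
def Algorithm.answers (O : Oracle) (M : Algorithm) : Answers := fun t x y => (M t).Outputs O x y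

/-- The three programs run in polynomial time (bounded by `q`) relative to the oracle `O`: the
program for `group` in expected time, the programs for `image` and `preimage` without tossing
coins and in the worst case. All outputs have polynomially bounded length. -/
def Algorithm.PolyTime (C : RingClass) (O : Oracle) (M : Algorithm) (q : Polynomial ℕ) : Prop :=
  (∀ x : Msg, IsInput C (M.answers O) Task.group x →
    (M Task.group).expectedTime O x ≤ ((q.eval (msgLen x) : ℕ) : ℝ≥0∞)) ∧
  (∀ t : Task, t ≠ Task.group → (M t).body.CoinFree ∧
    ∀ x : Msg, IsInput C (M.answers O) t x → (M t).TimeAtMost O x (q.eval (msgLen x))) ∧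
  LengthBounded C (M.answers O) q

/-- `ans` solves the problem of computing the abelianizations of the unit groups of the rings
in `C`. -/
def ComputesUnitsAb (C : RingClass) (ans : Answers) : Prop :=
  Determines C (fun R _ => commutator Rˣ) ans

/-- `ans` solves the problem of computing `K₁` of the rings in `C`. -/
def ComputesK1 (C : RingClass) (ans : Answers) : Prop :=
  Determines C (fun R _ => (unitsToK1 R).ker) ans

/-- The problem of computing `K₁` of the rings in `C` reduces in probabilistic polynomial time to
the problem of computing abelianizations of unit groups of rings in `C`: there is one algorithm that
computes `K₁` with the help of any oracle that computes abelianizations of unit groups and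
gives answers of polynomially bounded length; the bound `q` on the running time depends only on
the bound `b` on the lengths of the answers. -/
def K1ReducesToUnitsAb (C : RingClass) : Prop :=
  ∃ M : Algorithm, ∀ b : Polynomial ℕ, ∃ q : Polynomial ℕ, ∀ O : Oracle,
    ComputesUnitsAb C O.answers → LengthBounded C O.answers b →
      ComputesK1 C (M.answers O) ∧ M.PolyTime C O q

end FiniteRingAlg

end

noncomputable section

namespace FiniteRingAlg

/-! ### A program logic with step counts -/

/-! ### Bit lengths of numbers, lists and messages. -/

section Sizes

/-! The algebraic core is that `u ↦ diag(u, 1, 1, 1)` maps `Rˣ` onto the abelianization of `GL₄(R)`,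
with the same kernel as `Rˣ → K₁(R)` (`unitsToGLFourAb_surjective`, `ker_unitsToGLFourAb`). Hence
`K₁(R)` is visible in the unit group of the finite ring `M₄(R)`, which the oracle can handle, and
each of the classes of rings is closed under passing from `R` to `M₄(R)`.

The key notion is a symmetric homomorphism `f` on `Sˣ` with values in an abelian group: `f (1 + xy)
= f (1 + yx)` whenever both arguments are units. If `S` has a unit `p` with `p - 1` a unit, then
elementary matrices are commutators in `GL₂(S)`, and `Sˣ → GL₂(S)^ab` is symmetric
(`symmetric_of_diagOne`). With `S = M₂(R)` this applies to `GL₂(R) → GL₄(R)^ab`. Conversely, a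
symmetric `f` extends to a symmetric homomorphism on `GL₂(S)`, a noncommutative determinant that is
read off from Gaussian elimination (`exists_extension`, `extension_symmetric`). This needs stable
range one, a condition `UnitComplement` that allows one to choose the elimination step compatibly
with a further row operation, and that units generate `S` additively. All three hold for `S =
M_N(R)` with `R` finite and `N` even; the first two are checked modulo the radical, on matrices over
finite fields. Repeated doubling extends `GL₂(R) → GL₄(R)^ab` to all `GL_N(R)` with `N` a power of
two, so a unit that dies in `K₁(R)` dies already in `GL₄(R)^ab`.

For the algorithm let `φ₁ : Rˣ → A₁` and `φ₂ : GL₄(R) → A₂` be the maps given by the oracle. The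
group returned is `A₂`, with `ψ u = φ₂ (diag(u, 1, 1, 1))`. As the code of `1` is not part of the
encoding of `R`, the programs use `diag(u, w, w, w)` instead, where `w` is an oracle preimage of `0
∈ A₁`; it lies in the commutator subgroup, so `φ₂` does not notice the change (`exists_homs`). For
preimages, `ψ` factors as `h ∘ φ₁` with `h : A₁ → A₂` surjective. The images under `h` of the
generators of `A₁` are computed, `h y = x` is solved by Euclidean elimination on the graph of `h`,
and the oracle lifts `y` to a unit. Correctness and running times are proved together in a small
program logic with step counts (`Good`, `Run`). No program tosses coins, so the expected time is
bounded by a worst case bound. -/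

theorem bitLen_append (v w : List ℕ) : bitLen (v ++ w) = bitLen v + bitLen w := by
  simp [bitLen]

theorem length_le_bitLen (w : List ℕ) : w.length ≤ bitLen w := by
  induction w with
  | nil => simp
  | cons a w ih => simp only [bitLen, List.map_cons, List.sum_cons, List.length_cons] at ih ⊢; omega

theorem size_lt_bitLen {w : List ℕ} {a : ℕ} (h : a ∈ w) : Nat.size a < bitLen w := by
  induction w with
  | nil => simp at h
  | cons b w ih =>
    simp only [bitLen, List.map_cons, List.sum_cons] at ih ⊢
    rcases List.mem_cons.1 h with rfl | h
    · omega
    · have := ih h; omega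

theorem bitLen_lt_msgLen {x : Msg} {w : List ℕ} (h : w ∈ x) : bitLen w < msgLen x := by
  induction x with
  | nil => simp at h
  | cons b x ih =>
    simp only [msgLen, List.map_cons, List.sum_cons] at ih ⊢
    rcases List.mem_cons.1 h with rfl | h
    · omega
    · have := ih h; omega

theorem bitLen_le_mul {w : List ℕ} {z : ℕ} (h : ∀ a ∈ w, Nat.size a ≤ z) :
    bitLen w ≤ w.length * (z + 1) := by
  induction w with
  | nil => simp [bitLen]
  | cons a w ih =>
    have h1 := h a (by simp)
    have h2 := ih fun b hb => h b (by simp [hb])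
    simp only [bitLen, List.map_cons, List.sum_cons, List.length_cons] at h2 ⊢
    rw [add_mul, one_mul]
    omega

theorem msgLen_le_mul {x : Msg} {z : ℕ} (h : ∀ w ∈ x, bitLen w ≤ z) :
    msgLen x ≤ x.length * (z + 1) := by
  induction x with
  | nil => simp [msgLen]
  | cons a w ih =>
    have h1 := h a (by simp)
    have h2 := ih fun b hb => h b (by simp [hb])
    simp only [msgLen, List.map_cons, List.sum_cons, List.length_cons] at h2 ⊢
    rw [add_mul, one_mul]
    omega

theorem size_le_self (n : ℕ) : Nat.size n ≤ n := Nat.size_le.2 Nat.lt_two_pow_self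

theorem size_add_le (m n : ℕ) : Nat.size (m + n) ≤ Nat.size m + Nat.size n + 1 := by
  rw [Nat.size_le]
  have h1 := Nat.lt_size_self m
  have h2 := Nat.lt_size_self n
  have h3 : 2 ^ m.size ≤ 2 ^ (m.size + n.size) := Nat.pow_le_pow_right (by norm_num) (by omega)
  have h4 : 2 ^ n.size ≤ 2 ^ (m.size + n.size) := Nat.pow_le_pow_right (by norm_num) (by omega)
  rw [pow_succ]
  omega

theorem size_mul_le (m n : ℕ) : Nat.size (m * n) ≤ Nat.size m + Nat.size n := by
  rw [Nat.size_le, pow_add]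
  exact Nat.mul_lt_mul'' (Nat.lt_size_self m) (Nat.lt_size_self n)

end Sizes

/-! ### Size and cost of expressions over bounded registers. -/

section Weights

/-- All registers have bit length at most `Z`. -/
def Store.Bounded (Z : ℕ) (σ : Store) : Prop :=
  (∀ x, Nat.size (σ.num x) ≤ Z) ∧ ∀ a, bitLen (σ.arr a) ≤ Z

/-- A constant that controls the size of the value and the cost of an expression. -/
def Arith.weight : Arith → ℕ
  | .lit n => Nat.size n + 1
  | .var _ => 1
  | .len _ => 1
  | .get _ i => i.weight + 1
  | .add e f => e.weight + f.weight + (e.weight + 1) * (f.weight + 1)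
  | .sub e f => e.weight + f.weight + (e.weight + 1) * (f.weight + 1)
  | .mul e f => e.weight + f.weight + (e.weight + 1) * (f.weight + 1)
  | .div e f => e.weight + f.weight + (e.weight + 1) * (f.weight + 1)
  | .mod e f => e.weight + f.weight + (e.weight + 1) * (f.weight + 1)

/-- Sums and products at most add the sizes of their arguments, up to a carry, so the size stays
linear in the register bound for a fixed expression. The product of weights in `Arith.weight` is
there mainly to pay for `mulCost` in `Arith.cost_le`, so that one constant serves both bounds. -/
theorem Arith.size_eval_le {Z : ℕ} {σ : Store} (hσ : σ.Bounded Z) (e : Arith) :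
    Nat.size (e.eval σ) ≤ e.weight * (Z + 1) := by
  induction e with
  | lit n => simp only [eval, weight]; nlinarith [Nat.zero_le (n.size * Z)]
  | var x => have := hσ.1 x; simp only [eval, weight]; omega
  | len a =>
    have := hσ.2 a
    have h2 := length_le_bitLen (σ.arr a)
    have h3 := size_le_self (σ.arr a).length
    simp only [eval, weight]; omega
  | get a i _ =>
    have h1 := hσ.2 a
    simp only [eval, weight]
    have h3 : Nat.size ((σ.arr a).getD (i.eval σ) 0) ≤ Z := by
      by_cases h : i.eval σ < (σ.arr a).length
      · rw [List.getD_eq_getElem _ _ h]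
        exact (size_lt_bitLen (List.getElem_mem h)).le.trans h1
      · rw [List.getD_eq_default _ _ (not_lt.1 h)]; simp
    nlinarith [Nat.zero_le (i.weight * (Z + 1))]
  | add e f he hf =>
    have := size_add_le (e.eval σ) (f.eval σ)
    simp only [eval, weight]
    nlinarith [Nat.zero_le ((e.weight + 1) * (f.weight + 1) * Z),
      Nat.zero_le (e.weight * f.weight)]
  | sub e f he hf =>
    have := Nat.size_le_size (Nat.sub_le (e.eval σ) (f.eval σ))
    simp only [eval, weight]
    nlinarith [Nat.zero_le ((e.weight + 1) * (f.weight + 1) * (Z + 1))]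
  | mul e f he hf =>
    have := size_mul_le (e.eval σ) (f.eval σ)
    simp only [eval, weight]
    nlinarith [Nat.zero_le ((e.weight + 1) * (f.weight + 1) * (Z + 1))]
  | div e f he hf =>
    have := Nat.size_le_size (Nat.div_le_self (e.eval σ) (f.eval σ))
    simp only [eval, weight]
    nlinarith [Nat.zero_le ((e.weight + 1) * (f.weight + 1) * (Z + 1))]
  | mod e f he hf =>
    have := Nat.size_le_size (Nat.mod_le (e.eval σ) (f.eval σ))
    simp only [eval, weight]
    nlinarith [Nat.zero_le ((e.weight + 1) * (f.weight + 1) * (Z + 1))]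

theorem linCost_le_mulCost (m n : ℕ) : linCost m n ≤ mulCost m n := by
  simp only [linCost, mulCost]; nlinarith [Nat.zero_le (m.size * n.size)]

theorem Arith.mulCost_le {Z : ℕ} {σ : Store} (hσ : σ.Bounded Z) (e f : Arith) :
    mulCost (e.eval σ) (f.eval σ) ≤ (e.weight + 1) * (f.weight + 1) * (Z + 1) ^ 2 := by
  have he := e.size_eval_le hσ
  have hf := f.size_eval_le hσ
  calc mulCost (e.eval σ) (f.eval σ)
      ≤ ((e.weight + 1) * (Z + 1)) * ((f.weight + 1) * (Z + 1)) :=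
        Nat.mul_le_mul (by rw [add_mul]; omega) (by rw [add_mul]; omega)
    _ = _ := by ring

theorem Arith.cost_le {Z : ℕ} {σ : Store} (hσ : σ.Bounded Z) (e : Arith) :
    e.cost σ ≤ e.weight * (Z + 1) ^ 2 := by
  have hZ : Z + 1 ≤ (Z + 1) ^ 2 := by nlinarith
  induction e with
  | lit n => simp only [cost, weight]; nlinarith [Nat.zero_le (n.size * Z)]
  | var x => have := hσ.1 x; simp only [cost, weight]; omega
  | len a => have := hσ.2 a; simp only [cost, weight]; omega
  | get a i ih => have := hσ.2 a; simp only [cost, weight]; rw [add_mul, one_mul]; omega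
  | add e f he hf =>
    have := linCost_le_mulCost (e.eval σ) (f.eval σ)
    have := Arith.mulCost_le hσ e f
    simp only [cost, weight]; rw [add_mul, add_mul]; omega
  | sub e f he hf =>
    have := linCost_le_mulCost (e.eval σ) (f.eval σ)
    have := Arith.mulCost_le hσ e f
    simp only [cost, weight]; rw [add_mul, add_mul]; omega
  | mul e f he hf =>
    have := Arith.mulCost_le hσ e f
    simp only [cost, weight]; rw [add_mul, add_mul]; omega
  | div e f he hf =>
    have := Arith.mulCost_le hσ e f
    simp only [cost, weight]; rw [add_mul, add_mul]; omega
  | mod e f he hf =>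
    have := Arith.mulCost_le hσ e f
    simp only [cost, weight]; rw [add_mul, add_mul]; omega

/-- A constant that controls the cost of the single steps of a command. -/
def Cmd.weight : Cmd → ℕ
  | .skip => 1
  | .assign _ e => e.weight + 1
  | .push _ e => e.weight + 1
  | .put _ i e => i.weight + e.weight + 1
  | .clear _ => 1
  | .copy _ _ => 2
  | .flip _ => 1
  | .call _ args _ => args.length + 1
  | .seq c d => c.weight + d.weight + 1
  | .branch e c d => e.weight + c.weight + d.weight + 1
  | .loop e c => e.weight + c.weight + 1

end Weights

/-! ### Executions with a step budget, and a Hoare logic in continuation style. -/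

section Logic

variable (O : Oracle) (Z : ℕ)

/-- The remaining commands `k` toss no coins and halt after at most `n` steps, in a store that
satisfies `Post`; the registers stay bounded by `Z`. -/
def Good (Post : Store → Prop) : ℕ → List Cmd → Store → Prop
  | _, [], σ => σ.Bounded Z ∧ Post σ
  | 0, _ :: _, _ => False
  | n + 1, c :: k, σ => σ.Bounded Z ∧
    match c with
    | .skip => Good Post n k σ
    | .assign x e => Good Post n k (σ.setNum x (e.eval σ))
    | .push a e => Good Post n k (σ.setArr a (σ.arr a ++ [e.eval σ]))
    | .put a i e => Good Post n k (σ.setArr a ((σ.arr a).set (i.eval σ) (e.eval σ)))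
    | .clear a => Good Post n k (σ.setArr a [])
    | .copy a b => Good Post n k (σ.setArr a (σ.arr b))
    | .flip _ => False
    | .call t args rets => ∀ y ∈ (O t (args.map σ.arr)).support,
        msgLen y ≤ Z ∧ Good Post n k (σ.receive rets y)
    | .seq c d => Good Post n (c :: d :: k) σ
    | .branch e c d => Good Post n ((if e.eval σ ≠ 0 then c else d) :: k) σ
    | .loop e c => Good Post n (if e.eval σ ≠ 0 then c :: .loop e c :: k else k) σ

variable {O Z} {Post : Store → Prop}

theorem Good.bounded {n : ℕ} {k : List Cmd} {σ : Store} (h : Good O Z Post n k σ) :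
    σ.Bounded Z := by
  cases k with
  | nil => cases n <;> exact h.1
  | cons c k => cases n with
    | zero => exact h.elim
    | succ n => cases c <;> exact h.1

theorem Good.post {n : ℕ} {σ : Store} (h : Good O Z Post n [] σ) : Post σ := by
  cases n <;> exact h.2

theorem Good.succ {n : ℕ} {k : List Cmd} {σ : Store} (h : Good O Z Post n k σ) :
    Good O Z Post (n + 1) k σ := by
  induction n generalizing k σ with
  | zero =>
    cases k with
    | nil => exact h
    | cons c k => exact h.elim
  | succ n ih =>
    cases k with
    | nil => exact h
    | cons c k =>
      cases c with
      | flip => exact h.2.elim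
      | call t args rets => exact ⟨h.1, fun y hy => ⟨(h.2 y hy).1, ih (h.2 y hy).2⟩⟩
      | _ => exact ⟨h.1, ih h.2⟩

theorem Good.mono {n m : ℕ} (hnm : n ≤ m) {k : List Cmd} {σ : Store} (h : Good O Z Post n k σ) :
    Good O Z Post m k σ := by
  induction hnm with
  | refl => exact h
  | step _ ih => exact ih.succ

theorem good_step {C n : ℕ} {c : Cmd} {k : List Cmd} {σ : Store} {τ : ℕ}
    (h : Good O Z Post (n + 1) (c :: k) σ) (hC : ∀ d ∈ c :: k, d.weight ≤ C)
    {γ : Config} (hγ : γ ∈ (step O ⟨c :: k, σ, τ⟩).support) :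
    Good O Z Post n γ.todo γ.store ∧ γ.time ≤ τ + C * (Z + 1) ^ 2 ∧
      ∀ d ∈ γ.todo, d.weight ≤ C := by
  have hb := h.bounded
  have hc := hC c (by simp)
  have hk : ∀ d ∈ k, d.weight ≤ C := fun d hd => hC d (by simp [hd])
  have hZ : Z + 1 ≤ (Z + 1) ^ 2 := by nlinarith
  have hmono : c.weight * (Z + 1) ^ 2 ≤ C * (Z + 1) ^ 2 := Nat.mul_le_mul_right _ hc
  cases c with
  | skip =>
    simp only [step, PMF.support_pure, Set.mem_singleton_iff] at hγ
    subst hγ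
    simp only [Cmd.weight] at hmono
    exact ⟨h.2, by show τ + 1 ≤ _; omega, hk⟩
  | assign x e =>
    simp only [step, PMF.support_pure, Set.mem_singleton_iff] at hγ
    subst hγ
    have := e.cost_le hb
    simp only [Cmd.weight, add_mul, one_mul] at hmono
    exact ⟨h.2, by show τ + _ ≤ _; omega, hk⟩
  | push a e =>
    simp only [step, PMF.support_pure, Set.mem_singleton_iff] at hγ
    subst hγ
    have := e.cost_le hb
    have := hb.2 a
    simp only [Cmd.weight, add_mul, one_mul] at hmono
    exact ⟨h.2, by show τ + _ ≤ _; omega, hk⟩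
  | put a i e =>
    simp only [step, PMF.support_pure, Set.mem_singleton_iff] at hγ
    subst hγ
    have := e.cost_le hb
    have := i.cost_le hb
    have := hb.2 a
    simp only [Cmd.weight, add_mul, one_mul] at hmono
    exact ⟨h.2, by show τ + _ ≤ _; omega, hk⟩
  | clear a =>
    simp only [step, PMF.support_pure, Set.mem_singleton_iff] at hγ
    subst hγ
    have := hb.2 a
    simp only [Cmd.weight, one_mul] at hmono
    exact ⟨h.2, by show τ + _ ≤ _; omega, hk⟩
  | copy a b =>
    simp only [step, PMF.support_pure, Set.mem_singleton_iff] at hγ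
    subst hγ
    have := hb.2 a
    have := hb.2 b
    simp only [Cmd.weight] at hmono
    exact ⟨h.2, by show τ + _ ≤ _; omega, hk⟩
  | flip x => exact h.2.elim
  | call t args rets =>
    simp only [step, PMF.mem_support_bind_iff, PMF.support_pure, Set.mem_singleton_iff] at hγ
    obtain ⟨y, hy, rfl⟩ := hγ
    obtain ⟨h1, h2⟩ := h.2 y hy
    have h3 : msgLen (args.map σ.arr) ≤ args.length * (Z + 1) := by
      have := msgLen_le_mul (x := args.map σ.arr) (z := Z) (by
        intro w hw
        obtain ⟨a, -, rfl⟩ := List.mem_map.1 hw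
        exact hb.2 a)
      simpa using this
    have h4 : args.length * (Z + 1) ≤ args.length * (Z + 1) ^ 2 := Nat.mul_le_mul_left _ hZ
    simp only [Cmd.weight, add_mul, one_mul] at hmono
    exact ⟨h2, by show τ + _ ≤ _; omega, hk⟩
  | seq c d =>
    simp only [step, PMF.support_pure, Set.mem_singleton_iff] at hγ
    subst hγ
    simp only [Cmd.weight] at hc hmono
    refine ⟨h.2, ?_, ?_⟩
    · show τ + 1 ≤ _
      rw [add_mul, one_mul] at hmono; omega
    · intro d' hd'
      simp only [List.mem_cons] at hd'
      rcases hd' with rfl | rfl | hd'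
      · omega
      · omega
      · exact hk _ hd'
  | branch e c d =>
    simp only [step, PMF.support_pure, Set.mem_singleton_iff] at hγ
    subst hγ
    have := e.cost_le hb
    simp only [Cmd.weight] at hc hmono
    refine ⟨h.2, ?_, ?_⟩
    · show τ + _ ≤ _
      simp only [add_mul, one_mul] at hmono; omega
    · intro d' hd'
      simp only [List.mem_cons] at hd'
      rcases hd' with rfl | hd'
      · split_ifs <;> omega
      · exact hk _ hd'
  | loop e c =>
    simp only [step, PMF.support_pure, Set.mem_singleton_iff] at hγ
    subst hγ
    have := e.cost_le hb
    simp only [Cmd.weight] at hc hmono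
    refine ⟨h.2, ?_, ?_⟩
    · show τ + _ ≤ _
      simp only [add_mul, one_mul] at hmono; omega
    · intro d' hd'
      simp only at hd'
      split_ifs at hd'
      · simp only [List.mem_cons] at hd'
        rcases hd' with rfl | rfl | hd'
        · omega
        · simpa [Cmd.weight] using hc
        · exact hk _ hd'
      · exact hk _ hd'

/-- A program satisfies its specification, with a bound for the running time. -/
theorem good_run {P : Program} {x : Msg} {n : ℕ}
    (h : Good O Z Post n [P.body] (P.init x).store) (i : ℕ) {γ : Config}
    (hγ : γ ∈ (P.run O x i).support) :
    (∃ r, Good O Z Post r γ.todo γ.store) ∧ γ.time ≤ n * (P.body.weight * (Z + 1) ^ 2) := by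
  set κ := P.body.weight * (Z + 1) ^ 2 with hκ
  -- A potential argument: the elapsed time plus `κ` for every step still allowed never exceeds `n *
  -- κ`. The weight bound persists because a step only puts back the removed command or parts of it.
  suffices H : ∃ r, Good O Z Post r γ.todo γ.store ∧ γ.time + r * κ ≤ n * κ ∧
      ∀ d ∈ γ.todo, d.weight ≤ P.body.weight by
    obtain ⟨r, h1, h2, -⟩ := H
    exact ⟨⟨r, h1⟩, by omega⟩
  induction i generalizing γ with
  | zero =>
    simp only [Program.run, PMF.support_pure, Set.mem_singleton_iff] at hγ
    subst hγ
    exact ⟨n, h, by simp [Program.init], by simp [Program.init]⟩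
  | succ i ih =>
    simp only [Program.run, PMF.mem_support_bind_iff] at hγ
    obtain ⟨γ', hγ', hγ⟩ := hγ
    obtain ⟨r, h1, h2, h3⟩ := ih hγ'
    obtain ⟨k, σ, τ⟩ := γ'
    cases k with
    | nil =>
      simp only [step, PMF.support_pure, Set.mem_singleton_iff] at hγ
      subst hγ
      exact ⟨r, h1, h2, h3⟩
    | cons c k =>
      cases r with
      | zero => exact h1.elim
      | succ r =>
        obtain ⟨h4, h5, h6⟩ := good_step h1 h3 hγ
        refine ⟨r, h4, ?_, h6⟩
        simp only at h2
        rw [add_mul, one_mul] at h2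
        omega

theorem good_outputs {P : Program} {x y : Msg} {n : ℕ}
    (h : Good O Z Post n [P.body] (P.init x).store) (hy : P.Outputs O x y) :
    ∃ σ : Store, σ.Bounded Z ∧ Post σ ∧ P.outs.map σ.arr = y := by
  obtain ⟨i, γ, hγ, h1, h2⟩ := hy
  obtain ⟨⟨r, h3⟩, -⟩ := good_run h i hγ
  rw [h1] at h3
  exact ⟨γ.store, h3.bounded, h3.post, h2⟩

theorem good_timeAtMost {P : Program} {x : Msg} {n : ℕ}
    (h : Good O Z Post n [P.body] (P.init x).store) :
    P.TimeAtMost O x (n * (P.body.weight * (Z + 1) ^ 2)) :=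
  fun i _ hγ => (good_run h i hγ).2

/-- The time is bounded on the whole support of each distribution, so its expectation satisfies the
same bound. -/
theorem good_expectedTime {P : Program} {x : Msg} {n : ℕ}
    (h : Good O Z Post n [P.body] (P.init x).store) :
    P.expectedTime O x ≤ ((n * (P.body.weight * (Z + 1) ^ 2) : ℕ) : ℝ≥0∞) := by
  refine iSup_le fun i => ?_
  calc ∑' γ : Config, P.run O x i γ * (γ.time : ℝ≥0∞)
      ≤ ∑' γ : Config, P.run O x i γ * ((n * (P.body.weight * (Z + 1) ^ 2) : ℕ) : ℝ≥0∞) := by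
        refine ENNReal.tsum_le_tsum fun γ => ?_
        by_cases hγ : γ ∈ (P.run O x i).support
        · exact mul_le_mul_right (Nat.cast_le.2 (good_run h i hγ).2) _
        · rw [PMF.mem_support_iff, not_not] at hγ
          simp [hγ]
    _ = _ := by rw [ENNReal.tsum_mul_right, PMF.tsum_coe, one_mul]

variable (O Z) in
/-- Started in the store `σ`, the command `c` halts after at most `n` steps in a store that
satisfies `Q`; the registers stay bounded by `Z`. -/
def Run (c : Cmd) (σ : Store) (n : ℕ) (Q : Store → Prop) : Prop :=
  σ.Bounded Z → ∀ (Post : Store → Prop) (k : List Cmd) (m : ℕ),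
    (∀ σ', σ'.Bounded Z → Q σ' → Good O Z Post m k σ') → Good O Z Post (n + m) (c :: k) σ

variable {σ : Store} {Q : Store → Prop}

theorem Run.good {c : Cmd} {n : ℕ} (h : Run O Z c σ n Q) (hσ : σ.Bounded Z) :
    Good O Z Q n [c] σ := by
  have := h hσ Q [] 0 fun σ' h1 h2 => ⟨h1, h2⟩
  simpa using this

theorem Run.weaken {c : Cmd} {n m : ℕ} {Q' : Store → Prop} (h : Run O Z c σ n Q) (hnm : n ≤ m)
    (hQ : ∀ σ', Q σ' → Q' σ') : Run O Z c σ m Q' :=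
  fun hσ Post k l hk => (h hσ Post k l fun σ' h1 h2 => hk σ' h1 (hQ σ' h2)).mono (by omega)

theorem Run.seq {c d : Cmd} {n m : ℕ} (h : Run O Z c σ n fun σ' => Run O Z d σ' m Q) :
    Run O Z (.seq c d) σ (n + m + 1) Q := by
  intro hσ Post k l hk
  have h1 := h hσ Post (d :: k) (m + l) fun σ' h1 h2 => h2 h1 Post k l hk
  rw [show n + m + 1 + l = n + (m + l) + 1 by ring]
  exact ⟨hσ, h1⟩

theorem Store.Bounded.setNum (hσ : σ.Bounded Z) {x v : ℕ} (hv : Nat.size v ≤ Z) :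
    (σ.setNum x v).Bounded Z := by
  refine ⟨fun y => ?_, hσ.2⟩
  by_cases h : y = x
  · subst h; simpa [Store.setNum] using hv
  · simpa [Store.setNum, h] using hσ.1 y

theorem Store.Bounded.setArr (hσ : σ.Bounded Z) {a : ℕ} {w : List ℕ} (hw : bitLen w ≤ Z) :
    (σ.setArr a w).Bounded Z := by
  refine ⟨hσ.1, fun b => ?_⟩
  by_cases h : b = a
  · subst h; simpa [Store.setArr] using hw
  · simpa [Store.setArr, h] using hσ.2 b

theorem Store.Bounded.receive (hσ : σ.Bounded Z) {rets : List ℕ} {y : Msg} (hy : msgLen y ≤ Z) :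
    (σ.receive rets y).Bounded Z := by
  refine ⟨hσ.1, fun b => ?_⟩
  simp only [Store.receive]
  split_ifs
  · by_cases h : rets.idxOf b < y.length
    · rw [List.getD_eq_getElem _ _ h]
      exact (bitLen_lt_msgLen (List.getElem_mem h)).le.trans hy
    · rw [List.getD_eq_default _ _ (not_lt.1 h)]; simp [bitLen]
  · exact hσ.2 b

theorem Run.assign {x : ℕ} {e : Arith} (hv : Nat.size (e.eval σ) ≤ Z)
    (hQ : Q (σ.setNum x (e.eval σ))) : Run O Z (.assign x e) σ 1 Q := by
  intro hσ Post k l hk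
  rw [add_comm]
  exact ⟨hσ, hk _ (hσ.setNum hv) hQ⟩

theorem Run.push {a : ℕ} {e : Arith} (hv : bitLen (σ.arr a ++ [e.eval σ]) ≤ Z)
    (hQ : Q (σ.setArr a (σ.arr a ++ [e.eval σ]))) : Run O Z (.push a e) σ 1 Q := by
  intro hσ Post k l hk
  rw [add_comm]
  exact ⟨hσ, hk _ (hσ.setArr hv) hQ⟩

theorem Run.clear {a : ℕ} (hQ : Q (σ.setArr a [])) : Run O Z (.clear a) σ 1 Q := by
  intro hσ Post k l hk
  rw [add_comm]
  exact ⟨hσ, hk _ (hσ.setArr (by simp [bitLen])) hQ⟩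

theorem Run.copy {a b : ℕ} (hQ : Q (σ.setArr a (σ.arr b))) : Run O Z (.copy a b) σ 1 Q := by
  intro hσ Post k l hk
  rw [add_comm]
  exact ⟨hσ, hk _ (hσ.setArr (hσ.2 b)) hQ⟩

theorem Run.call {t : Task} {args rets : List ℕ}
    (h : ∀ y ∈ (O t (args.map σ.arr)).support, msgLen y ≤ Z ∧ Q (σ.receive rets y)) :
    Run O Z (.call t args rets) σ 1 Q := by
  intro hσ Post k l hk
  rw [add_comm]
  exact ⟨hσ, fun y hy => ⟨(h y hy).1, hk _ (hσ.receive (h y hy).1) (h y hy).2⟩⟩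

/-- The index of the invariant is a variant that drops in every pass, possibly by more than one. A
pass costs `b` steps and one test; the last summand is the failing test. -/
theorem Run.loop {e : Arith} {c : Cmd} {b : ℕ} {I : ℕ → Store → Prop}
    (h0 : ∀ σ, I 0 σ → e.eval σ = 0)
    (hs : ∀ i σ, I (i + 1) σ → e.eval σ ≠ 0 → Run O Z c σ b fun σ' => ∃ j ≤ i, I j σ')
    (hQ : ∀ i σ, I i σ → e.eval σ = 0 → Q σ) {i : ℕ} (hi : I i σ) :
    Run O Z (.loop e c) σ ((b + 1) * i + 1) Q := by
  intro hσ Post k l hk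
  induction i using Nat.strong_induction_on generalizing σ with
  | _ i ih =>
    by_cases he : e.eval σ = 0
    · have h1 : Good O Z Post (l + 1) (.loop e c :: k) σ := ⟨hσ, by
        simp only [he, ne_eq, not_true_eq_false, if_false]
        exact hk σ hσ (hQ i σ hi he)⟩
      exact h1.mono (by omega)
    · cases i with
      | zero => exact (he (h0 σ hi)).elim
      | succ i =>
        have h1 := hs i σ hi he hσ Post (.loop e c :: k) ((b + 1) * i + 1 + l) (by
          rintro σ' hσ' ⟨j, hj, hI⟩
          have := ih j (by omega) hI hσ'
          refine this.mono ?_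
          have : (b + 1) * j ≤ (b + 1) * i := Nat.mul_le_mul_left _ hj
          omega)
        have h2 : Good O Z Post (b + ((b + 1) * i + 1 + l) + 1) (.loop e c :: k) σ := ⟨hσ, by
          simp only [ne_eq, he, not_false_eq_true, if_true]
          exact h1⟩
        refine h2.mono (le_of_eq ?_)
        ring

end Logic

/-! ### Stores with an explicit list of registers, and loops that fill an array. -/

section ListStore

/-- The store given by the lists of the contents of the registers. -/
def mkS (ns : List ℕ) (as : Msg) : Store := ⟨fun x => ns.getD x 0, fun a => as.getD a []⟩

theorem mkS_setNum {ns : List ℕ} {as : Msg} {x : ℕ} (hx : x < ns.length) (v : ℕ) :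
    (mkS ns as).setNum x v = mkS (ns.set x v) as := by
  simp only [Store.setNum, mkS, Store.mk.injEq, and_true]
  funext y
  by_cases h : y = x
  · subst h; simp [List.getD_eq_getElem?_getD, hx]
  · simp [List.getD_eq_getElem?_getD, h, List.getElem?_set_ne (Ne.symm h)]

theorem mkS_setArr {ns : List ℕ} {as : Msg} {a : ℕ} (ha : a < as.length) (w : List ℕ) :
    (mkS ns as).setArr a w = mkS ns (as.set a w) := by
  simp only [Store.setArr, mkS, Store.mk.injEq, true_and]
  funext y
  by_cases h : y = a
  · subst h; simp [List.getD_eq_getElem?_getD, ha]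
  · simp [List.getD_eq_getElem?_getD, h, List.getElem?_set_ne (Ne.symm h)]

theorem mkS_receive_one {ns : List ℕ} {as : Msg} {a : ℕ} (ha : a < as.length) (w : List ℕ) :
    (mkS ns as).receive [a] [w] = mkS ns (as.set a w) := by
  rw [← mkS_setArr ha]
  simp only [Store.receive, Store.setArr, mkS, Store.mk.injEq, true_and]
  funext y
  by_cases h : y = a
  · subst h; simp
  · simp [h]

theorem mkS_receive_two {ns : List ℕ} {as : Msg} {a b : ℕ} (ha : a < as.length)
    (hb : b < as.length) (hab : a ≠ b) (v w : List ℕ) :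
    (mkS ns as).receive [a, b] [v, w] = mkS ns ((as.set a v).set b w) := by
  rw [← mkS_setArr (by simpa using hb), ← mkS_setArr ha]
  simp only [Store.receive, Store.setArr, mkS, Store.mk.injEq, true_and]
  funext y
  by_cases h : y = a
  · subst h; simp [hab]
  · by_cases h' : y = b
    · subst h'; simp [h, Ne.symm h]
    · simp [h, h']

theorem mkS_bounded {Z : ℕ} {ns : List ℕ} {as : Msg} (hn : ∀ v ∈ ns, Nat.size v ≤ Z)
    (ha : ∀ w ∈ as, bitLen w ≤ Z) : (mkS ns as).Bounded Z := by
  constructor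
  · intro x
    by_cases h : x < ns.length
    · simp only [mkS]; rw [List.getD_eq_getElem _ _ h]; exact hn _ (List.getElem_mem h)
    · simp only [mkS]; rw [List.getD_eq_default _ _ (not_lt.1 h)]; simp
  · intro x
    by_cases h : x < as.length
    · simp only [mkS]; rw [List.getD_eq_getElem _ _ h]; exact ha _ (List.getElem_mem h)
    · simp only [mkS]; rw [List.getD_eq_default _ _ (not_lt.1 h)]; simp [bitLen]

/-- Append the values of `e`, for `x = 0, …, N - 1`, to the array `a`. -/
def extendCmd (a : ℕ) (N e : Arith) : Cmd :=
  .seq (.loop (.sub N (.var 0)) (.seq (.push a e) (.assign 0 (.add (.var 0) (.lit 1)))))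
    (.assign 0 (.lit 0))

variable {O : Oracle} {Z : ℕ} {Q : Store → Prop}

/-- `hN` and `he` are required for every content `v` of the array `a`, since both expressions are
evaluated while it grows. An entry costs four steps (test, sequencing, `push`, increment), and `n ≤
Z` because each entry has positive bit length. The counter, variable `0`, is zero again at the end.
-/
theorem run_extend {ns : List ℕ} {as : Msg} {a : ℕ} {N e : Arith} (n : ℕ) (g : ℕ → ℕ)
    (w : List ℕ) (ha : a < as.length) (hw : as.getD a [] = w)
    (hN : ∀ i v, N.eval (mkS (i :: ns) (as.set a v)) = n)
    (he : ∀ i v, i < n → e.eval (mkS (i :: ns) (as.set a v)) = g i)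
    (hb : bitLen (w ++ (List.range n).map g) ≤ Z)
    (hQ : Q (mkS (0 :: ns) (as.set a (w ++ (List.range n).map g)))) :
    Run O Z (extendCmd a N e) (mkS (0 :: ns) as) (4 * Z + 3) Q := by
  have hnZ : n ≤ Z := by
    have := length_le_bitLen (w ++ (List.range n).map g)
    simp at this
    omega
  have hloop : Run O Z (.loop (.sub N (.var 0))
      (.seq (.push a e) (.assign 0 (.add (.var 0) (.lit 1))))) (mkS (0 :: ns) as)
      ((3 + 1) * n + 1) fun σ' =>
        Run O Z (.assign 0 (.lit 0)) σ' 1 Q := by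
    refine Run.loop (I := fun j σ => ∃ i, i + j = n ∧
      σ = mkS (i :: ns) (as.set a (w ++ (List.range i).map g))) ?_ ?_ ?_ ?_
    · rintro σ ⟨i, hi, rfl⟩
      simp only [Arith.eval, hN]
      simp [mkS]; omega
    · rintro j σ ⟨i, hi, rfl⟩ -
      refine Run.seq (n := 1) (m := 1) ?_
      have hia : (mkS (i :: ns) (as.set a (w ++ (List.range i).map g))).arr a =
          w ++ (List.range i).map g := by
        simp [mkS, List.getD_eq_getElem?_getD, ha]
      have hnext : w ++ (List.range i).map g ++ [g i] = w ++ (List.range (i + 1)).map g := by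
        rw [List.range_succ, List.map_append, List.append_assoc]; rfl
      refine Run.push ?_ ?_
      · rw [hia, he _ _ (by omega), hnext]
        refine le_trans ?_ hb
        have e : (List.range n).map g = (List.range (i + 1)).map g ++
            ((List.range j).map (i + 1 + ·)).map g := by
          rw [← List.map_append, ← List.range_add, show i + 1 + j = n by omega]
        rw [e, ← List.append_assoc, bitLen_append _ (List.map g (List.map _ _))]
        exact Nat.le_add_right _ _
      · rw [hia, he _ _ (by omega), hnext, mkS_setArr (by simpa using ha), List.set_set]
        refine Run.assign ?_ ?_
        · simp only [Arith.eval, mkS, List.getD_cons_zero]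
          exact (size_le_self _).trans (by omega)
        · rw [mkS_setNum (by simp)]
          exact ⟨j, le_rfl, i + 1, by omega, rfl⟩
    · rintro j σ ⟨i, hi, rfl⟩ h0
      simp only [Arith.eval, hN] at h0
      simp only [mkS, List.getD_cons_zero] at h0
      obtain rfl : i = n := by omega
      refine Run.assign (by simp [Arith.eval]) ?_
      rw [mkS_setNum (by simp)]
      exact hQ
    · refine ⟨0, by omega, ?_⟩
      rw [← mkS_setArr ha]
      simp only [List.range_zero, List.map_nil, List.append_nil]
      rw [mkS_setArr ha, ← hw]
      congr 1
      refine List.ext_getElem (by simp) fun i h1 h2 => ?_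
      by_cases h : a = i
      · subst h; simp [List.getD_eq_getElem?_getD, ha]
      · simp [h]
  exact (Run.seq hloop).weaken (by omega) fun _ h => h

/-- Fill the array `a` with the values of `e`, for `x = 0, …, N - 1`. -/
def fillCmd (a : ℕ) (N e : Arith) : Cmd := .seq (.clear a) (extendCmd a N e)

theorem run_fill {ns : List ℕ} {as : Msg} {a : ℕ} {N e : Arith} (n : ℕ) (g : ℕ → ℕ)
    (ha : a < as.length)
    (hN : ∀ i v, N.eval (mkS (i :: ns) (as.set a v)) = n)
    (he : ∀ i v, i < n → e.eval (mkS (i :: ns) (as.set a v)) = g i)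
    (hb : bitLen ((List.range n).map g) ≤ Z)
    (hQ : Q (mkS (0 :: ns) (as.set a ((List.range n).map g)))) :
    Run O Z (fillCmd a N e) (mkS (0 :: ns) as) (4 * Z + 5) Q := by
  refine (Run.seq (n := 1) (m := 4 * Z + 3) (Run.clear ?_)).weaken (by omega) fun _ h => h
  rw [mkS_setArr ha]
  refine run_extend n g [] (by simpa using ha) (by simp [List.getD_eq_getElem?_getD, ha]) ?_ ?_ hb ?_
  · intro i v; rw [List.set_set]; exact hN i v
  · intro i v; rw [List.set_set]; exact he i v
  · rw [List.set_set]; exact hQ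

end ListStore

/-! ### Stable range conditions for finite rings -/

/-- Bass's first stable range condition. -/
def StableRangeOne (S : Type*) [Ring S] : Prop :=
  ∀ a x : S, ∃ t : S, IsUnit (a + t * (1 - x * a))

/-- Two affine conditions of invertibility can be satisfied simultaneously. -/
def UnitComplement (S : Type*) [Ring S] : Prop :=
  ∀ t c : S, ∃ y : S, IsUnit (t + y) ∧ IsUnit (1 + y * c)

/-! ### Passing to surjections that reflect units, and to products. -/

section Transport

variable {S S' : Type*} [Ring S] [Ring S']

theorem StableRangeOne.of_surjective (f : S →+* S') (hf : Function.Surjective f)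
    (hu : ∀ s, IsUnit (f s) → IsUnit s) (h : StableRangeOne S') : StableRangeOne S := by
  intro a x
  obtain ⟨t, ht⟩ := h (f a) (f x)
  obtain ⟨t, rfl⟩ := hf t
  exact ⟨t, hu _ (by simpa using ht)⟩

theorem UnitComplement.of_surjective (f : S →+* S') (hf : Function.Surjective f)
    (hu : ∀ s, IsUnit (f s) → IsUnit s) (h : UnitComplement S') : UnitComplement S := by
  intro t c
  obtain ⟨y, h1, h2⟩ := h (f t) (f c)
  obtain ⟨y, rfl⟩ := hf y
  exact ⟨y, hu _ (by simpa using h1), hu _ (by simpa using h2)⟩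

theorem UnitComplement.of_ringEquiv (e : S ≃+* S') (h : UnitComplement S') : UnitComplement S :=
  h.of_surjective e.toRingHom e.surjective fun s hs => by simpa using hs

theorem StableRangeOne.pi {ι : Type*} {A : ι → Type*} [∀ i, Ring (A i)]
    (h : ∀ i, StableRangeOne (A i)) : StableRangeOne (∀ i, A i) := by
  intro a x
  choose t ht using fun i => h i (a i) (x i)
  exact ⟨t, Pi.isUnit_iff.2 ht⟩

theorem UnitComplement.pi {ι : Type*} {A : ι → Type*} [∀ i, Ring (A i)]
    (h : ∀ i, UnitComplement (A i)) : UnitComplement (∀ i, A i) := by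
  intro t c
  choose y hy using fun i => h i (t i) (c i)
  exact ⟨y, Pi.isUnit_iff.2 fun i => (hy i).1, Pi.isUnit_iff.2 fun i => (hy i).2⟩

end Transport

/-! ### Both conditions for matrix rings over a field. -/

section MatrixField

open Matrix

variable {F : Type*} [Field F]

theorem exists_units_mul_mul_eq_diagonal {ι : Type*} [Fintype ι] [DecidableEq ι]
    (M : Matrix ι ι F) :
    ∃ (P Q : (Matrix ι ι F)ˣ) (d : ι → F), M = P * diagonal d * Q := by
  obtain ⟨L, L', D, h⟩ := Pivot.exists_list_transvec_mul_diagonal_mul_list_transvec M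
  have key : ∀ L : List (TransvectionStruct ι F),
      IsUnit (L.map TransvectionStruct.toMatrix).prod := fun L => by
    rw [Matrix.isUnit_iff_isUnit_det, TransvectionStruct.det_toMatrix_prod]
    exact isUnit_one
  exact ⟨(key L).unit, (key L').unit, D, h⟩

/-- For diagonal `a` the correction is the projection `τ` onto its kernel. Then `a + τ = δ` is
invertible, `a = e δ` for the complementary projection `e`, and what remains is `(1 - τ x' e) δ`,
where `τ x' e` has square zero because `e τ = 0`. -/
theorem stableRangeOne_matrix_field {ι : Type*} [Fintype ι] [DecidableEq ι] :
    StableRangeOne (Matrix ι ι F) := by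
  classical
  intro a x
  obtain ⟨P, Q, d, rfl⟩ := exists_units_mul_mul_eq_diagonal a
  set τ : Matrix ι ι F := diagonal fun i => if d i = 0 then 1 else 0 with hτ
  set e : Matrix ι ι F := diagonal fun i => if d i = 0 then 0 else 1 with he
  set δ : Matrix ι ι F := diagonal fun i => if d i = 0 then 1 else d i with hδ
  have hδu : IsUnit δ := by
    rw [Matrix.isUnit_diagonal, Pi.isUnit_iff]
    intro i
    by_cases h : d i = 0 <;> simp [h]
  have h1 : diagonal d + τ = δ := by
    rw [hτ, hδ, diagonal_add]; congr 1; ext i; by_cases h : d i = 0 <;> simp [h]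
  have h2 : diagonal d = e * δ := by
    rw [he, hδ, diagonal_mul_diagonal]; congr 1; ext i; by_cases h : d i = 0 <;> simp [h]
  have h3 : e * τ = 0 := by
    rw [he, hτ, diagonal_mul_diagonal, ← diagonal_zero]; congr 1; ext i
    by_cases h : d i = 0 <;> simp [h]
  set x' : Matrix ι ι F := Q * x * P with hx'
  refine ⟨P * τ * Q, ?_⟩
  have h4 : (P : Matrix ι ι F) * diagonal d * Q + P * τ * Q * (1 - x * (P * diagonal d * Q))
      = P * ((1 - τ * x' * e) * δ) * Q := by
    have : (1 - τ * x' * e) * δ = diagonal d + τ - τ * x' * diagonal d := by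
      rw [sub_mul, one_mul, mul_assoc, ← h2, h1]
    rw [this, hx']
    noncomm_ring
  have h5 : IsUnit (1 - τ * x' * e) := by
    refine IsUnit.of_mul_eq_one (1 + τ * x' * e) ?_
    have : τ * x' * e * (τ * x' * e) = 0 := by
      have : τ * x' * e * (τ * x' * e) = τ * x' * (e * τ) * x' * e := by noncomm_ring
      rw [this, h3]; simp
    calc (1 - τ * x' * e) * (1 + τ * x' * e) = 1 - τ * x' * e * (τ * x' * e) := by noncomm_ring
      _ = 1 := by rw [this, sub_zero]
  rw [h4]
  exact (P.isUnit.mul (h5.mul hδu)).mul Q.isUnit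

/-- Size two is essential: over the field with two elements and in size one, `t = 0` forces `y = 1`,
and then `1 + y c = 0` for `c = 1`. -/
theorem exists_two_by_two (t : Matrix (Fin 2) (Fin 2) F) (d : Fin 2 → F) :
    ∃ y : Matrix (Fin 2) (Fin 2) F, (t + y).det ≠ 0 ∧ (1 + y * diagonal d).det ≠ 0 := by
  -- The unknown is `z = t + y`, in terms of which the first condition does not involve `t`.
  suffices h : ∃ z1 z2 z3 z4 : F, z1 * z4 - z2 * z3 ≠ 0 ∧
      (1 + (z1 - t 0 0) * d 0) * (1 + (z4 - t 1 1) * d 1)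
        - (z2 - t 0 1) * d 1 * ((z3 - t 1 0) * d 0) ≠ 0 by
    obtain ⟨z1, z2, z3, z4, h1, h2⟩ := h
    refine ⟨!![z1, z2; z3, z4] - t, ?_, ?_⟩
    · rw [add_sub_cancel, det_fin_two_of]; exact h1
    · rw [det_fin_two]
      simpa [Matrix.mul_apply, Fin.sum_univ_two, diagonal] using h2
  generalize t 0 0 = a
  generalize t 0 1 = b
  generalize t 1 0 = c
  generalize t 1 1 = e
  generalize d 0 = p
  generalize d 1 = q
  by_cases hb : b = 0
  swap
  -- Here `y` has a single nonzero entry, off the diagonal, so the second determinant is `1`; the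
  -- entry is chosen to make the first one `-1`.
  · exact ⟨a, b, (a * e + 1) / b, e, by field_simp; simp, by simp⟩
  by_cases hc : c = 0
  swap
  · exact ⟨a, (a * e + 1) / c, c, e, by field_simp; simp, by simp⟩
  subst hb hc
  by_cases ha : a = 0
  · subst ha
    -- With antidiagonal entries `1` the first determinant is `-1` and the second is `1 - p * q`. If
    -- this vanishes, raising `z4` by one changes the second to `q`, which is then nonzero.
    by_cases hpq : p * q = 1
    · refine ⟨0, 1, 1, e + 1, by simp, ?_⟩
      have hq : q ≠ 0 := right_ne_zero_of_mul_eq_one hpq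
      convert hq using 1
      linear_combination -hpq
    · refine ⟨0, 1, 1, e, by simp, ?_⟩
      intro h
      apply hpq
      linear_combination -h
  by_cases he : e = 0
  · subst he
    by_cases hpq : p * q = 1
    · refine ⟨a + 1, 1, 1, 0, by simp, ?_⟩
      have hq : p ≠ 0 := left_ne_zero_of_mul_eq_one hpq
      convert hq using 1
      linear_combination -hpq
    · refine ⟨a, 1, 1, 0, by simp, ?_⟩
      intro h
      apply hpq
      linear_combination -h
  exact ⟨a, 0, 0, e, by simp [ha, he], by simp⟩

theorem isUnit_of_isUnit_blocks {n : ℕ} {α : Type*} [LinearOrder α] (b : Fin 2 × Fin n → α)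
    (c : Fin n → α) (hc : Function.Injective c) (hb : ∀ p, b p = c p.2)
    (M : Matrix (Fin 2 × Fin n) (Fin 2 × Fin n) F) (hM : M.BlockTriangular b)
    (hd : ∀ k, (Matrix.of fun i j => M (i, k) (j, k)).det ≠ 0) : IsUnit M := by
  rw [Matrix.isUnit_iff_isUnit_det, isUnit_iff_ne_zero, hM.det, Finset.prod_ne_zero_iff]
  intro a ha
  obtain ⟨⟨i, k⟩, -, rfl⟩ := Finset.mem_image.1 ha
  let e : Fin 2 ≃ {p : Fin 2 × Fin n // b p = b (i, k)} :=
    { toFun := fun j => ⟨(j, k), by simp [hb]⟩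
      invFun := fun p => p.1.1
      left_inv := fun j => rfl
      right_inv := by
        rintro ⟨⟨j, l⟩, h⟩
        have : l = k := hc (by simpa [hb] using h)
        subst this; rfl }
  rw [← Matrix.det_submatrix_equiv_self e]
  exact hd k

/-- With `c` made diagonal, both conditions can be made block triangular for `2 × 2` blocks. Above
the block diagonal `y'` cancels `t'` and below it `y'` vanishes, so `t' + y'` is block lower
triangular and `1 + y' * diagonal d` is block upper triangular. Only the diagonal blocks matter, and
`exists_two_by_two` supplies them. -/
theorem unitComplement_matrix_field {n : ℕ} :
    UnitComplement (Matrix (Fin 2 × Fin n) (Fin 2 × Fin n) F) := by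
  intro t c
  obtain ⟨P, Q, d, rfl⟩ := exists_units_mul_mul_eq_diagonal c
  set t' : Matrix (Fin 2 × Fin n) (Fin 2 × Fin n) F := Q * t * P with ht'
  choose y hy1 hy2 using fun k : Fin n =>
    exists_two_by_two (Matrix.of fun i j => t' (i, k) (j, k)) fun i => d (i, k)
  set y' : Matrix (Fin 2 × Fin n) (Fin 2 × Fin n) F := Matrix.of fun p q =>
    if p.2 < q.2 then -t' p q else if h : p.2 = q.2 then y p.2 p.1 q.1 else 0 with hy'
  have h1 : IsUnit (t' + y') := by
    refine isUnit_of_isUnit_blocks (fun p => OrderDual.toDual p.2) OrderDual.toDual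
      OrderDual.toDual.injective (fun _ => rfl) _ ?_ ?_
    · intro p q hpq
      have : p.2 < q.2 := by simpa using hpq
      simp [hy', this]
    · intro k
      convert hy1 k using 2
      ext i j
      simp [hy']
  have h2 : IsUnit (1 + y' * diagonal d) := by
    refine isUnit_of_isUnit_blocks (fun p => p.2) id Function.injective_id (fun _ => rfl) _ ?_ ?_
    · intro p q hpq
      have h1 : ¬ p.2 < q.2 := not_lt.2 (le_of_lt hpq)
      have h2 : ¬ p.2 = q.2 := fun h => by simp [h] at hpq
      have h3 : p ≠ q := fun h => h2 (by rw [h])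
      simp [hy', h1, h2, h3]
    · intro k
      convert hy2 k using 2
      ext i j
      simp [hy', Matrix.one_apply]
  have e2 := P.mul_inv
  have e3 := Q.inv_mul
  have e4 := P.inv_mul
  refine ⟨(↑Q⁻¹ : Matrix (Fin 2 × Fin n) (Fin 2 × Fin n) F) * y' * (↑P⁻¹ : Matrix (Fin 2 × Fin n) (Fin 2 × Fin n) F), ?_, ?_⟩
  · have : t + (↑Q⁻¹ : Matrix (Fin 2 × Fin n) (Fin 2 × Fin n) F) * y' * (↑P⁻¹ : Matrix (Fin 2 × Fin n) (Fin 2 × Fin n) F)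
        = (↑Q⁻¹ : Matrix (Fin 2 × Fin n) (Fin 2 × Fin n) F) * (t' + y') * (↑P⁻¹ : Matrix (Fin 2 × Fin n) (Fin 2 × Fin n) F) := by
      rw [mul_add, add_mul, ht', ← mul_assoc, ← mul_assoc, e3, one_mul, mul_assoc t, e2, mul_one]
    rw [this]
    exact ((Q⁻¹).isUnit.mul h1).mul (P⁻¹).isUnit
  · have : 1 + ((↑Q⁻¹ : Matrix (Fin 2 × Fin n) (Fin 2 × Fin n) F) * y' * (↑P⁻¹ : Matrix (Fin 2 × Fin n) (Fin 2 × Fin n) F)) * (P * diagonal d * Q)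
        = (↑Q⁻¹ : Matrix (Fin 2 × Fin n) (Fin 2 × Fin n) F) * (1 + y' * diagonal d) * Q := by
      rw [mul_add, add_mul, mul_one, e3]
      congr 1
      simp only [mul_assoc]
      rw [← mul_assoc _ (P : Matrix (Fin 2 × Fin n) (Fin 2 × Fin n) F), e4, one_mul]
    rw [this]
    exact ((Q⁻¹).isUnit.mul h2).mul Q.isUnit

end MatrixField

/-! ### From matrix rings over fields to finite rings. -/

section Finite

variable (T : Type) [Ring T] [Finite T]

theorem isUnit_of_mul_isUnit {T : Type*} [Ring T] [Finite T] {a b : T} (h : IsUnit (a * b)) :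
    IsUnit a := by
  obtain ⟨u, hu⟩ := h
  exact IsUnit.of_mul_eq_one (b * ↑u⁻¹) (by rw [← mul_assoc, ← hu, u.mul_inv])

/-- A lift `b` of the inverse gives `a b ∈ 1 + rad T`, which has a left inverse; in a finite ring
one-sided inverses are two-sided. -/
theorem isUnit_of_map_isUnit {T T' : Type*} [Ring T] [Finite T] [Ring T'] (f : T →+* T')
    (hf : Function.Surjective f) (hk : RingHom.ker f ≤ Ideal.jacobson ⊥) {a : T}
    (h : IsUnit (f a)) : IsUnit a := by
  obtain ⟨b', hb⟩ := h.exists_right_inv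
  obtain ⟨b, rfl⟩ := hf b'
  have hm : a * b - 1 ∈ Ideal.jacobson (⊥ : Ideal T) :=
    hk (by rw [RingHom.mem_ker, map_sub, map_mul, hb, map_one, sub_self])
  obtain ⟨z, hz⟩ := Ideal.mem_jacobson_iff.1 hm 1
  have hz : z * (a * b) = 1 := by
    have := (Submodule.mem_bot T).1 hz
    rw [mul_one] at this
    have h2 : z * (a * b - 1) + z - 1 = z * (a * b) - 1 := by noncomm_ring
    rw [h2] at this
    exact sub_eq_zero.1 this
  have : a * b * z = 1 := mul_eq_one_comm.1 hz
  exact isUnit_of_mul_isUnit (IsUnit.of_mul_eq_one z this)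

/-- A finite ring modulo its radical is a product of matrix rings over fields. -/
theorem exists_surjective_pi_matrix_field :
    ∃ (n : ℕ) (D : Fin n → Type) (d : Fin n → ℕ) (_ : ∀ i, Field (D i))
      (f : T →+* ∀ i, Matrix (Fin (d i)) (Fin (d i)) (D i)),
      Function.Surjective f ∧ RingHom.ker f ≤ Ideal.jacobson ⊥ := by
  obtain ⟨n, D, d, hD, hd, ⟨e⟩⟩ :=
    IsSemisimpleRing.exists_ringEquiv_pi_matrix_divisionRing (T ⧸ Ring.jacobson T)
  have hs : Function.Surjective
      (e.toRingHom.comp (Ideal.Quotient.mk (Ring.jacobson T))) :=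
    e.surjective.comp Ideal.Quotient.mk_surjective
  have hfin : Finite (∀ i, Matrix (Fin (d i)) (Fin (d i)) (D i)) := Finite.of_surjective _ hs
  have hfin' : ∀ i, Finite (D i) := fun i => by
    have := hd i
    refine Finite.of_surjective
      (fun M : ∀ i, Matrix (Fin (d i)) (Fin (d i)) (D i) => M i 0 0) fun x => ?_
    classical
    exact ⟨Function.update 0 i (Matrix.of fun _ _ => x), by simp⟩
  refine ⟨n, D, d, fun i => littleWedderburn (D i), ?_⟩
  refine ⟨e.toRingHom.comp (Ideal.Quotient.mk (Ring.jacobson T)), hs, ?_⟩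
  intro x hx
  rw [Ideal.jacobson_bot, ← Ideal.Quotient.eq_zero_iff_mem]
  exact e.injective (by rw [map_zero]; exact hx)

theorem stableRangeOne_of_finite : StableRangeOne T := by
  obtain ⟨n, D, d, _, f, hf, hk⟩ := exists_surjective_pi_matrix_field T
  exact StableRangeOne.of_surjective f hf (fun _ => isUnit_of_map_isUnit f hf hk)
    (StableRangeOne.pi fun i => stableRangeOne_matrix_field)

/-- Entrywise reduction maps `M₂(T)` onto a product of rings `M₂(M_d(F))`, that is, matrices indexed
by `Fin 2 × Fin d`. Its kernel consists of matrices over the radical, which lie in the radical of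
`M₂(T)`. -/
theorem unitComplement_matrix_of_finite : UnitComplement (Matrix (Fin 2) (Fin 2) T) := by
  obtain ⟨n, D, d, _, f, hf, hk⟩ := exists_surjective_pi_matrix_field T
  have hs : Function.Surjective (f.mapMatrix (m := Fin 2)) := fun M => by
    choose N hN using fun i j => hf (M i j)
    exact ⟨Matrix.of N, by ext i j : 2; simp [hN]⟩
  refine UnitComplement.of_surjective f.mapMatrix hs
    (fun _ => isUnit_of_map_isUnit _ hs fun M hM => ?_) ?_
  · have h1 : M ∈ (Ideal.jacobson (⊥ : Ideal T)).matrix (Fin 2) := fun i j =>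
      hk (congrFun (congrFun hM i) j)
    have h2 := Ideal.matrix_jacobson_le _ h1
    rwa [Ideal.matrix_bot] at h2
  · refine UnitComplement.of_ringEquiv Matrix.piRingEquiv (UnitComplement.pi fun i => ?_)
    exact UnitComplement.of_ringEquiv (Matrix.compRingEquiv _ _ _) unitComplement_matrix_field

end Finite

/-! ### Extending homomorphisms from `Sˣ` to `GL₂(S)` -/

section Extension

variable {S : Type*} [Ring S] {A : Type*} [CommGroup A]

/-- The relations `f (1 + xy) = f (1 + yx)`. -/
def Symmetric (f : Sˣ →* A) : Prop :=
  ∀ (x y : S) (u v : Sˣ), (u : S) = 1 + x * y → (v : S) = 1 + y * x → f u = f v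

/-- Upper unitriangular matrices. -/
def upper (s : S) : (Matrix (Fin 2) (Fin 2) S)ˣ where
  val := !![1, s; 0, 1]
  inv := !![1, -s; 0, 1]
  val_inv := by simp [Matrix.one_fin_two]
  inv_val := by simp [Matrix.one_fin_two]

/-- Lower unitriangular matrices. -/
def lower (s : S) : (Matrix (Fin 2) (Fin 2) S)ˣ where
  val := !![1, 0; s, 1]
  inv := !![1, 0; -s, 1]
  val_inv := by simp [Matrix.one_fin_two]
  inv_val := by simp [Matrix.one_fin_two]

/-- Diagonal matrices. -/
def diag2 (p r : Sˣ) : (Matrix (Fin 2) (Fin 2) S)ˣ where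
  val := !![(p : S), 0; 0, (r : S)]
  inv := !![(↑p⁻¹ : S), 0; 0, (↑r⁻¹ : S)]
  val_inv := by simp [Matrix.one_fin_two]
  inv_val := by simp [Matrix.one_fin_two]

/-- The permutation matrix. -/
def swap2 : (Matrix (Fin 2) (Fin 2) S)ˣ where
  val := !![0, 1; 1, 0]
  inv := !![0, 1; 1, 0]
  val_inv := by simp [Matrix.one_fin_two]
  inv_val := by simp [Matrix.one_fin_two]

theorem diag2_mul (p r p' r' : Sˣ) : diag2 p r * diag2 p' r' = diag2 (p * p') (r * r') := by
  ext i j; fin_cases i <;> fin_cases j <;> simp [diag2]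

theorem upper_mul_zero (s : S) (g : (Matrix (Fin 2) (Fin 2) S)ˣ) (j : Fin 2) :
    (upper s * g).1 0 j = g.1 0 j + s * g.1 1 j := by
  simp only [upper, Units.val_mul, Matrix.mul_apply, Fin.sum_univ_two]; simp

theorem upper_mul_one (s : S) (g : (Matrix (Fin 2) (Fin 2) S)ˣ) (j : Fin 2) :
    (upper s * g).1 1 j = g.1 1 j := by
  simp only [upper, Units.val_mul, Matrix.mul_apply, Fin.sum_univ_two]; simp

theorem lower_mul_zero (s : S) (g : (Matrix (Fin 2) (Fin 2) S)ˣ) (j : Fin 2) :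
    (lower s * g).1 0 j = g.1 0 j := by
  simp only [lower, Units.val_mul, Matrix.mul_apply, Fin.sum_univ_two]; simp

theorem lower_mul_one (s : S) (g : (Matrix (Fin 2) (Fin 2) S)ˣ) (j : Fin 2) :
    (lower s * g).1 1 j = s * g.1 0 j + g.1 1 j := by
  simp only [lower, Units.val_mul, Matrix.mul_apply, Fin.sum_univ_two]; simp

theorem mul_upper_zero (s : S) (g : (Matrix (Fin 2) (Fin 2) S)ˣ) (i : Fin 2) :
    (g * upper s).1 i 0 = g.1 i 0 := by
  simp only [upper, Units.val_mul, Matrix.mul_apply, Fin.sum_univ_two]; simp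

theorem mul_upper_one (s : S) (g : (Matrix (Fin 2) (Fin 2) S)ˣ) (i : Fin 2) :
    (g * upper s).1 i 1 = g.1 i 0 * s + g.1 i 1 := by
  simp only [upper, Units.val_mul, Matrix.mul_apply, Fin.sum_univ_two]; simp

theorem diag2_mul_zero (p r : Sˣ) (g : (Matrix (Fin 2) (Fin 2) S)ˣ) (j : Fin 2) :
    (diag2 p r * g).1 0 j = p * g.1 0 j := by
  simp only [diag2, Units.val_mul, Matrix.mul_apply, Fin.sum_univ_two]; simp

theorem diag2_mul_one (p r : Sˣ) (g : (Matrix (Fin 2) (Fin 2) S)ˣ) (j : Fin 2) :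
    (diag2 p r * g).1 1 j = r * g.1 1 j := by
  simp only [diag2, Units.val_mul, Matrix.mul_apply, Fin.sum_univ_two]; simp

theorem lower_add (s t : S) : lower (s + t) = lower s * lower t := by
  ext i j; fin_cases i <;> fin_cases j <;> simp [lower]

theorem lower_zero : lower (0 : S) = 1 := by
  ext i j; fin_cases i <;> fin_cases j <;> simp [lower]

theorem upper_inv (s : S) : (upper s)⁻¹ = upper (-s) := Units.ext rfl

theorem diag2_inv (p r : Sˣ) : (diag2 p r)⁻¹ = diag2 p⁻¹ r⁻¹ := Units.ext rfl

theorem swap2_conj (p r : Sˣ) : swap2 * diag2 p r * swap2⁻¹ = diag2 r p := by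
  rw [mul_inv_eq_iff_eq_mul]
  ext i j; fin_cases i <;> fin_cases j <;> simp [swap2, diag2]

/-- The homomorphism `u ↦ diag(u, 1)`. -/
def diagOne : Sˣ →* (Matrix (Fin 2) (Fin 2) S)ˣ where
  toFun u := diag2 u 1
  map_one' := by ext i j; fin_cases i <;> fin_cases j <;> simp [diag2]
  map_mul' u v := by rw [diag2_mul, mul_one]

/-- The formula for the inverse is suggested by the geometric series: `(1 + x s)⁻¹ = 1 - x (1 + s
x)⁻¹ s`. -/
theorem exists_unit_one_add_mul_comm (x s : S) (u : Sˣ) (hu : (u : S) = 1 + s * x) :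
    ∃ v : Sˣ, (v : S) = 1 + x * s ∧ (↑v⁻¹ : S) = 1 - x * ↑u⁻¹ * s := by
  have h1 : (1 + s * x) * (↑u⁻¹ : S) = 1 := by rw [← hu, u.mul_inv]
  have h2 : (↑u⁻¹ : S) * (1 + s * x) = 1 := by rw [← hu, u.inv_mul]
  refine ⟨⟨1 + x * s, 1 - x * ↑u⁻¹ * s, ?_, ?_⟩, rfl, rfl⟩
  · calc (1 + x * s) * (1 - x * ↑u⁻¹ * s)
        = 1 + x * s - x * ((1 + s * x) * ↑u⁻¹) * s := by noncomm_ring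
      _ = 1 := by rw [h1]; noncomm_ring
  · calc (1 - x * ↑u⁻¹ * s) * (1 + x * s)
        = 1 + x * s - x * (↑u⁻¹ * (1 + s * x)) * s := by noncomm_ring
      _ = 1 := by rw [h2]; noncomm_ring

variable (f : Sˣ →* A)

/-- `DetRel f g α`: Gaussian elimination of the matrix `g` shows that its determinant with respect
to `f` is `α`. -/
def DetRel (g : Matrix (Fin 2) (Fin 2) S) (α : A) : Prop :=
  ∃ (t : S) (p r : Sˣ), (p : S) = g 0 0 + t * g 1 0 ∧
    (r : S) = g 1 1 - g 1 0 * ↑p⁻¹ * (g 0 1 + t * g 1 1) ∧ α = f p * f r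

variable {f}

/-- Replacing `t` by `t' = t + s` multiplies the pivot `p` by `1 + s x` from the left, where `x = c
p⁻¹`, and the Schur complement `r` by `(1 + x s)⁻¹`. Symmetry of `f` makes the two changes cancel.
-/
theorem DetRel.unique (hf : Symmetric f) {g : Matrix (Fin 2) (Fin 2) S} {α α' : A}
    (h : DetRel f g α) (h' : DetRel f g α') : α = α' := by
  obtain ⟨t, p, r, hp, hr, rfl⟩ := h
  obtain ⟨t', p', r', hp', hr', rfl⟩ := h'
  set a := g 0 0
  set b := g 0 1
  set c := g 1 0
  set d := g 1 1
  set x : S := c * ↑p⁻¹ with hx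
  set s : S := t' - t with hs
  have hxp : x * p = c := by rw [hx, mul_assoc, p.inv_mul, mul_one]
  have hu : ((p' * p⁻¹ : Sˣ) : S) = 1 + s * x := by
    rw [Units.val_mul, Units.mul_inv_eq_iff_eq_mul, hp', add_mul, one_mul, mul_assoc, hxp, hp, hs]
    noncomm_ring
  obtain ⟨v, hv, hv'⟩ := exists_unit_one_add_mul_comm x s _ hu
  have hc : c * (↑p'⁻¹ : S) = x * ↑(p' * p⁻¹)⁻¹ := by
    rw [mul_inv_rev, inv_inv, Units.val_mul, ← mul_assoc, hxp]
  have hr2 : (r' : S) = ((v⁻¹ * r : Sˣ) : S) := by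
    have hd : d = r + x * (b + t * d) := by rw [hr]; noncomm_ring
    have hq : (↑(p' * p⁻¹)⁻¹ : S) * (1 + s * x) = 1 := by rw [← hu, Units.inv_mul]
    rw [hr', hc, Units.val_mul, hv']
    set w : S := ↑(p' * p⁻¹)⁻¹
    have e1 : b + t' * d = (1 + s * x) * (b + t * d) + s * r := by
      have : b + t' * d = (b + t * d) + s * d := by rw [hs]; noncomm_ring
      rw [this]
      nth_rewrite 2 [hd]
      noncomm_ring
    rw [e1]
    calc d - x * w * ((1 + s * x) * (b + t * d) + s * r)
        = d - x * (w * (1 + s * x)) * (b + t * d) - x * w * s * r := by noncomm_ring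
      _ = (1 - x * w * s) * r := by rw [hq]; nth_rewrite 1 [hd]; noncomm_ring
  have hr3 : r' = v⁻¹ * r := Units.ext hr2
  have h1 := hf s x (p' * p⁻¹) v hu hv
  rw [hr3, map_mul, map_inv, ← h1, map_mul, map_inv]
  have : f p' * ((f p' * (f p)⁻¹)⁻¹ * f r) = f p * f r := by
    rw [mul_inv, inv_inv]
    calc f p' * ((f p')⁻¹ * f p * f r) = (f p' * (f p')⁻¹) * (f p * f r) := by
          simp only [mul_assoc]
      _ = f p * f r := by rw [mul_inv_cancel, one_mul]
  rw [this]

/-- Clearing the first column and row leaves the diagonal matrix `h`. The diagonal entries of `h *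
h⁻¹` and `h⁻¹ * h` then show that the Schur complement is a unit. -/
theorem exists_factorization (g : (Matrix (Fin 2) (Fin 2) S)ˣ) (t : S) (p : Sˣ)
    (hp : (p : S) = g.1 0 0 + t * g.1 1 0) :
    ∃ r : Sˣ, (r : S) = g.1 1 1 - g.1 1 0 * ↑p⁻¹ * (g.1 0 1 + t * g.1 1 1) ∧
      g = upper (-t) * lower (g.1 1 0 * ↑p⁻¹) * diag2 p r *
        upper (↑p⁻¹ * (g.1 0 1 + t * g.1 1 1)) := by
  set r₀ : S := g.1 1 1 - g.1 1 0 * ↑p⁻¹ * (g.1 0 1 + t * g.1 1 1) with hr₀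
  set h : (Matrix (Fin 2) (Fin 2) S)ˣ :=
    lower (-(g.1 1 0 * ↑p⁻¹)) * upper t * g * upper (-(↑p⁻¹ * (g.1 0 1 + t * g.1 1 1))) with hh
  set x : S := g.1 1 0 * ↑p⁻¹ with hx
  set β : S := g.1 0 1 + t * g.1 1 1 with hβ
  have hxp : x * (g.1 0 0 + t * g.1 1 0) = g.1 1 0 := by
    rw [← hp, hx, mul_assoc, p.inv_mul, mul_one]
  have e00 : h.1 0 0 = p := by
    rw [hh, mul_upper_zero, mul_assoc, lower_mul_zero, upper_mul_zero, hp]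
  have e10 : h.1 1 0 = 0 := by
    rw [hh, mul_upper_zero, mul_assoc, lower_mul_one, upper_mul_zero, upper_mul_one, neg_mul, hxp,
      neg_add_cancel]
  have e01 : h.1 0 1 = 0 := by
    rw [hh, mul_upper_one, mul_assoc, lower_mul_zero, lower_mul_zero, upper_mul_zero,
      upper_mul_zero, ← hp, mul_neg, ← mul_assoc, p.mul_inv, one_mul, neg_add_cancel]
  have e11 : h.1 1 1 = r₀ := by
    rw [hh, mul_upper_one, mul_assoc, lower_mul_one, lower_mul_one, upper_mul_zero,
      upper_mul_zero, upper_mul_one, upper_mul_one, neg_mul, hxp, neg_add_cancel, hr₀, ← hβ]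
    noncomm_ring
  have i1 := congrFun (congrFun h.mul_inv 1) 1
  have i2 := congrFun (congrFun h.inv_mul 1) 1
  rw [Matrix.mul_apply, Fin.sum_univ_two] at i1 i2
  rw [e10, e11, zero_mul, zero_add, Matrix.one_apply_eq] at i1
  rw [e01, e11, mul_zero, zero_add, Matrix.one_apply_eq] at i2
  refine ⟨⟨r₀, _, i1, i2⟩, rfl, ?_⟩
  have hd : h = diag2 p ⟨r₀, _, i1, i2⟩ := by
    ext i j
    fin_cases i <;> fin_cases j <;> simp [diag2, e00, e01, e10, e11]
  rw [← hd, hh]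
  have u1 : ∀ s : S, upper (-s) * upper s = 1 := fun s => by
    ext i j; fin_cases i <;> fin_cases j <;> simp [upper]
  have u2 : ∀ s : S, lower s * lower (-s) = 1 := fun s => by
    ext i j; fin_cases i <;> fin_cases j <;> simp [lower]
  generalize (↑p⁻¹ : S) * β = y
  calc g = upper (-t) * (lower x * lower (-x)) * upper t * g * (upper (-y) * upper y) := by
        rw [u1, u2, mul_one, mul_one, u1, one_mul]
    _ = _ := by simp only [mul_assoc]

/-- The corner entry of `g⁻¹ g = 1` reads `1 - (g⁻¹)₀₀ g₀₀ = (g⁻¹)₀₁ g₁₀`, so the correction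
provided by stable range one is a left multiple of `g₁₀`. -/
theorem exists_unit_add_mul (hS : StableRangeOne S) (g : (Matrix (Fin 2) (Fin 2) S)ˣ) :
    ∃ (t : S) (p : Sˣ), (p : S) = g.1 0 0 + t * g.1 1 0 := by
  have h := congrFun (congrFun g.inv_mul 0) 0
  rw [Matrix.mul_apply, Fin.sum_univ_two, Matrix.one_apply_eq] at h
  obtain ⟨t, u, hu⟩ := hS (g.1 0 0) (g.inv 0 0)
  refine ⟨t * g.inv 0 1, u, ?_⟩
  rw [hu, mul_assoc]
  congr 2
  rw [sub_eq_iff_eq_add', ← h]; rfl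

theorem exists_gauss (hS : StableRangeOne S) (g : (Matrix (Fin 2) (Fin 2) S)ˣ) :
    ∃ (t x y : S) (p r : Sˣ), g = upper t * lower x * diag2 p r * upper y := by
  obtain ⟨t, p, hp⟩ := exists_unit_add_mul hS g
  obtain ⟨r, -, h⟩ := exists_factorization g t p hp
  exact ⟨_, _, _, p, r, h⟩

theorem exists_detRel (hS : StableRangeOne S) (f : Sˣ →* A) (g : (Matrix (Fin 2) (Fin 2) S)ˣ) :
    ∃ α, DetRel f g.1 α := by
  obtain ⟨t, p, hp⟩ := exists_unit_add_mul hS g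
  obtain ⟨r, hr, -⟩ := exists_factorization g t p hp
  exact ⟨_, t, p, r, hp, hr, rfl⟩

theorem DetRel.upper_mul {g : (Matrix (Fin 2) (Fin 2) S)ˣ} {α : A} (s : S)
    (h : DetRel f g.1 α) : DetRel f (upper s * g).1 α := by
  obtain ⟨t, p, r, hp, hr, rfl⟩ := h
  refine ⟨t - s, p, r, ?_, ?_, rfl⟩
  · rw [hp, upper_mul_zero, upper_mul_one]; noncomm_ring
  · rw [hr, upper_mul_zero, upper_mul_one, upper_mul_one]; noncomm_ring

theorem DetRel.diag2_mul {g : (Matrix (Fin 2) (Fin 2) S)ˣ} {α : A} (p₀ r₀ : Sˣ)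
    (h : DetRel f g.1 α) : DetRel f (diag2 p₀ r₀ * g).1 (f p₀ * f r₀ * α) := by
  obtain ⟨t, p, r, hp, hr, rfl⟩ := h
  refine ⟨p₀ * t * ↑r₀⁻¹, p₀ * p, r₀ * r, ?_, ?_, ?_⟩
  · rw [Units.val_mul, hp, diag2_mul_zero, diag2_mul_one]
    simp [mul_add, mul_assoc]
  · rw [diag2_mul_zero, diag2_mul_one, diag2_mul_one, Units.val_mul, hr, mul_inv_rev,
      Units.val_mul]
    simp [mul_add, mul_sub, mul_assoc]
  · rw [map_mul, map_mul, mul_mul_mul_comm]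

/-- If `k = 1 - s t₁` is a unit, an elimination of `g` with parameter `t₁` yields one of `lower s *
g` with parameter `t₁ k⁻¹`: the pivot is multiplied by `(1 - t₁ s)⁻¹` and the Schur complement by
`k`, and `f` takes the same value on `k` and `1 - t₁ s`. `UnitComplement` allows the passage from
the given `t` to such a `t₁`, and `DetRel.unique` shows that this does not change the determinant.
-/
theorem DetRel.lower_mul (hP : UnitComplement S) (hf : Symmetric f)
    {g : (Matrix (Fin 2) (Fin 2) S)ˣ} {α : A} (s : Sˣ)
    (h : DetRel f g.1 α) : DetRel f (lower (s : S) * g).1 α := by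
  obtain ⟨t, p, r, hp, hr, rfl⟩ := id h
  -- For `t₁ = t + τ` the first condition makes `t₁ - s⁻¹`, hence `1 - s t₁`, a unit; the second
  -- makes the new pivot `(1 + τ c p⁻¹) p` a unit.
  obtain ⟨τ, ⟨k', hk'⟩, ⟨q, hq⟩⟩ := hP (t - ↑s⁻¹) (g.1 1 0 * ↑p⁻¹)
  obtain ⟨t₁, ht₁⟩ : ∃ t₁, t₁ = t + τ := ⟨_, rfl⟩
  obtain ⟨p₁, hpp₁⟩ : ∃ p₁, p₁ = q * p := ⟨_, rfl⟩
  have hp₁ : (p₁ : S) = g.1 0 0 + t₁ * g.1 1 0 := by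
    rw [hpp₁, Units.val_mul, hq, add_mul, one_mul, mul_assoc τ, mul_assoc (g.1 1 0),
      p.inv_mul, mul_one, hp, ht₁]
    noncomm_ring
  obtain ⟨r₁, hr₁, -⟩ := exists_factorization g t₁ p₁ hp₁
  have hα := h.unique hf ⟨t₁, p₁, r₁, hp₁, hr₁, rfl⟩
  rw [hα]
  obtain ⟨k, hkk'⟩ : ∃ k, k = -(s * k') := ⟨_, rfl⟩
  have hk : (k : S) = 1 + s * -t₁ := by
    rw [hkk', Units.val_neg, Units.val_mul, hk', ht₁, mul_add, mul_sub, s.mul_inv]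
    noncomm_ring
  obtain ⟨m', hm', hm⟩ := exists_unit_one_add_mul_comm (-t₁) s k hk
  have hfm : f m' = f k := hf _ _ _ _ hm' hk
  have hm2 : (↑m'⁻¹ : S) = 1 + t₁ * ↑k⁻¹ * s := by rw [hm]; noncomm_ring
  have hkk : (↑k⁻¹ : S) * (1 + s * -t₁) = 1 := by rw [← hk, k.inv_mul]
  have e2 : t₁ * (↑k⁻¹ : S) = t₁ + t₁ * ↑k⁻¹ * s * t₁ := by
    calc t₁ * (↑k⁻¹ : S) = t₁ * (↑k⁻¹ * (1 + s * -t₁)) + t₁ * ↑k⁻¹ * s * t₁ := by noncomm_ring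
      _ = _ := by rw [hkk, mul_one]
  have e3 : ∀ a c : S, a + t₁ * ↑k⁻¹ * (s * a + c) = ↑m'⁻¹ * (a + t₁ * c) := fun a c => by
    calc a + t₁ * ↑k⁻¹ * (s * a + c) = a + t₁ * ↑k⁻¹ * s * a + (t₁ * ↑k⁻¹) * c := by noncomm_ring
      _ = a + t₁ * ↑k⁻¹ * s * a + (t₁ + t₁ * ↑k⁻¹ * s * t₁) * c := by rw [← e2]
      _ = _ := by rw [hm2]; noncomm_ring
  refine ⟨t₁ * ↑k⁻¹, m'⁻¹ * p₁, k * r₁, ?_, ?_, ?_⟩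
  · rw [Units.val_mul, hp₁, lower_mul_zero, lower_mul_one, e3]
  · rw [lower_mul_zero, lower_mul_one, lower_mul_one, e3, mul_inv_rev, inv_inv, Units.val_mul,
      Units.val_mul, hr₁]
    have e4 : s * g.1 0 0 + g.1 1 0 = s * p₁ + k * g.1 1 0 := by
      rw [hp₁, hk]; noncomm_ring
    rw [e4]
    set β := g.1 0 1 + t₁ * g.1 1 1 with hβ
    have e5 : (s * p₁ + k * g.1 1 0) * ((↑p₁⁻¹ : S) * m') * ((↑m'⁻¹ : S) * β)
        = s * (p₁ * ↑p₁⁻¹) * (m' * ↑m'⁻¹) * β + k * g.1 1 0 * ↑p₁⁻¹ * (m' * ↑m'⁻¹) * β := by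
      noncomm_ring
    rw [e5, p₁.mul_inv, m'.mul_inv, mul_one, mul_one, mul_one]
    have e6 : s * g.1 0 1 + g.1 1 1 = s * β + k * g.1 1 1 := by rw [hβ, hk]; noncomm_ring
    rw [e6]
    noncomm_ring
  · rw [map_mul, map_mul, map_inv, hfm]
    calc f p₁ * f r₁ = ((f k)⁻¹ * f k) * (f p₁ * f r₁) := by rw [inv_mul_cancel, one_mul]
      _ = _ := mul_mul_mul_comm _ _ _ _

/-- A symmetric homomorphism on the units of `S` extends to `GL₂(S)`. -/
theorem exists_extension (hS : StableRangeOne S) (hP : UnitComplement S)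
    (hU : ∀ s : S, s ∈ AddSubmonoid.closure {u : S | IsUnit u}) (hf : Symmetric f) :
    ∃ F : (Matrix (Fin 2) (Fin 2) S)ˣ →* A, ∀ g α, DetRel f g.1 α → F g = α := by
  choose F hF using exists_detRel hS f
  have hF' : ∀ g α, DetRel f g.1 α → F g = α := fun g α h => (hF g).unique hf h
  have h1 : F 1 = 1 := hF' 1 1 ⟨0, 1, 1, by simp, by simp, by simp⟩
  -- The `h` with this property for all `g` are closed under products, so the Gauss factors suffice.
  -- For lower matrices it is enough to treat unit entries, because units generate `S` additively.
  have key : ∀ h g, F (h * g) = F h * F g := by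
    have hmul : ∀ h₁ h₂, (∀ g, F (h₁ * g) = F h₁ * F g) → (∀ g, F (h₂ * g) = F h₂ * F g) →
        ∀ g, F (h₁ * h₂ * g) = F (h₁ * h₂) * F g := fun h₁ h₂ a b g => by
      rw [mul_assoc, a, b, a, mul_assoc]
    have hu : ∀ s g, F (upper s * g) = F (upper s) * F g := fun s g => by
      have : F (upper s) = 1 := by
        have := hF' _ _ ((hF 1).upper_mul s)
        rwa [mul_one, h1] at this
      rw [this, one_mul]
      exact hF' _ _ ((hF g).upper_mul s)
    have hd : ∀ p r g, F (diag2 p r * g) = F (diag2 p r) * F g := fun p r g => by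
      have : F (diag2 p r) = f p * f r := by
        have := hF' _ _ ((hF 1).diag2_mul p r)
        rwa [mul_one, h1, mul_one] at this
      rw [this]
      exact hF' _ _ ((hF g).diag2_mul p r)
    have hl : ∀ s g, F (lower s * g) = F (lower s) * F g := by
      intro s
      induction hU s using AddSubmonoid.closure_induction with
      | mem s hs =>
        intro g
        obtain ⟨s, rfl⟩ := hs
        have : F (lower (s : S)) = 1 := by
          have := hF' _ _ ((hF 1).lower_mul hP hf s)
          rwa [mul_one, h1] at this
        rw [this, one_mul]
        exact hF' _ _ ((hF g).lower_mul hP hf s)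
      | zero => intro g; rw [lower_zero, one_mul, h1, one_mul]
      | add s t _ _ h₁ h₂ => rw [lower_add]; exact hmul _ _ h₁ h₂
    intro h
    obtain ⟨t, x, y, p, r, rfl⟩ := exists_gauss hS h
    exact hmul _ _ (hmul _ _ (hmul _ _ (hu t) (hl x)) (hd p r)) (hu y)
  exact ⟨⟨⟨F, h1⟩, key⟩, hF'⟩

variable {F : (Matrix (Fin 2) (Fin 2) S)ˣ →* A}

theorem extension_diagOne (hF : ∀ g α, DetRel f g.1 α → F g = α) (u : Sˣ) :
    F (diagOne u) = f u :=
  hF _ _ ⟨0, u, 1, by simp [diagOne, diag2], by simp [diagOne, diag2], by simp⟩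

/-- The extension is again symmetric. -/
theorem extension_symmetric (hS : StableRangeOne S) (hf : Symmetric f)
    (hF : ∀ g α, DetRel f g.1 α → F g = α) : Symmetric F := by
  -- products of a column and a row
  have hrank : ∀ (b₁ b₂ c₁ c₂ : S) (v : Sˣ) (g : (Matrix (Fin 2) (Fin 2) S)ˣ),
      (v : S) = 1 + (c₁ * b₁ + c₂ * b₂) →
      g.1 = !![1 + b₁ * c₁, b₁ * c₂; b₂ * c₁, 1 + b₂ * c₂] → IsUnit (1 + b₁ * c₁) →
      F g = f v := by
    rintro b₁ b₂ c₁ c₂ v g hv hg ⟨w, hw⟩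
    -- Symmetry of `f` is used twice: for the pivot, `w = 1 + b₁ c₁` and `w' = 1 + c₁ b₁`, and for
    -- the Schur complement, `r = 1 + b₂ (w'⁻¹ c₂)` and `r' = 1 + (w'⁻¹ c₂) b₂`. The product `w' *
    -- r'` is `v`.
    obtain ⟨w', hw', hw''⟩ := exists_unit_one_add_mul_comm c₁ b₁ w hw
    obtain ⟨r, hr, -⟩ := exists_factorization g 0 w (by rw [hg]; simp [hw])
    rw [hF g _ ⟨0, w, r, by rw [hg]; simp [hw], hr, rfl⟩, hf _ _ w w' hw hw', ← map_mul]
    have hr' : (r : S) = 1 + b₂ * (↑w'⁻¹ * c₂) := by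
      rw [hr, hg, hw'']; simp; noncomm_ring
    obtain ⟨r', hr1, -⟩ := exists_unit_one_add_mul_comm (↑w'⁻¹ * c₂) b₂ r hr'
    rw [map_mul, hf _ _ r r' hr' hr1, ← map_mul]
    congr 1
    ext
    rw [Units.val_mul, hr1, hv, mul_add, mul_one, ← mul_assoc, ← mul_assoc, w'.mul_inv, one_mul, hw']
    abel
  -- a conjugate has an invertible entry
  have hconj : ∀ X Y : Matrix (Fin 2) (Fin 2) S, ∀ u v : (Matrix (Fin 2) (Fin 2) S)ˣ,
      u.1 = 1 + X * Y → v.1 = 1 + Y * X → ∃ X' Y', ∃ v' : (Matrix (Fin 2) (Fin 2) S)ˣ,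
        F v' = F v ∧ u.1 = 1 + X' * Y' ∧ v'.1 = 1 + Y' * X' ∧ IsUnit (v'.1 0 0) := by
    intro X Y u v hu hv
    obtain ⟨z, p, hp⟩ := exists_unit_add_mul hS v
    refine ⟨X * (upper z)⁻¹.1, (upper z).1 * Y, upper z * v * (upper z)⁻¹, ?_, ?_, ?_, ?_⟩
    · rw [map_mul, map_mul, mul_right_comm, ← map_mul, mul_inv_cancel, map_one, one_mul]
    · rw [hu, mul_assoc, ← mul_assoc _ _ Y, Units.inv_mul, one_mul]
    · rw [Units.val_mul, Units.val_mul, hv, mul_add, add_mul, mul_one, Units.mul_inv]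
      simp only [mul_assoc]
    · rw [upper_inv, mul_upper_zero, upper_mul_zero, ← hp]
      exact p.isUnit
  -- Conjugation by `upper z` makes the corner invertible. It replaces the column `b` and the row
  -- `c` by others with the same scalar product `c b`, and `F` does not change since its target is
  -- abelian.
  have hrank' : ∀ (b₁ b₂ c₁ c₂ : S) (v : Sˣ) (g : (Matrix (Fin 2) (Fin 2) S)ˣ),
      (v : S) = 1 + (c₁ * b₁ + c₂ * b₂) →
      g.1 = !![1 + b₁ * c₁, b₁ * c₂; b₂ * c₁, 1 + b₂ * c₂] → F g = f v := by
    intro b₁ b₂ c₁ c₂ v g hv hg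
    obtain ⟨z, p, hp⟩ := exists_unit_add_mul hS g
    have e : F g = F (upper z * g * upper (-z)) := by
      rw [← upper_inv, map_mul, map_mul, mul_right_comm, ← map_mul, mul_inv_cancel, map_one, one_mul]
    have h00 : (upper z * g * upper (-z)).1 0 0 = p := by
      rw [mul_upper_zero, upper_mul_zero, hp]
    have hm : (upper z * g * upper (-z)).1 = !![1 + (b₁ + z * b₂) * c₁,
        (b₁ + z * b₂) * (c₂ - c₁ * z); b₂ * c₁, 1 + b₂ * (c₂ - c₁ * z)] := by
      ext i j
      fin_cases i <;> fin_cases j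
      · show (upper z * g * upper (-z)).1 0 0 = _
        rw [mul_upper_zero, upper_mul_zero, hg]; simp; noncomm_ring
      · show (upper z * g * upper (-z)).1 0 1 = _
        rw [mul_upper_one, upper_mul_zero, upper_mul_zero, hg]; simp; noncomm_ring
      · show (upper z * g * upper (-z)).1 1 0 = _
        rw [mul_upper_zero, upper_mul_one, hg]; simp
      · show (upper z * g * upper (-z)).1 1 1 = _
        rw [mul_upper_one, upper_mul_one, upper_mul_one, hg]; simp; noncomm_ring
    rw [e]
    refine hrank (b₁ + z * b₂) b₂ c₁ (c₂ - c₁ * z) v _ ?_ hm ?_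
    · rw [hv]; noncomm_ring
    · have : 1 + (b₁ + z * b₂) * c₁ = p := by rw [← h00, hm]; simp
      rw [this]; exact p.isUnit
  intro X Y u v hu hv
  obtain ⟨X, Y, v, hv', hu, hv, w, hw⟩ := hconj X Y u v hu hv
  rw [← hv']
  clear hv'
  have hw1 : (w : S) = 1 + (Y 0 0 * X 0 0 + Y 0 1 * X 1 0) := by
    rw [hw, hv]; simp [Matrix.mul_apply, Fin.sum_univ_two]
  -- `X Y` is the sum of two products of a column and a row. Write `g₁` for `1` plus the first of
  -- them; then `g₁⁻¹ u` is again `1` plus a column times a row. The values of `F` at `g₁` and `g₁⁻¹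
  -- u` are those of `f` at the pivot and at the Schur complement of `v = 1 + Y X`, whose product is
  -- `F v`.
  obtain ⟨g₁, hg₁, hg₁'⟩ := exists_unit_one_add_mul_comm
    (!![X 0 0, 0; X 1 0, 0] : Matrix (Fin 2) (Fin 2) S) !![Y 0 0, Y 0 1; 0, 0] (diag2 w 1) (by
      ext i j; fin_cases i <;> fin_cases j <;> simp [diag2, hw1])
  rw [diag2_inv] at hg₁'
  have h₁ : F g₁ = f w := hrank' _ _ _ _ w g₁ hw1 (by
    rw [hg₁]; ext i j; fin_cases i <;> fin_cases j <;> simp)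
  have h₂ : u.1 = g₁.1 + X * !![0, 0; Y 1 0, Y 1 1] := by
    rw [hu, hg₁]
    ext i j
    fin_cases i <;> fin_cases j <;> simp [Matrix.mul_apply, Fin.sum_univ_two, add_assoc]
  have h₃ : (g₁⁻¹ * u).1 = 1 + g₁⁻¹.1 * (X * !![0, 0; Y 1 0, Y 1 1]) := by
    rw [Units.val_mul, h₂, mul_add, Units.inv_mul]
  obtain ⟨r, hr, -⟩ := exists_factorization v 0 w (by simp [hw])
  have h₄ : F (g₁⁻¹ * u) = f r := by
    refine hrank' (g₁⁻¹.1 0 0 * X 0 1 + g₁⁻¹.1 0 1 * X 1 1)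
      (g₁⁻¹.1 1 0 * X 0 1 + g₁⁻¹.1 1 1 * X 1 1) (Y 1 0) (Y 1 1) r _ ?_ ?_
    · rw [hr, hv, hg₁']
      simp [Matrix.mul_apply, Fin.sum_univ_two, diag2]
      noncomm_ring
    · rw [h₃]
      ext i j
      fin_cases i <;> fin_cases j <;>
        simp [Matrix.mul_apply, Fin.sum_univ_two, add_mul, mul_assoc]
  rw [hF v _ ⟨0, w, r, by simp [hw], hr, rfl⟩, ← h₁, ← h₄, ← map_mul, mul_inv_cancel_left]

end Extension

/-! ### The kernel of `Rˣ → K₁(R)` -/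

section Doubling

variable {S : Type*} [Ring S] {A : Type*} [CommGroup A]

/-- An elementary matrix is `1 + X Y` with `Y X = 0`. In contrast to `of_upper_eq_one`, this needs
no special unit of `S`. -/
theorem Symmetric.map_upper {F : (Matrix (Fin 2) (Fin 2) S)ˣ →* A} (hF : Symmetric F) (s : S) :
    F (upper s) = 1 := by
  rw [← map_one F]
  refine hF !![0, s; 0, 0] !![0, 0; 0, 1] _ _ ?_ ?_ <;>
  · ext i j; fin_cases i <;> fin_cases j <;> simp [upper]

theorem Symmetric.map_lower {F : (Matrix (Fin 2) (Fin 2) S)ˣ →* A} (hF : Symmetric F) (s : S) :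
    F (lower s) = 1 := by
  rw [← map_one F]
  refine hF !![0, 0; s, 0] !![1, 0; 0, 0] _ _ ?_ ?_ <;>
  · ext i j; fin_cases i <;> fin_cases j <;> simp [lower]

theorem Symmetric.comp {B : Type*} [CommGroup B] {f : Sˣ →* A} (hf : Symmetric f) (g : A →* B) :
    Symmetric (g.comp f) := fun x y u v hu hv => congrArg g (hf x y u v hu hv)

theorem Symmetric.comp_ringEquiv {S' : Type*} [Ring S'] {f : Sˣ →* A} (hf : Symmetric f)
    (e : S' ≃+* S) : Symmetric (f.comp (Units.mapEquiv e.toMulEquiv).toMonoidHom) :=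
  fun x y u v hu hv => hf (e x) (e y) _ _ (by simp [hu]) (by simp [hv])

/-- Only the diagonal Gauss factor survives, and conjugation by `swap2` moves its second entry to
the first place. -/
theorem exists_map_eq_diagOne (hS : StableRangeOne S) (F : (Matrix (Fin 2) (Fin 2) S)ˣ →* A)
    (hu : ∀ s, F (upper s) = 1) (hl : ∀ s, F (lower s) = 1) (g : (Matrix (Fin 2) (Fin 2) S)ˣ) :
    ∃ h : Sˣ, F g = F (diagOne h) := by
  obtain ⟨t, x, y, p, r, rfl⟩ := exists_gauss hS g
  refine ⟨p * r, ?_⟩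
  have h1 : F (diag2 1 r) = F (diag2 r 1) := by
    rw [← swap2_conj, map_mul, map_mul, mul_right_comm, ← map_mul, mul_inv_cancel, map_one, one_mul]
  have h2 : diag2 p r = diag2 p 1 * diag2 1 r := by rw [diag2_mul, mul_one, one_mul]
  rw [map_mul, map_mul, map_mul, hu, hl, hu, one_mul, one_mul, mul_one, h2, map_mul, h1, ← map_mul]
  congr 1
  rw [diag2_mul, mul_one]; rfl

/-- The commutator of `diag(p, 1)` and `upper y` is `upper (p y - y)`, which is `upper s` for `y =
q⁻¹ s`. -/
theorem of_upper_eq_one (p q : Sˣ) (hq : (q : S) = p - 1) (s : S) :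
    (Abelianization.of (upper s) : Abelianization (Matrix (Fin 2) (Fin 2) S)ˣ) = 1 := by
  have h : upper s = diag2 p 1 * upper (↑q⁻¹ * s) * (diag2 p 1)⁻¹ * (upper (↑q⁻¹ * s))⁻¹ := by
    rw [eq_mul_inv_iff_mul_eq, eq_mul_inv_iff_mul_eq]
    have hs : s = q * (↑q⁻¹ * s) := by rw [← mul_assoc, q.mul_inv, one_mul]
    ext i j
    fin_cases i <;> fin_cases j <;> simp [upper, diag2]
    nth_rewrite 2 [hs]
    rw [hq]
    noncomm_ring
  have h2 : (Abelianization.of (upper s) : Abelianization (Matrix (Fin 2) (Fin 2) S)ˣ) =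
      Abelianization.of (diag2 p 1) * (Abelianization.of (diag2 p 1))⁻¹ *
        (Abelianization.of (upper (↑q⁻¹ * s)) * (Abelianization.of (upper (↑q⁻¹ * s)))⁻¹) := by
    conv_lhs => rw [h]
    rw [map_mul, map_mul, map_mul, map_inv, map_inv, mul_right_comm (Abelianization.of (diag2 p 1)),
      mul_assoc]
  rw [h2, mul_inv_cancel, mul_inv_cancel, one_mul]

theorem of_lower_eq_one (p q : Sˣ) (hq : (q : S) = p - 1) (s : S) :
    (Abelianization.of (lower s) : Abelianization (Matrix (Fin 2) (Fin 2) S)ˣ) = 1 := by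
  have h : lower s = swap2 * upper s * swap2⁻¹ := by
    rw [eq_mul_inv_iff_mul_eq]
    ext i j
    fin_cases i <;> fin_cases j <;> simp [upper, lower, swap2]
  rw [h, map_mul, map_mul, of_upper_eq_one p q hq, mul_one, ← map_mul, mul_inv_cancel, map_one]

/-- For `u = 1 + x y` and `v = 1 + y x` the matrix `upper x * lower y` has the Gauss decomposition
with diagonal part `diag(u, v⁻¹)`. As elementary matrices vanish in the abelianization, so does this
diagonal matrix. -/
theorem symmetric_of_diagOne (p q : Sˣ) (hq : (q : S) = p - 1) :
    Symmetric ((Abelianization.of : (Matrix (Fin 2) (Fin 2) S)ˣ →* _).comp diagOne) := by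
  intro x y u v hu hv
  have h : upper x * lower y = lower (y * ↑u⁻¹) * diag2 u v⁻¹ * upper (↑u⁻¹ * x) := by
    have hv' : (↑v⁻¹ : S) = 1 - y * ↑u⁻¹ * x := by
      obtain ⟨w, hw, hw'⟩ := exists_unit_one_add_mul_comm y x u hu
      have : w = v := Units.ext (by rw [hw, hv])
      rw [← this, hw']
    ext i j
    fin_cases i <;> fin_cases j <;>
      simp [upper, lower, diag2]
    · exact hu.symm
    · rw [hv']; noncomm_ring
  have h2 := congrArg (Abelianization.of : (Matrix (Fin 2) (Fin 2) S)ˣ →* _) h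
  simp only [map_mul, of_upper_eq_one p q hq, of_lower_eq_one p q hq, one_mul, mul_one] at h2
  have h3 : diag2 u v⁻¹ = diag2 u 1 * (swap2 * diag2 v 1 * swap2⁻¹)⁻¹ := by
    rw [swap2_conj, diag2_inv, diag2_mul, inv_one, mul_one, one_mul]
  rw [h3, map_mul, map_inv, map_mul, map_mul, mul_right_comm, ← map_mul, mul_inv_cancel, map_one,
    one_mul, eq_comm, mul_inv_eq_one] at h2
  exact h2

end Doubling

/-! ### Units in rings of `2 × 2` matrices over an arbitrary ring. -/

section MatrixUnits

variable {T : Type*} [Ring T]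

/-- A unit `p` of `M₂(T)` such that `p - 1` is a unit. -/
def fibUnit : (Matrix (Fin 2) (Fin 2) T)ˣ where
  val := !![1, 1; 1, 0]
  inv := !![0, 1; 1, -1]
  val_inv := by simp [Matrix.one_fin_two]
  inv_val := by simp [Matrix.one_fin_two]

theorem fibUnit_inv_eq : ((fibUnit⁻¹ : (Matrix (Fin 2) (Fin 2) T)ˣ) : Matrix (Fin 2) (Fin 2) T)
    = (fibUnit : (Matrix (Fin 2) (Fin 2) T)ˣ).1 - 1 := by
  show (!![0, 1; 1, -1] : Matrix (Fin 2) (Fin 2) T) = !![1, 1; 1, 0] - 1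
  ext i j; fin_cases i <;> fin_cases j <;> simp

theorem mem_closure_isUnit (s : Matrix (Fin 2) (Fin 2) T) :
    s ∈ AddSubmonoid.closure {u : Matrix (Fin 2) (Fin 2) T | IsUnit u} := by
  have h1 : IsUnit !![s 0 0, 1; 1, 0] :=
    ⟨⟨_, !![0, 1; 1, -s 0 0], by simp [Matrix.one_fin_two], by simp [Matrix.one_fin_two]⟩, rfl⟩
  have h2 : IsUnit !![0, -1; -1, s 1 1] :=
    ⟨⟨_, !![-s 1 1, -1; -1, 0], by simp [Matrix.one_fin_two], by simp [Matrix.one_fin_two]⟩, rfl⟩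
  -- The two summands `-1` remove the diagonals of the two elementary matrices.
  have h3 : s = !![s 0 0, 1; 1, 0] + !![0, -1; -1, s 1 1] + (upper (s 0 1)).1 + (lower (s 1 0)).1
      + -1 + -1 := by
    ext i j; fin_cases i <;> fin_cases j <;> simp [upper, lower]
  rw [h3]
  have hsub := @AddSubmonoid.subset_closure _ _ {u : Matrix (Fin 2) (Fin 2) T | IsUnit u}
  exact add_mem (add_mem (add_mem (add_mem (add_mem (hsub h1) (hsub h2)) (hsub (upper _).isUnit))
    (hsub (lower _).isUnit)) (hsub isUnit_one.neg)) (hsub isUnit_one.neg)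

end MatrixUnits

/-! ### Comparison of the groups `GL_N(R)`, `N = 1, 2, 4, 8, …`, with `GL(R)`. -/

section Stable

variable (R : Type) [Ring R]

/-- Block matrices. -/
def blockEquiv (N : ℕ) :
    Matrix (Fin 2) (Fin 2) (Matrix (Fin N) (Fin N) R) ≃+* Matrix (Fin (2 * N)) (Fin (2 * N)) R :=
  (Matrix.compRingEquiv (Fin 2) (Fin N) R).trans (Matrix.reindexRingEquiv R finProdFinEquiv)

/-- Block matrices, on the level of unit groups. -/
def glBlockEquiv (N : ℕ) : (Matrix (Fin 2) (Fin 2) (Matrix (Fin N) (Fin N) R))ˣ ≃*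
    Matrix.GeneralLinearGroup (Fin (2 * N)) R :=
  Units.mapEquiv (blockEquiv R N).toMulEquiv

theorem glBlockEquiv_diagOne (N : ℕ) (h : N ≤ 2 * N) (g : Matrix.GeneralLinearGroup (Fin N) R) :
    glBlockEquiv R N (diagOne g) = stabilize R N (2 * N) h g := by
  ext i j
  obtain ⟨⟨a, i⟩, rfl⟩ := finProdFinEquiv.surjective i
  obtain ⟨⟨b, j⟩, rfl⟩ := finProdFinEquiv.surjective j
  show blockEquiv R N (diagOne g).1 _ _ = padMatrix (2 * N) g.1 _ _
  simp only [blockEquiv, RingEquiv.trans_apply, Matrix.compRingEquiv_apply,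
    Matrix.coe_reindexRingEquiv, Matrix.reindex_apply, Matrix.submatrix_apply,
    Equiv.symm_apply_apply, Matrix.comp_apply]
  have hi := i.2
  have hj := j.2
  fin_cases a <;> fin_cases b
  · simp [diagOne, diag2, padMatrix]
  · have : ¬ (j : ℕ) + N < N := by omega
    simp [diagOne, diag2, padMatrix, Fin.ext_iff]
  · have : ¬ (i : ℕ) + N < N := by omega
    simp [diagOne, diag2, padMatrix, Fin.ext_iff]
  · simp [diagOne, diag2, padMatrix, Matrix.one_apply, Fin.ext_iff]

variable {A : Type*} [CommGroup A]

theorem symmetric_comp_glBlockEquiv {N : ℕ}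
    {f : Matrix.GeneralLinearGroup (Fin (2 * N)) R →* A} (hf : Symmetric f) :
    Symmetric (f.comp (glBlockEquiv R N).toMonoidHom) :=
  hf.comp_ringEquiv (blockEquiv R N)

/-- Even size is what makes this possible for every `R`: the field with two elements, for example,
has no unit `p` with `p - 1` a unit. -/
theorem exists_fibUnit (n : ℕ) : ∃ p q : (Matrix (Fin (2 * n)) (Fin (2 * n)) R)ˣ,
    (q : Matrix (Fin (2 * n)) (Fin (2 * n)) R) = p - 1 := by
  refine ⟨glBlockEquiv R n fibUnit, glBlockEquiv R n fibUnit⁻¹, ?_⟩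
  show blockEquiv R n (fibUnit⁻¹).1 = blockEquiv R n fibUnit.1 - 1
  rw [fibUnit_inv_eq, map_sub, map_one]

/-- Stabilization by doubling the size, followed by abelianization, is symmetric. -/
theorem symmetric_of_stabilize (n N : ℕ) (hN : N = 2 * n) (h : N ≤ 2 * N) :
    Symmetric ((Abelianization.of :
      Matrix.GeneralLinearGroup (Fin (2 * N)) R →* _).comp (stabilize R N (2 * N) h)) := by
  subst hN
  obtain ⟨p, q, hq⟩ := exists_fibUnit R n
  have h1 := (symmetric_of_diagOne p q hq).comp
    (Abelianization.map (glBlockEquiv R (2 * n)).toMonoidHom)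
  convert h1 using 1
  ext g : 1
  simp only [MonoidHom.comp_apply, ← glBlockEquiv_diagOne R _ h, Abelianization.map_of]
  rfl

/-- The sizes `2, 4, 8, …`. -/
def dbl : ℕ → ℕ
  | 0 => 2
  | j + 1 => 2 * dbl j

theorem exists_dbl_eq (j : ℕ) : ∃ n, dbl j = 2 * n := by
  cases j
  · exact ⟨1, rfl⟩
  · exact ⟨_, rfl⟩

theorem two_le_dbl (j : ℕ) : 2 ≤ dbl j := by
  induction j with
  | zero => rfl
  | succ j ih => simp only [dbl]; omega

theorem le_dbl (j : ℕ) : j ≤ dbl j := by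
  induction j with
  | zero => omega
  | succ j ih => have := two_le_dbl j; simp only [dbl]; omega

theorem stabilize_stabilize {R : Type} [Ring R] {a b c : ℕ} (hab : a ≤ b) (hbc : b ≤ c)
    (g : Matrix.GeneralLinearGroup (Fin a) R) :
    stabilize R b c hbc (stabilize R a b hab g) = stabilize R a c (hab.trans hbc) g :=
  DirectedSystem.map_map (f := (stabilize R · · ·)) hab hbc g

theorem toGLInf_stabilize {a b : ℕ} (hab : a ≤ b) (g : Matrix.GeneralLinearGroup (Fin a) R) :
    toGLInf R b (stabilize R a b hab g) = toGLInf R a g :=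
  (DirectLimit.eq_of_le (f := stabilize R)
    (⟨a, g⟩ : Σ n, Matrix.GeneralLinearGroup (Fin n) R) b hab).symm

theorem exists_toGLInf (x : GLInf R) : ∃ m g, toGLInf R m g = x := by
  obtain ⟨m, g, rfl⟩ := DirectLimit.exists_eq_mk (f := stabilize R) x
  exact ⟨m, g, rfl⟩

/-- An element of the commutator subgroup involves only finitely many matrices, and these live in a
common `GL_m(R)`. -/
theorem exists_mem_commutator {x : GLInf R} (hx : x ∈ commutator (GLInf R)) :
    ∃ m, ∃ g ∈ commutator (Matrix.GeneralLinearGroup (Fin m) R), toGLInf R m g = x := by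
  have hstab : ∀ {a b : ℕ} (hab : a ≤ b) {g : Matrix.GeneralLinearGroup (Fin a) R},
      g ∈ commutator _ → stabilize R a b hab g ∈ commutator _ := fun hab g hg => by
    rw [← Abelianization.ker_of, MonoidHom.mem_ker] at hg ⊢
    rw [← Abelianization.map_of, hg, map_one]
  rw [commutator_eq_closure] at hx
  induction hx using Subgroup.closure_induction with
  | mem x hx =>
    obtain ⟨a, b, rfl⟩ := hx
    obtain ⟨m, a, rfl⟩ := exists_toGLInf R a
    obtain ⟨m', b, rfl⟩ := exists_toGLInf R b
    refine ⟨max m m', stabilize R m (max m m') (le_max_left _ _) a *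
      stabilize R m' (max m m') (le_max_right _ _) b *
      (stabilize R m (max m m') (le_max_left _ _) a)⁻¹ *
      (stabilize R m' (max m m') (le_max_right _ _) b)⁻¹, ?_, ?_⟩
    · rw [commutator_eq_closure]
      exact Subgroup.subset_closure ⟨_, _, rfl⟩
    · rw [map_mul, map_mul, map_mul, map_inv, map_inv, toGLInf_stabilize, toGLInf_stabilize]
      rfl
  | one => exact ⟨0, 1, one_mem _, map_one _⟩
  | mul x y _ _ hx hy =>
    obtain ⟨m, a, ha, rfl⟩ := hx
    obtain ⟨m', b, hb, rfl⟩ := hy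
    refine ⟨max m m', stabilize R m _ (le_max_left _ _) a * stabilize R m' _ (le_max_right _ _) b,
      mul_mem (hstab _ ha) (hstab _ hb), ?_⟩
    rw [map_mul, toGLInf_stabilize, toGLInf_stabilize]
  | inv x _ hx =>
    obtain ⟨m, a, ha, rfl⟩ := hx
    exact ⟨m, a⁻¹, inv_mem ha, map_inv _ _⟩

/-- The isomorphism `Rˣ → GL₁(R)`. -/
def toGLOne : Rˣ →* Matrix.GeneralLinearGroup (Fin 1) R :=
  Units.map (Matrix.scalar (Fin 1) : R →+* Matrix (Fin 1) (Fin 1) R).toMonoidHom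

theorem toGLOne_surjective : Function.Surjective (toGLOne R) := by
  intro g
  have h : ∀ a b : Matrix (Fin 1) (Fin 1) R, a * b = 1 → a 0 0 * b 0 0 = 1 := fun a b h => by
    have := congrFun (congrFun h 0) 0
    simpa [Matrix.mul_apply] using this
  refine ⟨⟨g.1 0 0, g⁻¹.1 0 0, h _ _ g.mul_inv, h _ _ g.inv_mul⟩, ?_⟩
  ext i j
  have hi := Subsingleton.elim i 0
  have hj := Subsingleton.elim j 0
  subst hi hj
  simp [toGLOne]

/-- The map `u ↦ diag(u, 1, 1, 1)` to the abelianization of `GL₄(R)`. -/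
def unitsToGLFourAb : Rˣ →* Abelianization (Matrix.GeneralLinearGroup (Fin 4) R) :=
  (Abelianization.of.comp (stabilize R 1 4 (by norm_num))).comp (toGLOne R)

variable [Finite R]

instance finiteMatrix (N : ℕ) : Finite (Matrix (Fin N) (Fin N) R) :=
  inferInstanceAs (Finite (Fin N → Fin N → R))

/-- This is `exists_extension` for `S = M_N(R)`. The size `N` is even so that `S` is a ring of `2 ×
2` matrices over `M_n(R)`, which gives `UnitComplement` and the generation by units. -/
theorem exists_extension_stabilize (n N : ℕ) (hN : N = 2 * n) (h : N ≤ 2 * N)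
    (f : Matrix.GeneralLinearGroup (Fin N) R →* A) (hf : Symmetric f) :
    ∃ F : Matrix.GeneralLinearGroup (Fin (2 * N)) R →* A,
      Symmetric F ∧ ∀ g, F (stabilize R N (2 * N) h g) = f g := by
  subst hN
  have hS : StableRangeOne (Matrix (Fin (2 * n)) (Fin (2 * n)) R) := stableRangeOne_of_finite _
  have hP : UnitComplement (Matrix (Fin (2 * n)) (Fin (2 * n)) R) :=
    (unitComplement_matrix_of_finite (Matrix (Fin n) (Fin n) R)).of_ringEquiv (blockEquiv R n).symm
  have hU : ∀ s : Matrix (Fin (2 * n)) (Fin (2 * n)) R, s ∈ AddSubmonoid.closure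
      {u : Matrix (Fin (2 * n)) (Fin (2 * n)) R | IsUnit u} := fun s => by
    have h1 := AddSubmonoid.mem_map_of_mem (blockEquiv R n).toAddEquiv.toAddMonoidHom
      (mem_closure_isUnit ((blockEquiv R n).symm s))
    rw [AddMonoidHom.map_mclosure] at h1
    have h2 : (blockEquiv R n).toAddEquiv.toAddMonoidHom ((blockEquiv R n).symm s) = s :=
      (blockEquiv R n).apply_symm_apply s
    rw [h2] at h1
    refine AddSubmonoid.closure_mono ?_ h1
    rintro _ ⟨u, hu, rfl⟩
    exact (hu : IsUnit u).map (blockEquiv R n)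
  obtain ⟨F, hF⟩ := exists_extension hS hP hU hf
  refine ⟨F.comp (glBlockEquiv R (2 * n)).symm.toMonoidHom,
    (extension_symmetric hS hf hF).comp_ringEquiv (blockEquiv R (2 * n)).symm, fun g => ?_⟩
  rw [← glBlockEquiv_diagOne]
  simp [extension_diagOne hF]

theorem exists_extension_dbl (f : Matrix.GeneralLinearGroup (Fin 2) R →* A) (hf : Symmetric f)
    (j : ℕ) : ∃ F : Matrix.GeneralLinearGroup (Fin (dbl j)) R →* A,
      Symmetric F ∧ ∀ g, F (stabilize R 2 (dbl j) (two_le_dbl j) g) = f g := by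
  induction j with
  | zero => exact ⟨f, hf, fun g => congrArg f (DirectedSystem.map_self (f := (stabilize R · · ·)) g)⟩
  | succ j ih =>
    obtain ⟨F, hF, h⟩ := ih
    obtain ⟨n, hn⟩ := exists_dbl_eq j
    obtain ⟨F', hF', h'⟩ := exists_extension_stabilize R n (dbl j) hn (by omega) F hF
    refine ⟨F', hF', fun g => ?_⟩
    rw [← h, ← h', stabilize_stabilize]
    rfl

/-- If `u` dies in `K₁(R)`, it becomes a product of commutators in some `GL_N(R)` with `N` a power
of two. The symmetric map `GL₂(R) → GL₄(R)^ab` extends to this group and, its target being abelian,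
kills commutators; on `u` the extension is the class of `diag(u, 1, 1, 1)`. -/
theorem ker_unitsToGLFourAb : (unitsToGLFourAb R).ker = (unitsToK1 R).ker := by
  ext u
  rw [MonoidHom.mem_ker, MonoidHom.mem_ker]
  constructor
  · intro h
    have h1 : Abelianization.map (toGLInf R 4) (unitsToGLFourAb R u) = unitsToK1 R u := by
      show Abelianization.of (toGLInf R 4 (stabilize R 1 4 _ (toGLOne R u))) = _
      rw [toGLInf_stabilize]; rfl
    rw [← h1, h, map_one]
  · intro h
    have h1 : toGLInf R 1 (toGLOne R u) ∈ commutator (GLInf R) := by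
      rw [← Abelianization.ker_of]; exact h
    obtain ⟨m, g, hg, hgu⟩ := exists_mem_commutator R h1
    have hr := Quotient.exact hgu
    obtain ⟨i, hi, hi', h2⟩ := hr
    obtain ⟨F, -, hF⟩ := exists_extension_dbl R _
      (symmetric_of_stabilize R 1 2 rfl (by norm_num)) i
    have h3 : stabilize R m (dbl i) (hi.trans (le_dbl i)) g
        = stabilize R 1 (dbl i) (hi'.trans (le_dbl i)) (toGLOne R u) := by
      rw [← stabilize_stabilize hi (le_dbl i), ← stabilize_stabilize hi' (le_dbl i)]
      exact congrArg _ h2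
    have h4 : F (stabilize R m (dbl i) (hi.trans (le_dbl i)) g) = 1 := by
      have : g ∈ (F.comp (stabilize R m (dbl i) (hi.trans (le_dbl i)))).ker :=
        Abelianization.commutator_subset_ker _ hg
      exact this
    rw [h3, ← stabilize_stabilize (show 1 ≤ 2 by norm_num) (two_le_dbl i), hF] at h4
    rw [← h4]
    show Abelianization.of _ = Abelianization.of _
    rw [stabilize_stabilize]

theorem exists_map_eq_stabilize (N : ℕ) (h : N ≤ 2 * N)
    (f : Matrix.GeneralLinearGroup (Fin (2 * N)) R →* A) (hf : Symmetric f)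
    (g : Matrix.GeneralLinearGroup (Fin (2 * N)) R) :
    ∃ g', f g = f (stabilize R N (2 * N) h g') := by
  have hF := symmetric_comp_glBlockEquiv R hf
  obtain ⟨g', hg'⟩ := exists_map_eq_diagOne (stableRangeOne_of_finite _) _ hF.map_upper
    hF.map_lower ((glBlockEquiv R N).symm g)
  refine ⟨g', ?_⟩
  rw [← glBlockEquiv_diagOne]
  simpa using hg'

/-- The size is halved twice. From `4` to `2`, elementary block matrices are commutators, as `M₂(R)`
contains a suitable unit `p`. From `2` to `1` this may fail for `R`, but `GL₂(R) → GL₄(R)^ab` is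
symmetric and therefore kills elementary matrices. -/
theorem unitsToGLFourAb_surjective : Function.Surjective (unitsToGLFourAb R) := by
  intro x
  obtain ⟨g, rfl⟩ := QuotientGroup.mk_surjective x
  change ∃ a, _ = Abelianization.of g
  obtain ⟨p, q, hq⟩ := exists_fibUnit R 1
  have h1 : ∃ g' : Matrix.GeneralLinearGroup (Fin 2) R,
      Abelianization.of g = Abelianization.of (stabilize R 2 (2 * 2) (by norm_num) g') := by
    obtain ⟨g', hg'⟩ := exists_map_eq_diagOne (stableRangeOne_of_finite _)
      (Abelianization.of : (Matrix (Fin 2) (Fin 2) (Matrix (Fin 2) (Fin 2) R))ˣ →* _)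
      (of_upper_eq_one p q hq) (of_lower_eq_one p q hq) ((glBlockEquiv R 2).symm g)
    refine ⟨g', ?_⟩
    have := congrArg (Abelianization.map (glBlockEquiv R 2).toMonoidHom) hg'
    rw [Abelianization.map_of, Abelianization.map_of] at this
    rw [← glBlockEquiv_diagOne]
    simpa using this
  obtain ⟨g', hg'⟩ := h1
  obtain ⟨g'', hg''⟩ := exists_map_eq_stabilize R 1 (by norm_num) _
    (symmetric_of_stabilize R 1 2 rfl (by norm_num)) g'
  obtain ⟨u, rfl⟩ := toGLOne_surjective R g''
  refine ⟨u, ?_⟩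
  refine Eq.trans ?_ (hg''.symm.trans hg'.symm)
  show Abelianization.of _ = Abelianization.of _
  rw [stabilize_stabilize]

/-- For even `N` the map `κ N : GL_N(R) → K₁(R)` factors through stabilization to `GL_{2N}(R)^ab`
and is thus symmetric. It kills elementary block matrices, so every class can be brought from size
`2N'` to size `N'`, and finally to size `1`. -/
theorem unitsToK1_surjective : Function.Surjective (unitsToK1 R) := by
  intro x
  obtain ⟨y, rfl⟩ := QuotientGroup.mk_surjective x
  obtain ⟨m, g, rfl⟩ := exists_toGLInf R y
  change ∃ a, _ = Abelianization.of _
  let κ : ∀ N, Matrix.GeneralLinearGroup (Fin N) R →* K1 R := fun N =>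
    Abelianization.of.comp (toGLInf R N)
  have hκ : ∀ {a b : ℕ} (hab : a ≤ b) (g), κ b (stabilize R a b hab g) = κ a g := fun hab g => by
    show Abelianization.of _ = _
    rw [toGLInf_stabilize]; rfl
  have hsym : ∀ n N, N = 2 * n → Symmetric (κ N) := fun n N hN => by
    have h := (symmetric_of_stabilize R n N hN (by omega)).comp
      (Abelianization.lift (κ (2 * N)))
    convert h using 1
    ext g : 1
    simp [hκ]
  have hdown : ∀ j (g : Matrix.GeneralLinearGroup (Fin (dbl j)) R), ∃ u, κ 1 u = κ (dbl j) g := by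
    intro j
    induction j with
    | zero =>
      intro g
      obtain ⟨u, hu⟩ := exists_map_eq_stabilize R 1 (by norm_num) _ (hsym 1 2 rfl) g
      refine ⟨u, Eq.trans ?_ hu.symm⟩
      exact (hκ _ _).symm
    | succ j ih =>
      intro g
      obtain ⟨n, hn⟩ := exists_dbl_eq (j + 1)
      obtain ⟨g', hg'⟩ := exists_map_eq_stabilize R (dbl j) (by omega) _ (hsym n _ hn) g
      obtain ⟨u, hu⟩ := ih g'
      refine ⟨u, hu.trans (Eq.trans ?_ hg'.symm)⟩
      exact (hκ _ _).symm
  obtain ⟨u, hu⟩ := hdown m (stabilize R m (dbl m) (le_dbl m) g)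
  obtain ⟨u, rfl⟩ := toGLOne_surjective R u
  exact ⟨u, hu.trans (hκ _ _)⟩

end Stable

/-! ### Encoding the ring of `4 × 4` matrices -/

theorem flatMap_range_map {α : Type*} (a b : ℕ) (g : ℕ → ℕ → α) :
    ((List.range a).flatMap fun i => (List.range b).map (g i)) =
      (List.range (a * b)).map fun p => g (p / b) (p % b) := by
  induction a with
  | zero => simp
  | succ a ih =>
    rw [List.range_succ, List.flatMap_append, ih, Nat.succ_mul, List.range_add, List.map_append]
    congr 1
    rw [List.flatMap_singleton, List.map_map]
    refine List.map_congr_left fun i hi => ?_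
    have hi : i < b := List.mem_range.1 hi
    have hb : 0 < b := by omega
    show g a i = g ((a * b + i) / b) ((a * b + i) % b)
    rw [mul_comm a b, Nat.mul_add_div hb, Nat.div_eq_of_lt hi, add_zero, Nat.mul_add_mod,
      Nat.mod_eq_of_lt hi]

theorem getD_map_range (N : ℕ) (f : ℕ → ℕ) {p : ℕ} (hp : p < N) :
    ((List.range N).map f).getD p 0 = f p := by
  simp [List.getD_eq_getElem?_getD, hp]

theorem index_lt {n i j k : ℕ} (hi : i < n) (hj : j < n) (hk : k < n) :
    (i * n + j) * n + k < n * (n * n) := by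
  have h1 : j * n + k < n * n := by
    calc j * n + k < j * n + n := by omega
      _ = (j + 1) * n := by ring
      _ ≤ n * n := Nat.mul_le_mul_right _ hj
  calc (i * n + j) * n + k = i * (n * n) + (j * n + k) := by ring
    _ < i * (n * n) + n * n := by omega
    _ = (i + 1) * (n * n) := by ring
    _ ≤ n * (n * n) := Nat.mul_le_mul_right _ hi

theorem index_div {n i j k : ℕ} (hj : j < n) (hk : k < n) :
    ((i * n + j) * n + k) / (n * n) = i := by
  rw [← Nat.div_div_eq_div_mul, mul_comm _ n, Nat.mul_add_div (by omega), Nat.div_eq_of_lt hk,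
    add_zero, mul_comm, Nat.mul_add_div (by omega), Nat.div_eq_of_lt hj, add_zero]

theorem index_mod_div {n i j k : ℕ} (hj : j < n) (hk : k < n) :
    ((i * n + j) * n + k) % (n * n) / n = j := by
  rw [Nat.mod_mul_right_div_self, mul_comm _ n, Nat.mul_add_div (by omega), Nat.div_eq_of_lt hk,
    add_zero, mul_comm, Nat.mul_add_mod, Nat.mod_eq_of_lt hj]

theorem index_mod {n i j k : ℕ} (hk : k < n) : ((i * n + j) * n + k) % n = k := by
  rw [mul_comm _ n, Nat.mul_add_mod, Nat.mod_eq_of_lt hk]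

theorem flatMap_finRange {α : Type*} (n : ℕ) (f : Fin n → List α) (g : ℕ → List α)
    (h : ∀ i, f i = g i) : (List.finRange n).flatMap f = (List.range n).flatMap g := by
  rw [← List.map_coe_finRange_eq_range, List.flatMap_map]
  exact congrArg (fun f => (List.finRange n).flatMap f) (funext h)

theorem abCode_eq_map {d : List ℕ} (x : AbGrp d) (g : ℕ → ℕ) (h : ∀ i, (x i).val = g i) :
    abCode x = (List.range d.length).map g := by
  rw [abCode, ← List.map_coe_finRange_eq_range, List.map_map, List.ofFn_eq_map]
  exact congrArg (fun f => (List.finRange d.length).map f) (funext h)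

theorem abCode_length {d : List ℕ} (x : AbGrp d) : (abCode x).length = d.length := by
  simp [abCode]

theorem abCode_getD {d : List ℕ} (x : AbGrp d) (i : Fin d.length) :
    (abCode x).getD i 0 = (x i).val := by
  simp [abCode, List.getD_eq_getElem?_getD]

/-- The `k`-th coordinate of the product of the generators `i` and `j` stands at position `(i * n +
j) * n + k`; the quotients and remainders recover the indices. -/
theorem table_eq_map {d : List ℕ} (c : Fin d.length → Fin d.length → AbGrp d)
    (G : ℕ → ℕ → ℕ → ℕ) (h : ∀ i j k, (c i j k).val = G i j k) :
    ((List.finRange d.length).flatMap fun i => (List.finRange d.length).flatMap fun j =>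
      abCode (c i j)) = (List.range (d.length * (d.length * d.length))).map fun p =>
        G (p / (d.length * d.length)) (p % (d.length * d.length) / d.length) (p % d.length) := by
  rw [flatMap_finRange _ _ (fun i => (List.range (d.length * d.length)).map fun q =>
    G i (q / d.length) (q % d.length)) fun i => ?_]
  · rw [flatMap_range_map]
    exact List.map_congr_left fun p _ => by rw [Nat.mod_mul_left_mod]
  · rw [← flatMap_range_map]
    exact flatMap_finRange _ _ _ fun j => abCode_eq_map _ _ fun k => h i j k

section MatrixCode

variable {R : Type} [Ring R] (κ : RingCode R)

theorem RingCode.table_getD (i j k : Fin κ.dims.length) :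
    κ.table.getD ((i * κ.dims.length + j) * κ.dims.length + k) 0 =
      (κ.equiv (κ.equiv.symm (abGen κ.dims i) * κ.equiv.symm (abGen κ.dims j)) k).val := by
  set G : ℕ → ℕ → ℕ → ℕ := fun i j k => if h : i < κ.dims.length ∧ j < κ.dims.length ∧
    k < κ.dims.length then (κ.equiv (κ.equiv.symm (abGen κ.dims ⟨i, h.1⟩) *
      κ.equiv.symm (abGen κ.dims ⟨j, h.2.1⟩)) ⟨k, h.2.2⟩).val else 0 with hG
  rw [κ.table_eq, table_eq_map _ G (by simp [hG]), getD_map_range _ _ (index_lt i.2 j.2 k.2),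
    index_div j.2 k.2, index_mod_div j.2 k.2, index_mod k.2]
  simp [hG]

/-- The dimensions of the matrix ring. -/
def matDims (d : List ℕ) : List ℕ :=
  (List.range (16 * d.length)).map fun p => d.getD (p % d.length) 0

theorem matDims_length (d : List ℕ) : (matDims d).length = 16 * d.length := by simp [matDims]

theorem mod_lt_of_matDims {d : List ℕ} (p : Fin (matDims d).length) : p % d.length < d.length := by
  have h := lt_of_lt_of_eq p.2 (matDims_length d)
  exact Nat.mod_lt _ (by omega)

/-- The generator of the coefficient ring that belongs to a generator of the matrix ring. -/
def matIdx {d : List ℕ} (p : Fin (matDims d).length) : Fin d.length := ⟨p % d.length, mod_lt_of_matDims p⟩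

theorem matDims_get {d : List ℕ} (p : Fin (matDims d).length) :
    (matDims d).get p = d.get (matIdx p) := by
  have h := mod_lt_of_matDims p
  rw [List.get_eq_getElem]
  simp only [matDims, List.getElem_map, List.getElem_range]
  simp [matIdx, h]

/-- The row of the block with the given index. -/
def matRow (n p : ℕ) : Fin 4 := Fin.ofNat 4 (p / n / 4)

/-- The column of the block with the given index. -/
def matCol (n p : ℕ) : Fin 4 := Fin.ofNat 4 (p / n)

/-- The index of a generator in a block. -/
def matPos {d : List ℕ} (r c : Fin 4) (a : Fin d.length) : Fin (matDims d).length :=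
  ⟨(4 * r + c) * d.length + a, by
    rw [matDims_length]
    have h1 := r.2
    have h2 := c.2
    have h3 := a.2
    have : (4 * (r : ℕ) + c) * d.length ≤ 15 * d.length := Nat.mul_le_mul_right _ (by omega)
    omega⟩

theorem matPos_div {d : List ℕ} (r c : Fin 4) (a : Fin d.length) :
    (matPos r c a : ℕ) / d.length = 4 * r + c := by
  show ((4 * (r : ℕ) + c) * d.length + a) / d.length = 4 * r + c
  have hd : 0 < d.length := by have := a.2; omega
  rw [mul_comm, Nat.mul_add_div hd, Nat.div_eq_of_lt a.2, add_zero]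

theorem matIdx_matPos {d : List ℕ} (r c : Fin 4) (a : Fin d.length) : matIdx (matPos r c a) = a := by
  ext
  show ((4 * (r : ℕ) + c) * d.length + a) % d.length = a
  rw [mul_comm, Nat.mul_add_mod, Nat.mod_eq_of_lt a.2]

theorem matRow_matPos {d : List ℕ} (r c : Fin 4) (a : Fin d.length) :
    matRow d.length (matPos r c a) = r := by
  ext
  have := r.2
  have := c.2
  simp only [matRow, matPos_div, Fin.ofNat]
  omega

theorem matCol_matPos {d : List ℕ} (r c : Fin 4) (a : Fin d.length) :
    matCol d.length (matPos r c a) = c := by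
  ext
  have := r.2
  have := c.2
  simp only [matCol, matPos_div, Fin.ofNat]
  omega

theorem matPos_eq {d : List ℕ} (p : Fin (matDims d).length) :
    matPos (matRow d.length p) (matCol d.length p) (matIdx p) = p := by
  have h := lt_of_lt_of_eq p.2 (matDims_length d)
  have h1 : (p : ℕ) / d.length < 16 := Nat.div_lt_of_lt_mul (by linarith)
  ext
  have h2 : 4 * ((matRow d.length p : Fin 4) : ℕ) + (matCol d.length p : Fin 4) = p / d.length := by
    simp only [matRow, matCol, Fin.ofNat]
    generalize (p : ℕ) / d.length = b at h1 ⊢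
    omega
  show (4 * ((matRow d.length p : Fin 4) : ℕ) + (matCol d.length p : Fin 4)) * d.length
    + p % d.length = p
  rw [h2, mul_comm, Nat.div_add_mod]

theorem RingCode.neZero (i : Fin κ.dims.length) : NeZero (κ.dims.get i) :=
  ⟨(κ.dims_pos _ (List.get_mem _ _)).ne'⟩

/-- The identification of the additive group of the matrix ring. -/
def matEquiv : Matrix (Fin 4) (Fin 4) R ≃+ AbGrp (matDims κ.dims) where
  toFun M p := ZMod.ringEquivCongr (matDims_get p).symm
    (κ.equiv (M (matRow κ.dims.length p) (matCol κ.dims.length p)) (matIdx p))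
  invFun N := Matrix.of fun r c => κ.equiv.symm fun a =>
    ZMod.ringEquivCongr (by rw [matDims_get, matIdx_matPos]) (N (matPos r c a))
  left_inv M := by
    ext r c
    show κ.equiv.symm _ = _
    rw [AddEquiv.symm_apply_eq]
    funext a
    have := κ.neZero a
    apply ZMod.val_injective
    rw [ZMod.ringEquivCongr_val, ZMod.ringEquivCongr_val, matRow_matPos, matCol_matPos,
      matIdx_matPos]
  right_inv N := by
    funext p
    have : NeZero ((matDims κ.dims).get p) := by rw [matDims_get]; exact κ.neZero _
    apply ZMod.val_injective
    rw [ZMod.ringEquivCongr_val]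
    show (κ.equiv (κ.equiv.symm _) _).val = _
    rw [AddEquiv.apply_symm_apply, ZMod.ringEquivCongr_val, matPos_eq]
  map_add' M N := by
    funext p
    simp

theorem matEquiv_val (M : Matrix (Fin 4) (Fin 4) R) (p : Fin (matDims κ.dims).length) :
    (matEquiv κ M p).val =
      (κ.equiv (M (matRow κ.dims.length p) (matCol κ.dims.length p)) (matIdx p)).val :=
  ZMod.ringEquivCongr_val _ _

theorem matEquiv_symm_abGen (p : Fin (matDims κ.dims).length) :
    (matEquiv κ).symm (abGen (matDims κ.dims) p) = Matrix.single (matRow κ.dims.length p)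
      (matCol κ.dims.length p) (κ.equiv.symm (abGen κ.dims (matIdx p))) := by
  rw [AddEquiv.symm_apply_eq]
  funext q
  have : NeZero ((matDims κ.dims).get q) := by rw [matDims_get]; exact κ.neZero _
  apply ZMod.val_injective
  rw [matEquiv_val, Matrix.single_apply]
  by_cases h : p = q
  · subst h
    -- A modulus may be `1`, so a standard generator has the coordinate `1 % d` instead of `1`.
    rw [if_pos ⟨rfl, rfl⟩, AddEquiv.apply_symm_apply, abGen, abGen, Pi.single_eq_same,
      Pi.single_eq_same, ZMod.val_one_eq_one_mod, ZMod.val_one_eq_one_mod, matDims_get]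
  · rw [abGen, Pi.single_eq_of_ne' h]
    split_ifs with h'
    · rw [AddEquiv.apply_symm_apply, abGen, Pi.single_eq_of_ne, ZMod.val_zero, ZMod.val_zero]
      intro h''
      exact h (by rw [← matPos_eq p, ← matPos_eq q, h'.1, h'.2, h''])
    · simp

/-- The entries of the multiplication table of the matrix ring. -/
def matEntry (d t : List ℕ) (i j k : ℕ) : ℕ :=
  if matCol d.length i = matRow d.length j ∧ matRow d.length k = matRow d.length i ∧
      matCol d.length k = matCol d.length j then
    t.getD ((i % d.length * d.length + j % d.length) * d.length + k % d.length) 0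
  else 0

/-- The multiplication table of the matrix ring. -/
def matTable (d t : List ℕ) : List ℕ :=
  (List.range (16 * d.length * (16 * d.length * (16 * d.length)))).map fun p =>
    matEntry d t (p / (16 * d.length * (16 * d.length)))
      (p % (16 * d.length * (16 * d.length)) / (16 * d.length)) (p % (16 * d.length))

/-- The encoding of the ring of `4 × 4` matrices. -/
def matCode : RingCode (Matrix (Fin 4) (Fin 4) R) where
  dims := matDims κ.dims
  table := matTable κ.dims κ.table
  dims_pos a ha := by
    obtain ⟨i, rfl⟩ := List.get_of_mem ha
    rw [matDims_get]
    exact κ.dims_pos _ (List.get_mem _ _)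
  equiv := matEquiv κ
  table_eq := by
    rw [table_eq_map _ (matEntry κ.dims κ.table)]
    · rw [matDims_length]; rfl
    · intro p q s
      rw [matEquiv_symm_abGen, matEquiv_symm_abGen, matEquiv_val, matEntry]
      by_cases h1 : matCol κ.dims.length p = matRow κ.dims.length q
      · rw [h1, Matrix.single_mul_single_same, Matrix.single_apply]
        by_cases h2 : matRow κ.dims.length p = matRow κ.dims.length s ∧
          matCol κ.dims.length q = matCol κ.dims.length s
        · rw [if_pos h2, if_pos ⟨rfl, h2.1.symm, h2.2.symm⟩]
          exact (κ.table_getD (matIdx p) (matIdx q) (matIdx s)).symm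
        · rw [if_neg h2, if_neg fun h => h2 ⟨h.2.1.symm, h.2.2.symm⟩]
          simp
      · rw [Matrix.single_mul_single_of_ne _ _ _ _ h1, if_neg fun h => h1 h.1]
        simp

theorem matCode_msg : (matCode κ).msg = [matDims κ.dims, matTable κ.dims κ.table] := rfl

/-- The code of the diagonal matrix `diag(u, w, w, w)`. -/
def diagList (n : ℕ) (u w : List ℕ) : List ℕ :=
  (List.range (16 * n)).map fun p =>
    if p / n % 5 = 0 then (if p / n = 0 then u else w).getD (p % n) 0 else 0

/-- Block `b` lies in row `b / 4` and column `b % 4`; the diagonal blocks are `0`, `5`, `10` and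
`15`. -/
theorem diag_index {b : ℕ} (hb : b < 16) :
    (b / 4 % 4 = b % 4 ↔ b % 5 = 0) ∧ (b % 5 = 0 → (b / 4 % 4 = 0 ↔ b = 0)) := by
  interval_cases b <;> simp

theorem matCode_encode_diagonal (u w : R) :
    (matCode κ).encode (Matrix.diagonal fun i => if i = 0 then u else w) =
      diagList κ.dims.length (κ.encode u) (κ.encode w) := by
  rw [RingCode.encode, abCode_eq_map _ (fun p => if p / κ.dims.length % 5 = 0 then
    (if p / κ.dims.length = 0 then κ.encode u else κ.encode w).getD (p % κ.dims.length) 0 else 0)]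
  · show (List.range (matDims κ.dims).length).map _ = _
    rw [matDims_length]; rfl
  · intro (p : Fin (matDims κ.dims).length)
    have h := lt_of_lt_of_eq p.2 (matDims_length κ.dims)
    have h1 : (p : ℕ) / κ.dims.length < 16 := Nat.div_lt_of_lt_mul (by linarith)
    show (matEquiv κ _ p).val = _
    rw [matEquiv_val, Matrix.diagonal_apply]
    have hr : ((matRow κ.dims.length p : Fin 4) : ℕ) = p / κ.dims.length / 4 % 4 := rfl
    have hc : ((matCol κ.dims.length p : Fin 4) : ℕ) = p / κ.dims.length % 4 := rfl
    have e1 : matRow κ.dims.length p = matCol κ.dims.length p ↔ p / κ.dims.length % 5 = 0 := by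
      rw [Fin.ext_iff, hr, hc]
      exact (diag_index h1).1
    by_cases h5 : (p : ℕ) / κ.dims.length % 5 = 0
    · rw [if_pos (e1.2 h5), if_pos h5]
      have e2 : matRow κ.dims.length p = 0 ↔ (p : ℕ) / κ.dims.length = 0 := by
        rw [Fin.ext_iff, hr]
        exact (diag_index h1).2 h5
      by_cases h0 : (p : ℕ) / κ.dims.length = 0
      · rw [if_pos (e2.2 h0), if_pos h0]
        exact (abCode_getD _ (matIdx p)).symm
      · rw [if_neg (fun h => h0 (e2.1 h)), if_neg h0]
        exact (abCode_getD _ (matIdx p)).symm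
    · rw [if_neg (fun h => h5 (e1.1 h)), if_neg h5]
      simp

end MatrixCode

/-! ### Elimination with integral rows modulo a vector of moduli -/

section Elimination

/-- A vector of natural numbers as a vector of integers. -/
def toZ (v : ℕ → ℕ) : ℕ → ℤ := fun k => v k

/-- The group that is generated by the first `m` rows. -/
def rowSpan (m : ℕ) (v : ℕ → ℕ → ℕ) : AddSubgroup (ℕ → ℤ) :=
  AddSubgroup.closure {z | ∃ i < m, z = toZ (v i)}

theorem toZ_mem_rowSpan {m i : ℕ} (hi : i < m) (v : ℕ → ℕ → ℕ) : toZ (v i) ∈ rowSpan m v :=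
  AddSubgroup.subset_closure ⟨i, hi, rfl⟩

/-- The modulus of the `k`-th coordinate is `D k`, the first `n` of the `N` columns are to be
eliminated, there are `m` rows, and the rows belong to `H`. -/
structure EliminationData where
  D : ℕ → ℕ
  N : ℕ
  n : ℕ
  m : ℕ
  H : AddSubgroup (ℕ → ℤ)
  le : n ≤ N
  pos : ∀ k < N, 0 < D k
  mem : ∀ z : ℕ → ℤ, (∀ k < N, (D k : ℤ) ∣ z k) → z ∈ H

variable (E : EliminationData)

/-- The rows are reduced, belong to `H`, and vanish in the first `j` columns. -/
structure EliminationData.Rows (j : ℕ) (v : ℕ → ℕ → ℕ) : Prop where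
  lt : ∀ i < E.m, ∀ k < E.N, v i k < E.D k
  mem : ∀ i < E.m, toZ (v i) ∈ E.H
  zero : ∀ i < E.m, ∀ k < j, v i k = 0

/-- The first `j` columns have been eliminated. -/
structure EliminationData.Echelon (j : ℕ) (v : ℕ → ℕ → ℕ) : Prop extends E.Rows j v where
  gen : ∀ a : ℕ → ℤ, ∃ z ∈ rowSpan E.m v, ∀ k, j ≤ k → k < E.n → (E.D k : ℤ) ∣ z k - a k

/-- In column `j`, the first `r` rows have been eliminated with the pivot row `P`. -/
structure EliminationData.Pivot (j r : ℕ) (v : ℕ → ℕ → ℕ) (P : ℕ → ℕ) : Prop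
    extends E.Rows j v where
  done : ∀ i < r, v i j = 0
  pivot_le : ∀ k < E.N, P k ≤ E.D k
  pivot_pos : 0 < P j
  pivot_mem : toZ P ∈ E.H
  pivot_zero : ∀ k < j, P k = 0
  gen : ∀ a : ℕ → ℤ, ∃ z ∈ rowSpan E.m v ⊔ AddSubgroup.zmultiples (toZ P),
    z j = a j ∧ ∀ k, j < k → k < E.n → (E.D k : ℤ) ∣ z k - a k

variable {E} {j r : ℕ} {v : ℕ → ℕ → ℕ} {P : ℕ → ℕ}

/-- The initial pivot row is `D j` times the `j`-th unit vector. Adding it to the generators turns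
congruences modulo `D j` in column `j` into equalities of integers. It is also why `pivot_le` is not
strict. -/
theorem EliminationData.Echelon.pivot (h : E.Echelon j v) (hj : j < E.n) :
    E.Pivot j 0 v (fun k => if k = j then E.D j else 0) where
  toRows := h.toRows
  done i hi := by omega
  pivot_le k hk := by
    by_cases hkj : k = j
    · subst hkj; simp
    · simp [hkj]
  pivot_pos := by simpa using E.pos j (hj.trans_le E.le)
  pivot_mem := E.mem _ fun k _ => by
    by_cases hkj : k = j
    · subst hkj; simp [toZ]
    · simp [toZ, hkj]
  pivot_zero k hk := by simp [hk.ne]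
  gen a := by
    obtain ⟨z, hz, ha⟩ := h.gen a
    obtain ⟨c, hc⟩ := ha j le_rfl hj
    refine ⟨z - c • toZ (fun k => if k = j then E.D j else 0),
      sub_mem (AddSubgroup.mem_sup_left hz)
        (zsmul_mem (AddSubgroup.mem_sup_right (AddSubgroup.mem_zmultiples _)) _), ?_, ?_⟩
    · simp [toZ]; linarith
    · intro k hjk hk
      simpa [toZ, hjk.ne'] using ha k hjk.le hk

/-- `P - q v` modulo the moduli, where `q` is the quotient of the entries in column `j`. -/
def reduceRow (D : ℕ → ℕ) (j : ℕ) (P v : ℕ → ℕ) : ℕ → ℕ :=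
  fun k => (P k + P j / v j * (D k - v k)) % D k

theorem dvd_reduce {D q a p : ℕ} (ha : a ≤ D) :
    (D : ℤ) ∣ (((p + q * (D - a)) % D : ℕ) : ℤ) - (p - q * a) := by
  have : (((p + q * (D - a)) % D : ℕ) : ℤ) - (p - q * a) =
      (((p + q * (D - a)) % D : ℕ) : ℤ) - ((p + q * (D - a) : ℕ) : ℤ) + q * D := by
    push_cast [Nat.cast_sub ha]; ring
  rw [this]
  refine dvd_add ?_ (dvd_mul_left _ _)
  rw [Int.natCast_mod]
  exact ⟨-(((p + q * (D - a) : ℕ) : ℤ) / D), by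
    have := Int.emod_add_mul_ediv (((p + q * (D - a) : ℕ) : ℤ)) D
    linarith⟩

/-- The remainder is below `v j < D j`, so in the pivot column the reduction modulo `D j` has no
effect on it, and the Euclidean algorithm takes place over the integers. -/
theorem reduceRow_self {D : ℕ → ℕ} {v : ℕ → ℕ} (hv : v j < D j) (h0 : v j ≠ 0) :
    reduceRow D j P v j = P j % v j := by
  have h1 : P j + P j / v j * (D j - v j) = P j % v j + D j * (P j / v j) := by
    zify [hv.le]
    have := Int.emod_add_mul_ediv (P j : ℤ) (v j)
    linarith [mul_comm (D j : ℤ) ((P j : ℤ) / v j), mul_comm (v j : ℤ) ((P j : ℤ) / v j),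
      mul_sub ((P j : ℤ) / v j) (D j : ℤ) (v j)]
  rw [reduceRow, h1, Nat.add_mul_mod_self_left]
  exact Nat.mod_eq_of_lt ((Nat.mod_lt _ (Nat.pos_of_ne_zero h0)).trans hv)

/-- This is the Euclidean step `(P, v r) ↦ (v r, P - q v r)`. Reducing the new row changes it by a
vector that is divisible by the moduli, which lies in `H`, and that vanishes in column `j`. -/
theorem EliminationData.Pivot.step (h : E.Pivot j r v P) (hj : j < E.n) (hr : r < E.m)
    (h0 : v r j ≠ 0) :
    E.Pivot j r (Function.update v r (reduceRow E.D j P (v r))) (v r) := by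
  have hlt := h.lt r hr
  have hjN := hj.trans_le E.le
  set w := reduceRow E.D j P (v r) with hw
  have hdvd : ∀ k < E.N, (E.D k : ℤ) ∣ (toZ w - (toZ P - ((P j / v r j : ℕ) : ℤ) • toZ (v r))) k :=
    fun k hk => by simpa [toZ, hw, reduceRow] using dvd_reduce (q := P j / v r j) (p := P k) (hlt k hk).le
  have hjj : w j = P j % v r j := reduceRow_self (hlt j hjN) h0
  have hjz : (w j : ℤ) = P j - (P j / v r j : ℕ) * v r j := by
    rw [hjj]
    have := Int.emod_add_mul_ediv (P j : ℤ) (v r j)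
    push_cast
    linarith [mul_comm (v r j : ℤ) ((P j : ℤ) / v r j)]
  constructor
  · constructor
    · intro i hi k hk
      rcases eq_or_ne i r with rfl | hir
      · rw [Function.update_self]
        exact Nat.mod_lt _ (E.pos k hk)
      · rw [Function.update_of_ne hir]; exact h.lt i hi k hk
    · intro i hi
      rcases eq_or_ne i r with rfl | hir
      · rw [Function.update_self]
        have := add_mem (E.mem _ hdvd) (sub_mem h.pivot_mem (zsmul_mem (h.mem _ hi) ((P j / v i j : ℕ) : ℤ)))
        rwa [sub_add_cancel] at this
      · rw [Function.update_of_ne hir]; exact h.mem i hi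
    · intro i hi k hk
      rcases eq_or_ne i r with rfl | hir
      · rw [Function.update_self, hw, reduceRow, h.pivot_zero k hk, h.zero i hi k hk]
        simp
      · rw [Function.update_of_ne hir]; exact h.zero i hi k hk
  · intro i hi
    rw [Function.update_of_ne hi.ne]; exact h.done i hi
  · exact fun k hk => (hlt k hk).le
  · exact Nat.pos_of_ne_zero h0
  · exact h.mem r hr
  · exact h.zero r hr
  · set v' := Function.update v r w with hv'
    set Λ := rowSpan E.m v' ⊔ AddSubgroup.zmultiples (toZ (v r)) with hΛ
    have hr' : toZ (v r) ∈ Λ := AddSubgroup.mem_sup_right (AddSubgroup.mem_zmultiples _)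
    have hw' : toZ w ∈ Λ := AddSubgroup.mem_sup_left (by
      have := toZ_mem_rowSpan hr v'
      rwa [hv', Function.update_self] at this)
    -- The vectors that the new span reaches exactly in column `j` and up to the moduli elsewhere.
    -- It contains the old generators, and this is all that `gen` requires.
    let Γ : AddSubgroup (ℕ → ℤ) :=
      { carrier := {z | ∃ z' ∈ Λ, z' j = z j ∧ ∀ k < E.N, (E.D k : ℤ) ∣ z' k - z k}
        zero_mem' := ⟨0, zero_mem _, rfl, by simp⟩
        add_mem' := by
          rintro a b ⟨a', ha, ha1, ha2⟩ ⟨b', hb, hb1, hb2⟩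
          refine ⟨a' + b', add_mem ha hb, by simp [ha1, hb1], fun k hk => ?_⟩
          have := dvd_add (ha2 k hk) (hb2 k hk)
          rwa [show a' k - a k + (b' k - b k) = (a' + b') k - (a + b) k by simp; ring] at this
        neg_mem' := by
          rintro a ⟨a', ha, ha1, ha2⟩
          refine ⟨-a', neg_mem ha, by simp [ha1], fun k hk => ?_⟩
          have := (dvd_neg).2 (ha2 k hk)
          rwa [show -(a' k - a k) = (-a') k - (-a) k by simp; ring] at this }
    have hle : rowSpan E.m v ⊔ AddSubgroup.zmultiples (toZ P) ≤ Γ := by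
      refine sup_le ((AddSubgroup.closure_le _).2 ?_) (AddSubgroup.zmultiples_le_of_mem ?_)
      · rintro z ⟨i, hi, rfl⟩
        refine ⟨toZ (v i), ?_, rfl, by simp⟩
        rcases eq_or_ne i r with rfl | hir
        · exact hr'
        · have := toZ_mem_rowSpan hi v'
          rw [hv', Function.update_of_ne hir] at this
          exact AddSubgroup.mem_sup_left this
      · refine ⟨toZ w + ((P j / v r j : ℕ) : ℤ) • toZ (v r), add_mem hw' (zsmul_mem hr' _), ?_, ?_⟩
        · simp only [Pi.add_apply, Pi.smul_apply, smul_eq_mul]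
          simp only [toZ]
          rw [hjz]; ring
        · intro k hk
          have := hdvd k hk
          rwa [show (toZ w - (toZ P - ((P j / v r j : ℕ) : ℤ) • toZ (v r))) k =
            (toZ w + ((P j / v r j : ℕ) : ℤ) • toZ (v r)) k - toZ P k by simp; ring] at this
    intro a
    obtain ⟨z, hz, hz1, hz2⟩ := h.gen a
    obtain ⟨z', hz', h1, h2⟩ := hle hz
    refine ⟨z', hz', h1.trans hz1, fun k hjk hk => ?_⟩
    have := dvd_add (h2 k (hk.trans_le E.le)) (hz2 k hjk hk)
    rwa [sub_add_sub_cancel] at this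

theorem EliminationData.Pivot.next (h : E.Pivot j r v P) (h0 : v r j = 0) :
    E.Pivot j (r + 1) v P :=
  { h with
    done := fun i hi => by
      rcases Nat.lt_succ_iff_lt_or_eq.1 hi with hi | rfl
      · exact h.done i hi
      · exact h0 }

theorem EliminationData.Pivot.exists_eq (h : E.Pivot j E.m v P) {z : ℕ → ℤ}
    (hz : z ∈ rowSpan E.m v ⊔ AddSubgroup.zmultiples (toZ P)) :
    ∃ y ∈ rowSpan E.m v, ∃ c : ℤ, z = y + c • toZ P ∧ z j = c * P j := by
  obtain ⟨y, hy, w, hw, rfl⟩ := AddSubgroup.mem_sup.1 hz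
  obtain ⟨c, rfl⟩ := AddSubgroup.mem_zmultiples_iff.1 hw
  refine ⟨y, hy, c, rfl, ?_⟩
  have hy0 : y j = 0 := by
    have : rowSpan E.m v ≤ (Pi.evalAddMonoidHom (fun _ : ℕ => ℤ) j).ker := by
      refine (AddSubgroup.closure_le _).2 ?_
      rintro z ⟨i, hi, rfl⟩
      simp [AddMonoidHom.mem_ker, toZ, h.done i hi]
    simpa [AddMonoidHom.mem_ker] using this hy
  simp [hy0, toZ]

/-- All rows vanish in column `j`, so the `j`-th coordinates of the span are multiples of `P j`; by
`gen` the integer `1` is among them. -/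
theorem EliminationData.Pivot.eq_one (h : E.Pivot j E.m v P) : P j = 1 := by
  obtain ⟨z, hz, h1, -⟩ := h.gen (fun _ => 1)
  obtain ⟨y, -, c, -, h2⟩ := h.exists_eq hz
  have : (P j : ℤ) ∣ 1 := ⟨c, by rw [← h1, h2, mul_comm]⟩
  have := Int.natCast_dvd_natCast.1 (by simpa using this : (P j : ℤ) ∣ ((1 : ℕ) : ℤ))
  exact Nat.dvd_one.1 this

/-- Prescribing the coordinate `0` in column `j` forces the coefficient of `P` to be zero. Hence the
rows alone still generate the later columns, and the pivot row can be discarded. -/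
theorem EliminationData.Pivot.echelon (h : E.Pivot j E.m v P) : E.Echelon (j + 1) v where
  lt := h.lt
  mem := h.mem
  zero i hi k hk := by
    rcases Nat.lt_succ_iff_lt_or_eq.1 hk with hk | rfl
    · exact h.zero i hi k hk
    · exact h.done i hi
  gen a := by
    obtain ⟨z, hz, h1, h2⟩ := h.gen (Function.update a j 0)
    obtain ⟨y, hy, c, h3, h4⟩ := h.exists_eq hz
    rw [h.eq_one, h1, Function.update_self] at h4
    obtain rfl : c = 0 := by simpa using h4.symm
    refine ⟨y, hy, fun k hjk hk => ?_⟩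
    have := h2 k hjk hk
    rwa [Function.update_of_ne (by omega), h3, zero_smul, add_zero] at this

/-- The vector `X` from which the first `j` coordinates have been eliminated. -/
structure EliminationData.Reduced (E : EliminationData) (X₀ : ℕ → ℕ) (j : ℕ) (X : ℕ → ℕ) :
    Prop where
  lt : ∀ k < E.N, X k < E.D k
  mem : toZ X - toZ X₀ ∈ E.H
  zero : ∀ k < j, X k = 0

/-- Since `P j = 1`, subtracting `X j` times the pivot row clears coordinate `j`; the class modulo
`H` is unchanged because `P` and the vectors divisible by the moduli lie in `H`. -/
theorem EliminationData.Reduced.next {X₀ X : ℕ → ℕ} (h : E.Reduced X₀ j X) (hj : j < E.n)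
    (hP : E.Pivot j E.m v P) :
    E.Reduced X₀ (j + 1) fun k => (X k + X j * (E.D k - P k)) % E.D k where
  lt k hk := Nat.mod_lt _ (E.pos k hk)
  mem := by
    have h1 : toZ (fun k => (X k + X j * (E.D k - P k)) % E.D k) -
        (toZ X - (X j : ℤ) • toZ P) ∈ E.H := E.mem _ fun k hk => by
      simpa [toZ] using dvd_reduce (q := X j) (p := X k) (hP.pivot_le k hk)
    have h2 := add_mem (sub_mem h1 (zsmul_mem hP.pivot_mem (X j : ℤ))) h.mem
    convert h2 using 1
    abel
  zero k hk := by
    rcases Nat.lt_succ_iff_lt_or_eq.1 hk with hk | rfl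
    · simp [h.zero k hk, hP.pivot_zero k hk]
    · have := E.pos k (hj.trans_le E.le)
      rw [hP.eq_one, show X k + X k * (E.D k - 1) = X k * E.D k by
        obtain ⟨d, hd⟩ : ∃ d, E.D k = d + 1 := ⟨E.D k - 1, by omega⟩
        rw [hd]; simp; ring]
      simp

/-- A bound for the number of steps of the Euclidean algorithm. -/
def euclidFuel (a b : ℕ) : ℕ := Nat.size (a * b) + if b ≤ a then 0 else 1

/-- If `b ≤ a`, then `2 (a % b) < a`, so the product of the two numbers at least halves and its size
drops. If `a < b`, the step only exchanges them, which uses up the extra unit. -/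
theorem euclidFuel_lt {a b : ℕ} (ha : 0 < a) (hb : 0 < b) :
    euclidFuel b (a % b) < euclidFuel a b := by
  have h1 := Nat.mod_lt a hb
  rw [euclidFuel, euclidFuel, if_pos h1.le]
  split_ifs with h
  · have h2 : 2 * (a % b) < a := by
      have := Nat.mod_add_div a b
      have : 1 ≤ a / b := (Nat.one_le_div_iff hb).2 h
      nlinarith
    rw [add_zero, add_zero, Nat.lt_size]
    rcases Nat.eq_zero_or_pos (b * (a % b)) with h0 | h0
    · rw [h0, Nat.size_zero, pow_zero]; exact Nat.mul_pos ha hb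
    · have h3 : 2 ^ (Nat.size (b * (a % b)) - 1) ≤ b * (a % b) :=
        Nat.lt_size.1 (by have := Nat.size_pos.2 h0; omega)
      have h4 : 0 < Nat.size (b * (a % b)) := Nat.size_pos.2 h0
      calc 2 ^ Nat.size (b * (a % b)) = 2 ^ (Nat.size (b * (a % b)) - 1) * 2 := by
            rw [← pow_succ]; congr 1; omega
        _ ≤ b * (a % b) * 2 := Nat.mul_le_mul_right _ h3
        _ = b * (2 * (a % b)) := by ring
        _ ≤ b * a := Nat.mul_le_mul_left _ h2.le
        _ = a * b := mul_comm _ _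
  · rw [Nat.mod_eq_of_lt (not_le.1 h), mul_comm]; omega

theorem eq_zero_of_euclidFuel {a b : ℕ} (ha : 0 < a) (h : euclidFuel a b = 0) : b = 0 := by
  have h1 : Nat.size (a * b) = 0 := by unfold euclidFuel at h; omega
  rw [Nat.size_eq_zero] at h1
  rcases Nat.mul_eq_zero.1 h1 with h | h
  · omega
  · exact h

end Elimination

/-! ### Building blocks of the programs -/

/-- The expression with the value `1` if `e = f` and `0` otherwise. -/
def Arith.eq (e f : Arith) : Arith := .sub (.sub (.lit 1) (.sub e f)) (.sub f e)

theorem Arith.eval_eq (σ : Store) (e f : Arith) :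
    (Arith.eq e f).eval σ = if e.eval σ = f.eval σ then 1 else 0 := by
  simp only [Arith.eq, Arith.eval]
  split_ifs with h <;> omega

/-- The value of `a` if `e = f`, and of `b` otherwise. -/
def Arith.ite (e f a b : Arith) : Arith :=
  .add (.mul (.eq e f) a) (.mul (.sub (.lit 1) (.eq e f)) b)

theorem Arith.eval_ite (σ : Store) (e f a b : Arith) :
    (Arith.ite e f a b).eval σ = if e.eval σ = f.eval σ then a.eval σ else b.eval σ := by
  simp only [Arith.ite, Arith.eval, Arith.eval_eq]
  split_ifs <;> simp

/-- A sequence of commands. -/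
def block : List Cmd → Cmd
  | [] => .skip
  | c :: l => .seq c (block l)

section Block

variable {O : Oracle} {Z S : ℕ} {Q : Store → Prop} {l : List Cmd} {σ : Store}

theorem block_nil (h : Q σ) : Run O Z (block []) σ ((S + 1) * 0 + 1) Q := by
  intro hσ Post k m hk
  rw [Nat.mul_zero, Nat.zero_add, Nat.add_comm]
  exact ⟨hσ, hk σ hσ h⟩

/-- A common bound `S` for all commands makes the step count of a block depend only on its length.
-/
theorem block_cons {c : Cmd} {n : ℕ} (hn : n ≤ S)
    (h : Run O Z c σ n fun σ' => Run O Z (block l) σ' ((S + 1) * l.length + 1) Q) :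
    Run O Z (block (c :: l)) σ ((S + 1) * (l.length + 1) + 1) Q :=
  (Run.seq h).weaken (by ring_nf; omega) fun _ h => h

variable {ns : List ℕ} {as : Msg}

theorem block_fill {a : ℕ} {N e : Arith} (n : ℕ) (g : ℕ → ℕ) (hS : 4 * Z + 5 ≤ S)
    (ha : a < as.length)
    (hN : ∀ i v, N.eval (mkS (i :: ns) (as.set a v)) = n)
    (he : ∀ i v, i < n → e.eval (mkS (i :: ns) (as.set a v)) = g i)
    (hb : bitLen ((List.range n).map g) ≤ Z)
    (h : Run O Z (block l) (mkS (0 :: ns) (as.set a ((List.range n).map g)))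
      ((S + 1) * l.length + 1) Q) :
    Run O Z (block (fillCmd a N e :: l)) (mkS (0 :: ns) as) ((S + 1) * (l.length + 1) + 1) Q :=
  block_cons hS (run_fill n g ha hN he hb h)

theorem block_extend {a : ℕ} {N e : Arith} (n : ℕ) (g : ℕ → ℕ) (w : List ℕ)
    (hS : 4 * Z + 5 ≤ S) (ha : a < as.length) (hw : as.getD a [] = w)
    (hN : ∀ i v, N.eval (mkS (i :: ns) (as.set a v)) = n)
    (he : ∀ i v, i < n → e.eval (mkS (i :: ns) (as.set a v)) = g i)
    (hb : bitLen (w ++ (List.range n).map g) ≤ Z)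
    (h : Run O Z (block l) (mkS (0 :: ns) (as.set a (w ++ (List.range n).map g)))
      ((S + 1) * l.length + 1) Q) :
    Run O Z (block (extendCmd a N e :: l)) (mkS (0 :: ns) as) ((S + 1) * (l.length + 1) + 1) Q :=
  block_cons (by omega) (run_extend n g w ha hw hN he hb h)

theorem block_assign {x : ℕ} {e : Arith} (v : ℕ) (hS : 4 * Z + 5 ≤ S) (hx : x < ns.length)
    (hv : e.eval (mkS ns as) = v) (hs : Nat.size v ≤ Z)
    (h : Run O Z (block l) (mkS (ns.set x v) as) ((S + 1) * l.length + 1) Q) :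
    Run O Z (block (.assign x e :: l)) (mkS ns as) ((S + 1) * (l.length + 1) + 1) Q :=
  block_cons (by omega) (Run.assign (by rwa [hv]) (by rwa [hv, mkS_setNum hx]))

theorem block_push {a : ℕ} {e : Arith} (v : ℕ) (w : List ℕ) (hS : 4 * Z + 5 ≤ S)
    (ha : a < as.length) (hw : as.getD a [] = w)
    (hv : e.eval (mkS ns as) = v) (hs : bitLen (w ++ [v]) ≤ Z)
    (h : Run O Z (block l) (mkS ns (as.set a (w ++ [v]))) ((S + 1) * l.length + 1) Q) :
    Run O Z (block (.push a e :: l)) (mkS ns as) ((S + 1) * (l.length + 1) + 1) Q := by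
  have hw' : (mkS ns as).arr a = w := hw
  exact block_cons (by omega) (Run.push (by rwa [hv, hw']) (by rwa [hv, hw', mkS_setArr ha]))

theorem block_copy {a b : ℕ} (w : List ℕ) (hS : 4 * Z + 5 ≤ S) (ha : a < as.length)
    (hw : as.getD b [] = w)
    (h : Run O Z (block l) (mkS ns (as.set a w)) ((S + 1) * l.length + 1) Q) :
    Run O Z (block (.copy a b :: l)) (mkS ns as) ((S + 1) * (l.length + 1) + 1) Q := by
  have hw' : (mkS ns as).arr b = w := hw
  exact block_cons (by omega) (Run.copy (by rwa [hw', mkS_setArr ha]))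

theorem block_clear {a : ℕ} (hS : 4 * Z + 5 ≤ S) (ha : a < as.length)
    (h : Run O Z (block l) (mkS ns (as.set a [])) ((S + 1) * l.length + 1) Q) :
    Run O Z (block (.clear a :: l)) (mkS ns as) ((S + 1) * (l.length + 1) + 1) Q :=
  block_cons (by omega) (Run.clear (by rwa [mkS_setArr ha]))

theorem block_call_one {t : Task} {args : List ℕ} {a : ℕ} (hS : 4 * Z + 5 ≤ S)
    (ha : a < as.length) (x : Msg) (hx : args.map (fun b => as.getD b []) = x)
    (h : ∀ y ∈ (O t x).support, ∃ w, y = [w] ∧ msgLen [w] ≤ Z ∧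
      Run O Z (block l) (mkS ns (as.set a w)) ((S + 1) * l.length + 1) Q) :
    Run O Z (block (.call t args [a] :: l)) (mkS ns as) ((S + 1) * (l.length + 1) + 1) Q := by
  refine block_cons (by omega) (Run.call fun y hy => ?_)
  have hx' : args.map (mkS ns as).arr = x := hx
  rw [hx'] at hy
  obtain ⟨w, rfl, h1, h2⟩ := h y hy
  exact ⟨h1, by rwa [mkS_receive_one ha]⟩

theorem block_call_two {t : Task} {args : List ℕ} {a b : ℕ} (hS : 4 * Z + 5 ≤ S)
    (ha : a < as.length) (hb : b < as.length) (hab : a ≠ b) (x : Msg)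
    (hx : args.map (fun b => as.getD b []) = x)
    (h : ∀ y ∈ (O t x).support, ∃ v w, y = [v, w] ∧ msgLen [v, w] ≤ Z ∧
      Run O Z (block l) (mkS ns ((as.set a v).set b w)) ((S + 1) * l.length + 1) Q) :
    Run O Z (block (.call t args [a, b] :: l)) (mkS ns as) ((S + 1) * (l.length + 1) + 1) Q := by
  refine block_cons (by omega) (Run.call fun y hy => ?_)
  have hx' : args.map (mkS ns as).arr = x := hx
  rw [hx'] at hy
  obtain ⟨v, w, rfl, h1, h2⟩ := h y hy
  exact ⟨h1, by rwa [mkS_receive_two ha hb hab]⟩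

/-- Registers beyond the lists read as zero or empty, so the padding changes nothing; it provides
list positions for the arrays that are written later. -/
theorem mkS_append_replicate (x : Msg) (k : ℕ) (P : Program) :
    (P.init x).store = mkS [0, 0, 0] (x ++ List.replicate k []) := by
  simp only [Program.init, mkS, Store.mk.injEq]
  constructor
  · funext y
    match y with
    | 0 => rfl
    | 1 => rfl
    | 2 => rfl
    | n + 3 => rfl
  · funext a
    simp only [List.getD_eq_getElem?_getD, List.getElem?_append, List.getElem?_replicate]
    split_ifs with h1 h2
    · rfl
    · rw [List.getElem?_eq_none (by omega)]; rfl
    · rw [List.getElem?_eq_none (by omega)]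

end Block

/-! ### Bounds for the contents of the registers. -/

section Fits

theorem map_getD_range (w : List ℕ) : ((List.range w.length).map fun k => w.getD k 0) = w := by
  refine List.ext_getElem (by simp) fun i h1 h2 => ?_
  simp [List.getD_eq_getElem?_getD, h2]

theorem size_getD_le {w : List ℕ} {B : ℕ} (h : bitLen w ≤ B) (k : ℕ) :
    Nat.size (w.getD k 0) ≤ B := by
  by_cases hk : k < w.length
  · rw [List.getD_eq_getElem _ _ hk]
    exact (size_lt_bitLen (List.getElem_mem hk)).le.trans h
  · rw [List.getD_eq_default _ _ (not_lt.1 hk)]; simp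

theorem bitLen_abCode_le {d : List ℕ} (hd : ∀ a ∈ d, 0 < a) (x : AbGrp d) :
    bitLen (abCode x) ≤ bitLen d := by
  have h : abCode x = (List.finRange d.length).map fun i => (x i).val := List.ofFn_eq_map
  have h2 : d = (List.finRange d.length).map fun i => d.get i := by simp
  rw [h]
  conv_rhs => rw [h2]
  rw [bitLen, bitLen, List.map_map, List.map_map]
  refine List.sum_le_sum fun i _ => ?_
  have : NeZero (d.get i) := ⟨(hd _ (List.get_mem _ _)).ne'⟩
  have h3 := Nat.size_le_size (ZMod.val_lt (x i)).le
  simp only [Function.comp]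
  omega

/-- A bound for the sizes of the registers of the programs, in terms of a bound for the bit lengths
of the data. -/
def storeBound (B : ℕ) : ℕ := 4096 * (B + 1) ^ 4

/-- The constant and the exponent come from the multiplication table of the matrix ring, which has
`(16 n)³ = 4096 n³` entries. -/
theorem bitLen_le_storeBound {B n : ℕ} {g : ℕ → ℕ} (hn : n ≤ 4096 * (B + 1) ^ 3)
    (hg : ∀ k < n, Nat.size (g k) ≤ B) : bitLen ((List.range n).map g) ≤ storeBound B := by
  have h := bitLen_le_mul (w := (List.range n).map g) (z := B) (by
    intro a ha
    obtain ⟨k, hk, rfl⟩ := List.mem_map.1 ha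
    exact hg k (List.mem_range.1 hk))
  rw [List.length_map, List.length_range] at h
  calc _ ≤ n * (B + 1) := h
    _ ≤ 4096 * (B + 1) ^ 3 * (B + 1) := Nat.mul_le_mul_right _ hn
    _ = storeBound B := by rw [storeBound]; ring

theorem le_cube (B : ℕ) : B + 1 ≤ (B + 1) ^ 3 := Nat.le_self_pow (by norm_num) _

theorem le_storeBound (B : ℕ) : 4096 * (B + 1) ≤ storeBound B := by
  rw [storeBound]
  exact Nat.mul_le_mul_left _ (Nat.le_self_pow (by norm_num) _)

theorem matDims_fits {d : List ℕ} {B : ℕ} (hd : bitLen d ≤ B) :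
    bitLen (matDims d) ≤ storeBound B :=
  bitLen_le_storeBound (by have := length_le_bitLen d; have := le_cube B; omega)
    fun _ _ => size_getD_le hd _

theorem size_matEntry_le {d t : List ℕ} {B : ℕ} (ht : bitLen t ≤ B) (i j k : ℕ) :
    Nat.size (matEntry d t i j k) ≤ B := by
  rw [matEntry]
  split_ifs
  · exact size_getD_le ht _
  · simp

theorem matTable_fits {d t : List ℕ} {B : ℕ} (hd : bitLen d ≤ B) (ht : bitLen t ≤ B) :
    bitLen (matTable d t) ≤ storeBound B := by
  refine bitLen_le_storeBound ?_ fun _ _ => size_matEntry_le ht _ _ _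
  have h1 : d.length ≤ B + 1 := by have := length_le_bitLen d; omega
  calc 16 * d.length * (16 * d.length * (16 * d.length)) = 4096 * d.length ^ 3 := by ring
    _ ≤ _ := Nat.mul_le_mul_left _ (Nat.pow_le_pow_left h1 3)

theorem diagList_fits {n B : ℕ} {u w : List ℕ} (hn : n ≤ B) (hu : bitLen u ≤ B)
    (hw : bitLen w ≤ B) : bitLen (diagList n u w) ≤ storeBound B := by
  refine bitLen_le_storeBound (by have := le_cube B; omega) fun k _ => ?_
  split_ifs
  · exact size_getD_le hu _
  · exact size_getD_le hw _
  · simp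

theorem msgLen_matCode_le {R : Type} [Ring R] (κ : RingCode R) {B : ℕ} (hd : bitLen κ.dims ≤ B)
    (ht : bitLen κ.table ≤ B) : msgLen (matCode κ).msg ≤ 2 * (storeBound B + 1) := by
  have h1 := matDims_fits hd
  have h2 := matTable_fits hd ht
  simp only [matCode_msg, msgLen, List.map_cons, List.map_nil, List.sum_cons, List.sum_nil]
  omega

end Fits

/-! ### Programs that write the encodings of `M₄(R)` and of diagonal matrices. -/

section MatrixRing

/-- The length of the array `0`. -/
abbrev dimE : Arith := .len 0

/-- `16` times the length of the array `0`. -/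
def matDimE : Arith := .mul (.lit 16) dimE

def rowE (e : Arith) : Arith := .mod (.div (.div e dimE) (.lit 4)) (.lit 4)

def colE (e : Arith) : Arith := .mod (.div e dimE) (.lit 4)

/-- The entry with indices `i`, `j`, `k` of the multiplication table of the matrix ring. -/
def matEntryE (i j k : Arith) : Arith :=
  .ite (colE i) (rowE j)
    (.ite (rowE k) (rowE i)
      (.ite (colE k) (colE j)
        (.get 1 (.add (.mul (.add (.mul (.mod i dimE) dimE) (.mod j dimE)) dimE) (.mod k dimE)))
        (.lit 0))
      (.lit 0))
    (.lit 0)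

theorem eval_matEntryE {σ : Store} {d t : List ℕ} (hd : σ.arr 0 = d) (ht : σ.arr 1 = t)
    (i j k : Arith) :
    (matEntryE i j k).eval σ = matEntry d t (i.eval σ) (j.eval σ) (k.eval σ) := by
  subst hd ht
  simp only [matEntryE, Arith.eval_ite, matEntry, matRow, matCol, Fin.ext_iff, Fin.ofNat, rowE,
    colE, Arith.eval]
  split_ifs <;> simp_all

/-- Write the encoding of the matrix ring into the arrays `8` and `9`. -/
def matrixCmds : List Cmd :=
  [fillCmd 8 matDimE (.get 0 (.mod (.var 0) dimE)),
   fillCmd 9 (.mul matDimE (.mul matDimE matDimE))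
    (matEntryE (.div (.var 0) (.mul matDimE matDimE))
      (.div (.mod (.var 0) (.mul matDimE matDimE)) matDimE) (.mod (.var 0) matDimE))]

/-- The entries of `diag(u, w, w, w)`, where `u` and `w` are in the arrays `a` and `b`. -/
def diagE (a b : ℕ) : Arith :=
  .ite (.mod (.div (.var 0) dimE) (.lit 5)) (.lit 0)
    (.ite (.div (.var 0) dimE) (.lit 0) (.get a (.mod (.var 0) dimE))
      (.get b (.mod (.var 0) dimE)))
    (.lit 0)

variable {O : Oracle} {Z S B : ℕ} {Q : Store → Prop} {l : List Cmd}

theorem block_matrix {ns : List ℕ} {as : Msg} {d t : List ℕ} (hS : 4 * Z + 5 ≤ S)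
    (hZ : storeBound B ≤ Z) (hd : bitLen d ≤ B) (ht : bitLen t ≤ B) (has : 9 < as.length)
    (h : Run O Z (block l) (mkS (0 :: ns)
      (((d :: t :: as).set 8 (matDims d)).set 9 (matTable d t))) ((S + 1) * l.length + 1) Q) :
    Run O Z (block (matrixCmds ++ l)) (mkS (0 :: ns) (d :: t :: as))
      ((S + 1) * (l.length + 2) + 1) Q := by
  refine block_fill (l := fillCmd 9 _ _ :: l) (16 * d.length) (fun p => d.getD (p % d.length) 0)
    hS ?_ (fun _ _ => rfl) (fun _ _ _ => rfl) ((matDims_fits hd).trans hZ) ?_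
  · simp; omega
  refine block_fill (16 * d.length * (16 * d.length * (16 * d.length))) _
    hS ?_ (fun _ _ => rfl) (fun i v _ => ?_) ((matTable_fits hd ht).trans hZ) h
  · simp; omega
  · rw [eval_matEntryE (d := d) (t := t) rfl rfl]; rfl

theorem eval_diagE {σ : Store} {a b n : ℕ} {u w : List ℕ} (h0 : (σ.arr 0).length = n)
    (hu : σ.arr a = u) (hw : σ.arr b = w) :
    (diagE a b).eval σ = if σ.num 0 / n % 5 = 0 then
      (if σ.num 0 / n = 0 then u else w).getD (σ.num 0 % n) 0 else 0 := by
  subst h0 hu hw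
  simp only [diagE, Arith.eval_ite, Arith.eval]
  split_ifs <;> simp_all

end MatrixRing

/-! ### The programs for the group and for images -/

section Diagonal

variable {R : Type} [Ring R]

/-- The matrix `diag(u, w, w, w)`. -/
def diagUnit (u w : Rˣ) : (Matrix (Fin 4) (Fin 4) R)ˣ where
  val := Matrix.diagonal fun i => if i = 0 then (u : R) else w
  inv := Matrix.diagonal fun i => if i = 0 then ((u⁻¹ : Rˣ) : R) else (w⁻¹ : Rˣ)
  val_inv := by
    rw [Matrix.diagonal_mul_diagonal, ← Matrix.diagonal_one]
    congr 1; funext i; split_ifs <;> simp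
  inv_val := by
    rw [Matrix.diagonal_mul_diagonal, ← Matrix.diagonal_one]
    congr 1; funext i; split_ifs <;> simp

theorem diagUnit_mul (u w u' w' : Rˣ) :
    diagUnit (u * u') (w * w') = diagUnit u w * diagUnit u' w' := by
  ext1
  show Matrix.diagonal _ = Matrix.diagonal _ * Matrix.diagonal _
  rw [Matrix.diagonal_mul_diagonal]
  congr 1; funext i; split_ifs <;> simp

theorem diagUnit_one : diagUnit (1 : Rˣ) 1 = 1 := by
  ext1
  show Matrix.diagonal _ = 1
  simp

theorem encode_diagUnit (κ : RingCode R) (u w : Rˣ) :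
    (matCode κ).encode (diagUnit u w : (Matrix (Fin 4) (Fin 4) R)ˣ) =
      diagList κ.dims.length (κ.encode u) (κ.encode w) :=
  matCode_encode_diagonal κ u w

end Diagonal

/-- The oracle `O` determines the abelianization of `Rˣ`, as the quotient `A` with the auxiliary
data `s`, by the homomorphism `φ`. -/
structure Solved (O : Oracle) {R : Type} [Ring R] (κ : RingCode R) (A s : List ℕ)
    (φ : Rˣ →* Multiplicative (AbGrp A)) : Prop where
  pos : ∀ a ∈ A, 0 < a
  surjective : Function.Surjective φ
  ker : φ.ker = commutator Rˣ
  image : ∀ (u : Rˣ), ∀ y ∈ (O Task.image (κ.msg ++ [A, s, κ.encode u])).support,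
    y = [abCode (Multiplicative.toAdd (φ u))]
  preimage : ∀ (x : AbGrp A), ∀ y ∈ (O Task.preimage (κ.msg ++ [A, s, abCode x])).support,
    ∃ u : Rˣ, φ u = Multiplicative.ofAdd x ∧ y = [κ.encode u]

/-- The auxiliary data of the matrix ring together with those of the ring. -/
def packAux (A s₁ s₂ : List ℕ) : List ℕ := A.length :: s₁.length :: (A ++ (s₁ ++ s₂))

section Pack

variable (A s₁ s₂ : List ℕ)

theorem packAux_group :
    (List.range A.length).map (fun k => (packAux A s₁ s₂).getD (2 + k) 0) = A := by
  refine List.ext_getElem (by simp) fun i h1 h2 => ?_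
  simp [packAux, List.getD_eq_getElem?_getD, add_comm 2, List.getElem?_append, h2]

theorem packAux_fst :
    (List.range s₁.length).map (fun k => (packAux A s₁ s₂).getD (2 + A.length + k) 0) = s₁ := by
  refine List.ext_getElem (by simp) fun i h1 h2 => ?_
  simp [packAux, List.getD_eq_getElem?_getD, add_comm 2, add_right_comm, List.getElem?_append, h2]

theorem packAux_snd :
    (List.range s₂.length).map
      (fun k => (packAux A s₁ s₂).getD (2 + A.length + s₁.length + k) 0) = s₂ := by
  refine List.ext_getElem (by simp) fun i h1 h2 => ?_
  rw [List.getElem_map, List.getElem_range, show 2 + A.length + s₁.length + i =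
    (A.length + (s₁.length + i)) + 2 by omega]
  simp [packAux, List.getD_eq_getElem?_getD, h2]

theorem packAux_length : (packAux A s₁ s₂).length = 2 + A.length + s₁.length + s₂.length := by
  simp [packAux]; omega

theorem bitLen_packAux : bitLen (packAux A s₁ s₂) = Nat.size A.length + 1 +
    (Nat.size s₁.length + 1 + (bitLen A + (bitLen s₁ + bitLen s₂))) := by
  rw [← bitLen_append, ← bitLen_append]
  simp [packAux, bitLen]

end Pack

/-- The program for the first task. -/
def groupProgram : Program where
  body := block (.call Task.group [0, 1] [5, 6] :: (matrixCmds ++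
    [.call Task.group [8, 9] [2, 7], .clear 3, .push 3 (.len 5), .push 3 (.len 6),
      extendCmd 3 (.len 5) (.get 5 (.var 0)), extendCmd 3 (.len 6) (.get 6 (.var 0)),
      extendCmd 3 (.len 7) (.get 7 (.var 0))]))
  outs := [2, 3]

/-- Unpack the auxiliary data into the arrays `5`, `6`, `7`, write the encoding of the matrix ring
into the arrays `8` and `9`, and find an element of the commutator subgroup. -/
def prepareCmds (l : List Cmd) : List Cmd :=
  fillCmd 5 (.get 3 (.lit 0)) (.get 3 (.add (.lit 2) (.var 0))) ::
  fillCmd 6 (.get 3 (.lit 1)) (.get 3 (.add (.add (.lit 2) (.get 3 (.lit 0))) (.var 0))) ::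
  fillCmd 7 (.sub (.len 3) (.add (.add (.lit 2) (.get 3 (.lit 0))) (.get 3 (.lit 1))))
    (.get 3 (.add (.add (.add (.lit 2) (.get 3 (.lit 0))) (.get 3 (.lit 1))) (.var 0))) ::
  (matrixCmds ++ fillCmd 10 (.len 5) (.lit 0) :: .call Task.preimage [0, 1, 5, 6, 10] [11] :: l)

/-- The program for the second task. -/
def imageProgram : Program where
  body := block (prepareCmds [fillCmd 13 matDimE (diagE 4 11),
    .call Task.image [8, 9, 2, 7, 13] [14]])
  outs := [14]

/-! ### Specifications of the programs for the group and for images. -/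

section Specs

variable {R : Type} [Ring R] (κ : RingCode R) {O : Oracle} {Z B : ℕ}

theorem bitLen_single_le {w : List ℕ} (hw : bitLen w ≤ B) (hZ : storeBound B ≤ Z) :
    msgLen [w] ≤ Z := by
  have := le_storeBound B
  simp only [msgLen, List.map_cons, List.map_nil, List.sum_cons, List.sum_nil]
  omega

/-- The output group is the answer for `M₄(R)`. The answer for `R` is kept in the auxiliary data
because a randomized oracle need not repeat it, and later tasks must refer to the same pair of
homomorphisms. -/
theorem groupProgram_good (hZ : storeBound B ≤ Z) (hd : bitLen κ.dims ≤ B)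
    (ht : bitLen κ.table ≤ B)
    (h1 : ∀ y ∈ (O Task.group κ.msg).support, msgLen y ≤ B ∧ ∃ A s, y = [A, s])
    (h2 : ∀ y ∈ (O Task.group (matCode κ).msg).support, msgLen y ≤ B ∧ ∃ A s, y = [A, s]) :
    Good O Z (fun σ => ∃ A₁ s₁ A₂ s₂, [A₁, s₁] ∈ (O Task.group κ.msg).support ∧
      [A₂, s₂] ∈ (O Task.group (matCode κ).msg).support ∧ σ.arr 2 = A₂ ∧
        σ.arr 3 = packAux A₁ s₁ s₂) ((4 * Z + 6) * 10 + 1) [groupProgram.body]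
      (groupProgram.init κ.msg).store := by
  have hBZ := le_storeBound B
  rw [mkS_append_replicate _ 18]
  refine Run.good ?_ ?_
  swap
  · refine mkS_bounded (by simp) ?_
    intro w hw
    have : w = κ.dims ∨ w = κ.table ∨ w = [] := by simpa [RingCode.msg] using hw
    rcases this with rfl | rfl | rfl
    · omega
    · omega
    · simp [bitLen]
  refine block_call_two (S := 4 * Z + 5) le_rfl (by simp) (by simp) (by simp) κ.msg rfl ?_
  intro y hy
  obtain ⟨hyB, A₁, s₁, rfl⟩ := h1 y hy
  have hA1 : bitLen A₁ < B := (bitLen_lt_msgLen (by simp)).trans_le hyB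
  have hs1 : bitLen s₁ < B := (bitLen_lt_msgLen (by simp)).trans_le hyB
  refine ⟨A₁, s₁, rfl, by omega, ?_⟩
  refine block_matrix (d := κ.dims) (t := κ.table) le_rfl hZ hd ht (by simp) ?_
  refine block_call_two le_rfl (by simp) (by simp) (by simp) (matCode κ).msg rfl ?_
  intro y' hy'
  obtain ⟨hyB', A₂, s₂, rfl⟩ := h2 y' hy'
  have hs2 : bitLen s₂ < B := (bitLen_lt_msgLen (by simp)).trans_le hyB'
  refine ⟨A₂, s₂, rfl, by omega, ?_⟩
  have hp : bitLen (packAux A₁ s₁ s₂) ≤ Z := by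
    have e1 := size_le_self A₁.length
    have e2 := size_le_self s₁.length
    have e3 := length_le_bitLen A₁
    have e4 := length_le_bitLen s₁
    rw [bitLen_packAux]; omega
  rw [bitLen_packAux] at hp
  have h0 : bitLen ([] ++ [A₁.length] ++ [s₁.length]) =
      Nat.size A₁.length + 1 + (Nat.size s₁.length + 1) := by simp [bitLen]
  refine block_clear le_rfl (by simp) ?_
  refine block_push A₁.length [] le_rfl (by simp) rfl rfl (by simp [bitLen]; omega) ?_
  refine block_push s₁.length ([] ++ [A₁.length]) le_rfl (by simp) rfl rfl
    (by simp [bitLen]; omega) ?_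
  refine block_extend A₁.length (fun k => A₁.getD k 0) ([] ++ [A₁.length] ++ [s₁.length])
    le_rfl (by simp) rfl (fun _ _ => rfl) (fun _ _ _ => rfl) ?_ ?_
  · rw [map_getD_range, bitLen_append, h0]; omega
  rw [map_getD_range]
  refine block_extend s₁.length (fun k => s₁.getD k 0) ([] ++ [A₁.length] ++ [s₁.length] ++ A₁)
    le_rfl (by simp) rfl (fun _ _ => rfl) (fun _ _ _ => rfl) ?_ ?_
  · rw [map_getD_range, bitLen_append, bitLen_append, h0]; omega
  rw [map_getD_range]
  refine block_extend s₂.length (fun k => s₂.getD k 0)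
    ([] ++ [A₁.length] ++ [s₁.length] ++ A₁ ++ s₁)
    le_rfl (by simp) rfl (fun _ _ => rfl) (fun _ _ _ => rfl) ?_ ?_
  · rw [map_getD_range, bitLen_append, bitLen_append, bitLen_append, h0]; omega
  rw [map_getD_range]
  refine block_nil ⟨A₁, s₁, A₂, s₂, hy, hy', rfl, ?_⟩
  show [] ++ [A₁.length] ++ [s₁.length] ++ A₁ ++ s₁ ++ s₂ = packAux A₁ s₁ s₂
  simp [packAux]

variable {A₁ s₁ A₂ s₂ : List ℕ} {φ₁ : Rˣ →* Multiplicative (AbGrp A₁)}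
  {φ₂ : (Matrix (Fin 4) (Fin 4) R)ˣ →* Multiplicative (AbGrp A₂)} {κ}

theorem Solved.bitLen_encode (κ : RingCode R) (r : R) : bitLen (κ.encode r) ≤ bitLen κ.dims :=
  bitLen_abCode_le κ.dims_pos _

/-- The call of the oracle for an element of the abelianization of the unit group. -/
theorem Solved.block_preimage (hs : Solved O κ A₁ s₁ φ₁) {S : ℕ} {Q : Store → Prop}
    {l : List Cmd} {ns : List ℕ} {as : Msg} {args : List ℕ} {a : ℕ} (hS : 4 * Z + 5 ≤ S)
    (hZ : storeBound B ≤ Z) (hd : bitLen κ.dims ≤ B) (ha : a < as.length) (x : AbGrp A₁)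
    (hx : args.map (fun b => as.getD b []) = κ.msg ++ [A₁, s₁, abCode x])
    (h : ∀ u : Rˣ, φ₁ u = Multiplicative.ofAdd x →
      Run O Z (block l) (mkS ns (as.set a (κ.encode u))) ((S + 1) * l.length + 1) Q) :
    Run O Z (block (.call Task.preimage args [a] :: l)) (mkS ns as)
      ((S + 1) * (l.length + 1) + 1) Q := by
  refine block_call_one hS ha _ hx fun y hy => ?_
  obtain ⟨u, hu, rfl⟩ := hs.preimage x y hy
  exact ⟨_, rfl, bitLen_single_le ((Solved.bitLen_encode κ _).trans hd) hZ, h u hu⟩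

/-- The call of the oracle for the image of a diagonal matrix. -/
theorem Solved.block_diag (hs : Solved O (matCode κ) A₂ s₂ φ₂) {S : ℕ} {Q : Store → Prop}
    {l : List Cmd} {ns : List ℕ} {as : Msg} {b c : ℕ} (hS : 4 * Z + 5 ≤ S)
    (hZ : storeBound B ≤ Z) (hd : bitLen κ.dims ≤ B) (hA : bitLen A₂ ≤ B) (u w : Rˣ)
    (has : 14 < as.length) (h0 : as.getD 0 [] = κ.dims) (hb : as.getD b [] = κ.encode u)
    (hc : as.getD c [] = κ.encode w) (h8 : as.getD 8 [] = matDims κ.dims)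
    (h9 : as.getD 9 [] = matTable κ.dims κ.table) (h2 : as.getD 2 [] = A₂)
    (h7 : as.getD 7 [] = s₂) (hb' : b ≠ 13) (hc' : c ≠ 13)
    (h : Run O Z (block l) (mkS (0 :: ns) ((as.set 13 (diagList κ.dims.length (κ.encode u)
      (κ.encode w))).set 14 (abCode (Multiplicative.toAdd (φ₂ (diagUnit u w))))))
      ((S + 1) * l.length + 1) Q) :
    Run O Z (block (fillCmd 13 matDimE (diagE b c) ::
      .call Task.image [8, 9, 2, 7, 13] [14] :: l)) (mkS (0 :: ns) as)
      ((S + 1) * (l.length + 2) + 1) Q := by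
  have hset : ∀ (a : ℕ) (v : List ℕ), a ≠ 13 → (as.set 13 v).getD a [] = as.getD a [] := by
    intro a v ha
    simp [List.getD_eq_getElem?_getD, List.getElem?_set_ne (Ne.symm ha)]
  have hdl : κ.dims.length ≤ B := (length_le_bitLen _).trans hd
  refine block_fill (l := .call _ _ _ :: l) (16 * κ.dims.length) _ hS (by omega) ?_ ?_
    ((diagList_fits (n := κ.dims.length) (u := κ.encode u) (w := κ.encode w) hdl
      ((Solved.bitLen_encode κ _).trans hd) ((Solved.bitLen_encode κ _).trans hd)).trans hZ) ?_
  · intro i v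
    show 16 * ((as.set 13 v).getD 0 []).length = _
    rw [hset _ _ (by simp), h0]
  · intro i v _
    rw [eval_diagE (n := κ.dims.length) (u := κ.encode u) (w := κ.encode w)]
    · rfl
    · show ((as.set 13 v).getD 0 []).length = _
      rw [hset _ _ (by simp), h0]
    · show (as.set 13 v).getD b [] = _
      rw [hset _ _ hb', hb]
    · show (as.set 13 v).getD c [] = _
      rw [hset _ _ hc', hc]
  · refine block_call_one hS (by simpa using has)
      ((matCode κ).msg ++ [A₂, s₂, (matCode κ).encode (diagUnit u w : (Matrix (Fin 4) (Fin 4) R)ˣ)])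
      ?_ fun y hy => ?_
    · simp only [List.map_cons, List.map_nil]
      rw [hset 8 _ (by simp), hset 9 _ (by simp), hset 2 _ (by simp), hset 7 _ (by simp), h8, h9,
        h2, h7, encode_diagUnit]
      have : ∀ v : List ℕ, (as.set 13 v).getD 13 [] = v := by
        intro v
        simp [List.getD_eq_getElem?_getD, (by omega : 13 < as.length)]
      rw [this]; rfl
    · obtain rfl := hs.image _ y hy
      exact ⟨_, rfl, bitLen_single_le ((bitLen_abCode_le hs.pos _).trans hA) hZ, h⟩

/-- The unit `w` is a substitute for `1`, whose code is not part of the input. It is obtained as an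
oracle preimage of `0`, and all that is known of it is that it lies in the commutator subgroup. -/
theorem block_prepare (h1 : Solved O κ A₁ s₁ φ₁) (hZ : storeBound B ≤ Z)
    (hd : bitLen κ.dims ≤ B) (ht : bitLen κ.table ≤ B)
    (hp : bitLen (packAux A₁ s₁ s₂) ≤ B) {S : ℕ} (hS : 4 * Z + 5 ≤ S) (x : List ℕ)
    {l : List Cmd} {Q : Store → Prop}
    (h : ∀ w : Rˣ, w ∈ commutator Rˣ → Run O Z (block l)
      (mkS [0, 0, 0] [κ.dims, κ.table, A₂, packAux A₁ s₁ s₂, x, A₁, s₁, s₂, matDims κ.dims,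
        matTable κ.dims κ.table, abCode (0 : AbGrp A₁), κ.encode w, [], [], [], [], [], [], [],
        []]) ((S + 1) * l.length + 1) Q) :
    Run O Z (block (prepareCmds l)) (mkS [0, 0, 0] ([κ.dims, κ.table, A₂, packAux A₁ s₁ s₂, x] ++
      List.replicate 15 [])) ((S + 1) * (l.length + 7) + 1) Q := by
  have hBZ := le_storeBound B
  have hp' := hp
  rw [bitLen_packAux] at hp'
  refine block_fill (l := fillCmd 6 _ _ :: fillCmd 7 _ _ :: (matrixCmds ++ fillCmd 10 _ _ ::
    .call _ _ _ :: l)) A₁.length (fun k => (packAux A₁ s₁ s₂).getD (2 + k) 0) hS (by simp)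
    (fun _ _ => rfl) (fun _ _ _ => rfl) ?_ ?_
  · rw [packAux_group]; omega
  rw [packAux_group]
  refine block_fill (l := fillCmd 7 _ _ :: (matrixCmds ++ fillCmd 10 _ _ ::
    .call _ _ _ :: l)) s₁.length (fun k => (packAux A₁ s₁ s₂).getD (2 + A₁.length + k) 0) hS
    (by simp) (fun _ _ => rfl) (fun _ _ _ => rfl) ?_ ?_
  · rw [packAux_fst]; omega
  rw [packAux_fst]
  refine block_fill (l := (matrixCmds ++ fillCmd 10 _ _ ::
    .call _ _ _ :: l)) s₂.length
    (fun k => (packAux A₁ s₁ s₂).getD (2 + A₁.length + s₁.length + k) 0) hS (by simp)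
    (fun i v => ?_) (fun _ _ _ => rfl) ?_ ?_
  · show (packAux A₁ s₁ s₂).length - (2 + A₁.length + s₁.length) = _
    rw [packAux_length]; omega
  · rw [packAux_snd]; omega
  rw [packAux_snd]
  refine block_matrix (l := fillCmd 10 _ _ :: .call _ _ _ :: l) (d := κ.dims) (t := κ.table) hS hZ
    hd ht (by simp) ?_
  have h0 : (List.range A₁.length).map (fun _ => 0) = abCode (0 : AbGrp A₁) :=
    (abCode_eq_map _ _ fun _ => by simp).symm
  refine block_fill (l := .call _ _ _ :: l) A₁.length (fun _ => 0) hS (by simp)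
    (fun _ _ => rfl) (fun _ _ _ => rfl) ?_ ?_
  · rw [h0]
    have := bitLen_abCode_le h1.pos (0 : AbGrp A₁)
    omega
  rw [h0]
  refine h1.block_preimage hS hZ hd (by simp) 0 rfl fun u hu => h u ?_
  rw [← h1.ker, MonoidHom.mem_ker, hu]; rfl

theorem imageProgram_good (h1 : Solved O κ A₁ s₁ φ₁) (h2 : Solved O (matCode κ) A₂ s₂ φ₂)
    (hZ : storeBound B ≤ Z) (hd : bitLen κ.dims ≤ B) (ht : bitLen κ.table ≤ B)
    (hA : bitLen A₂ ≤ B) (hp : bitLen (packAux A₁ s₁ s₂) ≤ B) (u : Rˣ) :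
    Good O Z (fun σ => ∃ w ∈ commutator Rˣ,
      σ.arr 14 = abCode (Multiplicative.toAdd (φ₂ (diagUnit u w)))) ((4 * Z + 6) * 9 + 1)
      [imageProgram.body]
      (imageProgram.init (κ.msg ++ [A₂, packAux A₁ s₁ s₂, κ.encode u])).store := by
  have hBZ := le_storeBound B
  rw [mkS_append_replicate _ 15]
  refine Run.good ?_ ?_
  · refine block_prepare (S := 4 * Z + 5) (l := [_, _]) h1 hZ hd ht hp le_rfl (κ.encode u)
      fun w hw => ?_
    exact h2.block_diag (l := []) le_rfl hZ hd hA u w (by simp) rfl rfl rfl rfl rfl rfl rfl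
      (by simp) (by simp) (block_nil ⟨w, hw, rfl⟩)
  · refine mkS_bounded (by simp) ?_
    have := Solved.bitLen_encode κ (u : R)
    intro v hv
    have : v = κ.dims ∨ v = κ.table ∨ v = A₂ ∨ v = packAux A₁ s₁ s₂ ∨ v = κ.encode u ∨ v = [] := by
      simpa [RingCode.msg, or_assoc] using hv
    rcases this with rfl | rfl | rfl | rfl | rfl | rfl
    · omega
    · omega
    · omega
    · omega
    · omega
    · simp [bitLen]

end Specs

/-! ### The elimination program -/

/-- The entry in row `1` (a variable) and column `2` (a variable) of the matrix in the array `16`. -/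
def cellE : Arith := .get 16 (.add (.mul (.var 1) (.len 15)) (.var 2))

/-- The entries of the matrix in the array `16` after a step of the Euclidean algorithm. -/
def reduceE : Arith :=
  .ite (.div (.var 0) (.len 15)) (.var 1)
    (.mod (.add (.get 17 (.mod (.var 0) (.len 15)))
        (.mul (.div (.get 17 (.var 2)) cellE)
          (.sub (.get 15 (.mod (.var 0) (.len 15))) (.get 16 (.var 0)))))
      (.get 15 (.mod (.var 0) (.len 15))))
    (.get 16 (.var 0))

def euclidCmd : Cmd :=
  .loop cellE (block [fillCmd 18 (.len 16) reduceE,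
    fillCmd 17 (.len 15) (.get 16 (.add (.mul (.var 1) (.len 15)) (.var 0))), .copy 16 18])

def pivotCmd : Cmd :=
  .loop (.sub (.len 5) (.var 1)) (block [euclidCmd, .assign 1 (.add (.var 1) (.lit 1))])

def eliminateCmd : Cmd :=
  .loop (.sub (.len 2) (.var 2)) (block [
    fillCmd 17 (.len 15) (.mul (.eq (.var 0) (.var 2)) (.get 15 (.var 2))),
    .assign 1 (.lit 0), pivotCmd,
    fillCmd 18 (.len 15) (.mod (.add (.get 19 (.var 0)) (.mul (.get 19 (.var 2))
      (.sub (.get 15 (.var 0)) (.get 17 (.var 0))))) (.get 15 (.var 0))),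
    .copy 19 18, .assign 2 (.add (.var 2) (.lit 1))])

/-- A vector as a list. -/
def vecList (N : ℕ) (f : ℕ → ℕ) : List ℕ := (List.range N).map f

/-- The rows of a matrix one after the other. -/
def rowsList (m N : ℕ) (v : ℕ → ℕ → ℕ) : List ℕ := vecList (m * N) fun p => v (p / N) (p % N)

/-- The store during the elimination. -/
abbrev elimStore (F : ℕ → List ℕ) (i j : ℕ) (d v p t x : List ℕ) : Store :=
  mkS [0, i, j] [F 0, F 1, F 2, F 3, F 4, F 5, F 6, F 7, F 8, F 9, F 10, F 11, F 12, F 13, F 14,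
    d, v, p, t, x]

theorem vecList_length (N : ℕ) (f : ℕ → ℕ) : (vecList N f).length = N := by simp [vecList]

theorem vecList_getD {N k : ℕ} (f : ℕ → ℕ) (h : k < N) : (vecList N f).getD k 0 = f k :=
  getD_map_range N f h

theorem rowsList_lt {m N i k : ℕ} (hi : i < m) (hk : k < N) : i * N + k < m * N := by
  calc i * N + k < i * N + N := by omega
    _ = (i + 1) * N := by ring
    _ ≤ m * N := Nat.mul_le_mul_right _ hi

theorem rowsList_getD {m N i k : ℕ} (v : ℕ → ℕ → ℕ) (hi : i < m) (hk : k < N) :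
    (rowsList m N v).getD (i * N + k) 0 = v i k := by
  rw [rowsList, vecList_getD _ (rowsList_lt hi hk), mul_comm, Nat.mul_add_div (by omega),
    Nat.div_eq_of_lt hk, add_zero, Nat.mul_add_mod, Nat.mod_eq_of_lt hk]

theorem rowsList_succ (i N : ℕ) (v : ℕ → ℕ → ℕ) :
    rowsList (i + 1) N v = rowsList i N v ++ vecList N (v i) := by
  rw [rowsList, rowsList, vecList, vecList, vecList, Nat.succ_mul, List.range_add, List.map_append,
    List.map_map]
  congr 1
  refine List.map_congr_left fun k hk => ?_
  have hk : k < N := List.mem_range.1 hk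
  simp only [Function.comp]
  rw [mul_comm, Nat.mul_add_div (by omega), Nat.div_eq_of_lt hk, add_zero, Nat.mul_add_mod,
    Nat.mod_eq_of_lt hk]

/-- Bounds for the numbers of steps. -/
def euclidSteps (Z : ℕ) : ℕ := ((4 * Z + 6) * 3 + 1 + 1) * (2 * Z + 1) + 1

def pivotSteps (Z : ℕ) : ℕ := ((euclidSteps Z + 1) * 2 + 1 + 1) * Z + 1

def eliminateSteps (Z : ℕ) : ℕ := ((pivotSteps Z + 1) * 6 + 1 + 1) * Z + 1

theorem le_euclidSteps (Z : ℕ) : 4 * Z + 5 ≤ euclidSteps Z := by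
  rw [euclidSteps]; nlinarith [Nat.zero_le (Z * Z)]

section Elimination

variable {O : Oracle} {Z B : ℕ} {Q : Store → Prop} {E : EliminationData} {F : ℕ → List ℕ}

/-- The sizes of the elimination data are bounded, and fit to the arrays. -/
structure EliminationData.Fits (E : EliminationData) (F : ℕ → List ℕ) (B : ℕ) : Prop where
  N_eq : E.N = E.n + E.m
  n_eq : (F 2).length = E.n
  m_eq : (F 5).length = E.m
  n_le : E.n ≤ B
  m_le : E.m ≤ B
  size_le : ∀ k < E.N, Nat.size (E.D k) ≤ B

theorem EliminationData.Fits.vec (h : E.Fits F B) {f : ℕ → ℕ} (hf : ∀ k < E.N, f k ≤ E.D k) :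
    bitLen (vecList E.N f) ≤ storeBound B := by
  refine bitLen_le_storeBound ?_ fun k hk => (Nat.size_le_size (hf k hk)).trans (h.size_le k hk)
  have := le_cube B
  have := h.N_eq
  have := h.n_le
  have := h.m_le
  omega

theorem EliminationData.Fits.rows (h : E.Fits F B) {v : ℕ → ℕ → ℕ} {i : ℕ} (hi : i ≤ E.m)
    (hv : ∀ r < E.m, ∀ k < E.N, v r k < E.D k) : bitLen (rowsList i E.N v) ≤ storeBound B := by
  refine bitLen_le_storeBound ?_ fun p hp => ?_
  · have h1 : E.N ≤ 2 * B := by have := h.N_eq; have := h.n_le; have := h.m_le; omega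
    calc i * E.N ≤ B * (2 * B) := Nat.mul_le_mul (hi.trans h.m_le) h1
      _ ≤ 4096 * (B + 1) ^ 3 := by
        have h2 : B * (2 * B) ≤ 4096 * (B + 1) ^ 2 := by nlinarith
        exact h2.trans (Nat.mul_le_mul_left _ (Nat.pow_le_pow_right (by omega) (by norm_num)))
  · have hN : 0 < E.N := Nat.pos_of_ne_zero fun h0 => by simp [h0] at hp
    have h1 : p / E.N < E.m := (Nat.div_lt_of_lt_mul (by rwa [mul_comm] at hp)).trans_le hi
    have h2 := Nat.mod_lt p hN
    exact (Nat.size_le_size (hv _ h1 _ h2).le).trans (h.size_le _ h2)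

theorem eval_cellE {r j : ℕ} (v : ℕ → ℕ → ℕ) {p t x : List ℕ} (hr : r < E.m) (hj : j < E.N) :
    cellE.eval (elimStore F r j (vecList E.N E.D) (rowsList E.m E.N v) p t x) = v r j := by
  show (rowsList E.m E.N v).getD (r * (vecList E.N E.D).length + j) 0 = _
  rw [vecList_length, rowsList_getD v hr hj]

/-- The variant is `euclidFuel` of the two entries in column `j`. Initially it is at most `2 * Z +
1`: the sizes of the two entries, and one for a possible exchange. -/
theorem run_euclid (hF : E.Fits F B) (hZ : storeBound B ≤ Z) {j r : ℕ} (hj : j < E.n)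
    (hr : r < E.m) {v : ℕ → ℕ → ℕ} {P : ℕ → ℕ} {t x : List ℕ} (h : E.Pivot j r v P)
    (hQ : ∀ v P t, E.Pivot j (r + 1) v P → Q (elimStore F r j (vecList E.N E.D)
      (rowsList E.m E.N v) (vecList E.N P) t x)) :
    Run O Z euclidCmd (elimStore F r j (vecList E.N E.D) (rowsList E.m E.N v) (vecList E.N P) t x)
      (euclidSteps Z) Q := by
  have hjN : j < E.N := hj.trans_le E.le
  refine (Run.loop (i := 2 * Z + 1) (I := fun f σ => ∃ v P t, E.Pivot j r v P ∧
    euclidFuel (P j) (v r j) ≤ f ∧ σ = elimStore F r j (vecList E.N E.D) (rowsList E.m E.N v)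
      (vecList E.N P) t x) ?_ ?_ ?_ ?_)
  · rintro σ ⟨v, P, t, h, h0, rfl⟩
    rw [eval_cellE v hr hjN]
    exact eq_zero_of_euclidFuel h.pivot_pos (by omega)
  · rintro f σ ⟨v, P, t, h, hf, rfl⟩ h0
    rw [eval_cellE v hr hjN] at h0
    have h' := h.step hj hr h0
    refine block_fill (S := 4 * Z + 5) (l := [fillCmd _ _ _, .copy _ _]) (E.m * E.N)
      (fun p => Function.update v r (reduceRow E.D j P (v r)) (p / E.N) (p % E.N)) le_rfl (by simp)
      (fun i w => ?_) (fun p w hp => ?_) ((hF.rows le_rfl h'.lt).trans hZ) ?_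
    · show (rowsList E.m E.N v).length = _
      rw [rowsList, vecList_length]
    · have hN : 0 < E.N := by omega
      have h1 : p / E.N < E.m := Nat.div_lt_of_lt_mul (by rwa [mul_comm] at hp)
      have h2 := Nat.mod_lt p hN
      rw [reduceE, Arith.eval_ite]
      show (if p / (vecList E.N E.D).length = r then
        ((vecList E.N P).getD (p % (vecList E.N E.D).length) 0 +
          (vecList E.N P).getD j 0 / (rowsList E.m E.N v).getD (r * (vecList E.N E.D).length + j) 0
          * ((vecList E.N E.D).getD (p % (vecList E.N E.D).length) 0 -
            (rowsList E.m E.N v).getD p 0)) %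
            (vecList E.N E.D).getD (p % (vecList E.N E.D).length) 0
        else (rowsList E.m E.N v).getD p 0) = _
      rw [vecList_length, vecList_getD _ h2, vecList_getD _ h2, vecList_getD _ hjN,
        rowsList_getD v hr hjN, show (rowsList E.m E.N v).getD p 0 = v (p / E.N) (p % E.N) from
          vecList_getD _ hp]
      split_ifs with h3
      · rw [h3, Function.update_self]; rfl
      · rw [Function.update_of_ne h3]
    refine block_fill (l := [.copy _ _]) E.N (v r) le_rfl (by simp) (fun i w => ?_)
      (fun k w hk => ?_) ((hF.vec fun k hk => (h.lt r hr k hk).le).trans hZ) ?_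
    · show (vecList E.N E.D).length = _
      rw [vecList_length]
    · show (rowsList E.m E.N v).getD (r * (vecList E.N E.D).length + k) 0 = _
      rw [vecList_length, rowsList_getD v hr hk]
    refine block_copy (l := []) _ le_rfl (by simp) rfl ?_
    refine block_nil ⟨_, le_rfl, _, _, _, h', ?_, rfl⟩
    rw [Function.update_self, reduceRow_self (h.lt r hr j hjN) h0]
    exact Nat.lt_succ_iff.1 ((euclidFuel_lt h.pivot_pos (Nat.pos_of_ne_zero h0)).trans_le hf)
  · rintro f σ ⟨v, P, t, h, -, rfl⟩ h0
    rw [eval_cellE v hr hjN] at h0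
    exact hQ v P t (h.next h0)
  · refine ⟨v, P, t, h, ?_, rfl⟩
    have h1 := size_mul_le (P j) (v r j)
    have h2 := (Nat.size_le_size (h.pivot_le j hjN)).trans (hF.size_le j hjN)
    have h3 := (Nat.size_le_size (h.lt r hr j hjN).le).trans (hF.size_le j hjN)
    have h4 := le_storeBound B
    rw [euclidFuel]
    split_ifs <;> omega

theorem run_pivot (hF : E.Fits F B) (hZ : storeBound B ≤ Z) {j : ℕ} (hj : j < E.n)
    {v : ℕ → ℕ → ℕ} {P : ℕ → ℕ} {t x : List ℕ} (h : E.Pivot j 0 v P)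
    (hQ : ∀ i v P t, E.Pivot j E.m v P → Q (elimStore F i j (vecList E.N E.D)
      (rowsList E.m E.N v) (vecList E.N P) t x)) :
    Run O Z pivotCmd (elimStore F 0 j (vecList E.N E.D) (rowsList E.m E.N v) (vecList E.N P) t x)
      (pivotSteps Z) Q := by
  have hBZ := le_storeBound B
  have hm := hF.m_le
  have hev : ∀ r (a b c d e : List ℕ), (Arith.sub (.len 5) (.var 1)).eval
      (elimStore F r j a b c d e) = E.m - r := fun r a b c d e => by
    rw [← hF.m_eq]; rfl
  refine (Run.loop (i := E.m) (b := (euclidSteps Z + 1) * 2 + 1)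
    (I := fun f σ => ∃ r v P t, r + f = E.m ∧ E.Pivot j r v P ∧
      σ = elimStore F r j (vecList E.N E.D) (rowsList E.m E.N v)
        (vecList E.N P) t x) ?_ ?_ ?_ ?_).weaken ?_ fun _ h => h
  · rintro σ ⟨r, v, P, t, hr, h, rfl⟩
    rw [hev]; omega
  · rintro f σ ⟨r, v, P, t, hr, h, rfl⟩ -
    refine block_cons (l := [_]) le_rfl (run_euclid hF hZ hj (by omega) h fun v P t h => ?_)
    refine block_assign (l := []) (r + 1) (le_euclidSteps Z) (by simp) rfl
      ((size_le_self _).trans (by omega)) ?_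
    exact block_nil ⟨f, le_rfl, r + 1, v, P, t, by omega, h, rfl⟩
  · rintro f σ ⟨r, v, P, t, hr, h, rfl⟩ h0
    rw [hev] at h0
    obtain rfl : r = E.m := by omega
    exact hQ _ v P t h
  · exact ⟨0, v, P, t, by omega, h, rfl⟩
  · rw [pivotSteps]
    exact Nat.succ_le_succ (Nat.mul_le_mul_left _ (by omega))

theorem run_eliminate (hF : E.Fits F B) (hZ : storeBound B ≤ Z)
    {v : ℕ → ℕ → ℕ} {X : ℕ → ℕ} {p t : List ℕ} {i : ℕ} (h : E.Echelon 0 v)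
    (hX : ∀ k < E.N, X k < E.D k)
    (hQ : ∀ i j v p t X', E.Reduced X E.n X' →
      Q (elimStore F i j (vecList E.N E.D) v p t (vecList E.N X'))) :
    Run O Z eliminateCmd
      (elimStore F i 0 (vecList E.N E.D) (rowsList E.m E.N v) p t (vecList E.N X))
      (eliminateSteps Z) Q := by
  have hBZ := le_storeBound B
  have hn := hF.n_le
  have hev : ∀ i j (a b c d e : List ℕ), (Arith.sub (.len 2) (.var 2)).eval
      (elimStore F i j a b c d e) = E.n - j := fun i j a b c d e => by
    rw [← hF.n_eq]; rfl
  -- The inequality fails for `Z = 0`; this case is excluded by `4096 ≤ storeBound B ≤ Z`.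
  have hS : 4 * Z + 5 ≤ pivotSteps Z ∨ Z = 0 := by
    rcases Nat.eq_zero_or_pos Z with h0 | h0
    · exact Or.inr h0
    · left
      have := le_euclidSteps Z
      rw [pivotSteps]
      nlinarith
  replace hS : 4 * Z + 5 ≤ pivotSteps Z := hS.resolve_right (by omega)
  refine (Run.loop (i := E.n) (b := (pivotSteps Z + 1) * 6 + 1)
    (I := fun f σ => ∃ i j v p t X', j + f = E.n ∧ E.Echelon j v ∧ E.Reduced X j X' ∧
      σ = elimStore F i j (vecList E.N E.D) (rowsList E.m E.N v) p t (vecList E.N X'))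
      ?_ ?_ ?_ ?_).weaken ?_ fun _ h => h
  · rintro σ ⟨i, j, v, p, t, X', hj, -, -, rfl⟩
    rw [hev]; omega
  · rintro f σ ⟨i, j, v, p, t, X', hj, h, hX', rfl⟩ -
    have hjn : j < E.n := by omega
    have hjN : j < E.N := hjn.trans_le E.le
    have hp := h.pivot hjn
    refine block_fill (l := [.assign _ _, pivotCmd, fillCmd _ _ _, .copy _ _, .assign _ _]) E.N
      (fun k => if k = j then E.D j else 0) hS (by simp)
      (fun _ _ => vecList_length _ _) (fun k w hk => ?_) ((hF.vec hp.pivot_le).trans hZ) ?_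
    · rw [Arith.eval, Arith.eval_eq]
      show (if k = j then 1 else 0) * (vecList E.N E.D).getD j 0 = _
      rw [vecList_getD _ hjN]
      split_ifs <;> simp
    refine block_assign (l := [pivotCmd, fillCmd _ _ _, .copy _ _, .assign _ _]) 0 hS (by simp) rfl
      (by simp) ?_
    refine block_cons (l := [fillCmd _ _ _, .copy _ _, .assign _ _]) le_rfl
      (run_pivot hF hZ hjn hp fun i v P t hP => ?_)
    have hX'' := hX'.next hjn hP
    refine block_fill (l := [.copy _ _, .assign _ _]) E.N
      (fun k => (X' k + X' j * (E.D k - P k)) % E.D k) hS (by simp)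
      (fun _ _ => vecList_length _ _) (fun k w hk => ?_)
      ((hF.vec fun k hk => (hX''.lt k hk).le).trans hZ) ?_
    · show ((vecList E.N X').getD k 0 + (vecList E.N X').getD j 0 *
        ((vecList E.N E.D).getD k 0 - (vecList E.N P).getD k 0)) % (vecList E.N E.D).getD k 0 = _
      rw [vecList_getD _ hk, vecList_getD _ hk, vecList_getD _ hk, vecList_getD _ hjN]
    refine block_copy (l := [.assign _ _]) _ hS (by simp) rfl ?_
    refine block_assign (l := []) (j + 1) hS (by simp) rfl ((size_le_self _).trans (by omega)) ?_
    exact block_nil ⟨f, le_rfl, _, j + 1, v, _, _, _, by omega, hP.echelon, hX'', rfl⟩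
  · rintro f σ ⟨i, j, v, p, t, X', hj, h, hX', rfl⟩ h0
    rw [hev] at h0
    obtain rfl : j = E.n := by omega
    exact hQ _ _ _ _ _ X' hX'
  · exact ⟨i, 0, v, p, t, X, by omega, h, ⟨hX, by simp, by simp⟩, rfl⟩
  · rw [eliminateSteps]
    exact Nat.succ_le_succ (Nat.mul_le_mul_left _ (by omega))

end Elimination

/-! ### The program for preimages -/

/-! ### The graph of a homomorphism of finite abelian groups as an elimination problem. -/

section Glued

/-- The reduction of the coordinates from `c` on. -/
def reduceHom (A : List ℕ) (c : ℕ) : (ℕ → ℤ) →+ AbGrp A where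
  toFun z i := (z (c + i) : ZMod (A.get i))
  map_zero' := by funext i; simp
  map_add' z z' := by funext i; simp

theorem reduceHom_eq_zero_iff {A : List ℕ} {c : ℕ} {z : ℕ → ℤ} :
    reduceHom A c z = 0 ↔ ∀ i : Fin A.length, (A.get i : ℤ) ∣ z (c + i) := by
  rw [funext_iff]
  exact forall_congr' fun i => ZMod.intCast_zmod_eq_zero_iff_dvd _ _

theorem reduceHom_toZ {A : List ℕ} {c : ℕ} {f : ℕ → ℕ} {x : AbGrp A} (hA : ∀ a ∈ A, 0 < a)
    (h : ∀ i : Fin A.length, f (c + i) = (x i).val) : reduceHom A c (toZ f) = x := by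
  funext i
  have : NeZero (A.get i) := ⟨(hA _ (List.get_mem _ _)).ne'⟩
  show (((f (c + i) : ℕ) : ℤ) : ZMod (A.get i)) = x i
  rw [h, Int.cast_natCast, ZMod.natCast_zmod_val]

variable {A₁ A₂ : List ℕ}

theorem append_getD_left (v w : List ℕ) {k : ℕ} (hk : k < v.length) :
    (v ++ w).getD k 0 = v.getD k 0 := by
  simp [List.getD_eq_getElem?_getD, List.getElem?_append, hk]

theorem append_getD_right (v w : List ℕ) (k : ℕ) :
    (v ++ w).getD (v.length + k) 0 = w.getD k 0 := by
  rw [List.getD_eq_getElem?_getD, List.getD_eq_getElem?_getD,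
    List.getElem?_append_right (by omega), Nat.add_sub_cancel_left]

theorem getD_eq_get (v : List ℕ) (i : Fin v.length) : v.getD i 0 = v.get i := by
  simp [List.getD_eq_getElem?_getD]

variable (h : AbGrp A₁ →+ AbGrp A₂) (h1 : ∀ a ∈ A₁, 0 < a) (h2 : ∀ a ∈ A₂, 0 < a)

/-- The elimination problem for the graph of the homomorphism `h`. -/
def graphData : EliminationData where
  D k := (A₂ ++ A₁).getD k 0
  N := A₂.length + A₁.length
  n := A₂.length
  m := A₁.length
  H := (h.comp (reduceHom A₁ A₂.length) - reduceHom A₂ 0).ker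
  le := Nat.le_add_right _ _
  pos k hk := by
    have hk' : k < (A₂ ++ A₁).length := by simpa using hk
    rw [List.getD_eq_getElem _ _ hk']
    rcases List.mem_append.1 (List.getElem_mem hk') with h | h
    · exact h2 _ h
    · exact h1 _ h
  mem z hz := by
    have e1 : reduceHom A₁ A₂.length z = 0 := reduceHom_eq_zero_iff.2 fun i => by
      have := hz (A₂.length + i) (by omega)
      rwa [append_getD_right, getD_eq_get] at this
    have e2 : reduceHom A₂ 0 z = 0 := reduceHom_eq_zero_iff.2 fun i => by
      have := hz i (by omega)
      rwa [append_getD_left _ _ i.2, getD_eq_get, ← Nat.zero_add (i : ℕ)] at this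
    rw [AddMonoidHom.mem_ker, AddMonoidHom.sub_apply, AddMonoidHom.comp_apply, e1, e2, map_zero,
      sub_zero]

theorem mem_graphData {z : ℕ → ℤ} :
    z ∈ (graphData h h1 h2).H ↔ h (reduceHom A₁ A₂.length z) = reduceHom A₂ 0 z := by
  show z ∈ (h.comp (reduceHom A₁ A₂.length) - reduceHom A₂ 0).ker ↔ _
  rw [AddMonoidHom.mem_ker, AddMonoidHom.sub_apply, sub_eq_zero, AddMonoidHom.comp_apply]

theorem graphData_lt {f : ℕ → ℕ} (hf₂ : ∀ i : Fin A₂.length, f i < A₂.get i)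
    (hf₁ : ∀ i : Fin A₁.length, f (A₂.length + i) < A₁.get i) :
    ∀ k < (graphData h h1 h2).N, f k < (graphData h h1 h2).D k := by
  intro k (hk : k < A₂.length + A₁.length)
  show f k < (A₂ ++ A₁).getD k 0
  by_cases hk2 : k < A₂.length
  · rw [append_getD_left _ _ hk2, getD_eq_get _ ⟨k, hk2⟩]
    exact hf₂ ⟨k, hk2⟩
  · obtain ⟨i, rfl⟩ := Nat.exists_eq_add_of_le (not_lt.1 hk2)
    have hi : i < A₁.length := by omega
    rw [append_getD_right, getD_eq_get _ ⟨i, hi⟩]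
    exact hf₁ ⟨i, hi⟩

/-- The list that encodes `y` and `h y`. -/
def graphList (y : AbGrp A₁) : List ℕ := abCode (h y) ++ abCode y

/-- The `i`-th generator of `ℤ/d₁ × ⋯ × ℤ/dₙ`. -/
def unitVec (A : List ℕ) (i : ℕ) : AbGrp A := fun a => if (a : ℕ) = i then 1 else 0

/-- The remainder matters only for moduli equal to `1`, where the generator is zero. -/
theorem abCode_unitVec (A : List ℕ) (i : ℕ) : abCode (unitVec A i) =
    (List.range A.length).map fun k => (if k = i then 1 else 0) % A.getD k 0 := by
  refine abCode_eq_map _ _ fun k => ?_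
  rw [getD_eq_get, unitVec]
  split_ifs
  · rw [ZMod.val_one_eq_one_mod]
  · simp

/-- The rows that encode the generators and their images. -/
def graphRows (i : ℕ) : ℕ → ℕ := fun k => (graphList h (unitVec A₁ i)).getD k 0

theorem graphList_left (y : AbGrp A₁) (i : Fin A₂.length) :
    (graphList h y).getD i 0 = (h y i).val := by
  have := append_getD_left (abCode (h y)) (abCode y) (k := i) (by rw [abCode_length]; exact i.2)
  rw [graphList, this, abCode_getD]

theorem graphList_right (y : AbGrp A₁) (i : Fin A₁.length) :
    (graphList h y).getD (A₂.length + i) 0 = (y i).val := by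
  have := append_getD_right (abCode (h y)) (abCode y) i
  rw [abCode_length] at this
  rw [graphList, this, abCode_getD]

theorem vecList_graphRows (i : ℕ) :
    vecList (A₂.length + A₁.length) (graphRows h i) = graphList h (unitVec A₁ i) := by
  have : (graphList h (unitVec A₁ i)).length = A₂.length + A₁.length := by
    simp [graphList, abCode_length]
  rw [vecList, ← this]
  exact map_getD_range _

/-- The rows `(h eᵢ, eᵢ)` lie on the graph. Surjectivity of `h` says precisely that their `A₂`-parts
generate everything modulo the moduli, which is the condition `gen`. -/
theorem graphRows_echelon (hh : Function.Surjective h) :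
    (graphData h h1 h2).Echelon 0 (graphRows h) := by
  have hl : ∀ i, reduceHom A₂ 0 (toZ (graphRows h i)) = h (unitVec A₁ i) := fun i =>
    reduceHom_toZ h2 fun k => by rw [Nat.zero_add]; exact graphList_left h _ k
  have hr : ∀ i, reduceHom A₁ A₂.length (toZ (graphRows h i)) = unitVec A₁ i := fun i =>
    reduceHom_toZ h1 fun k => graphList_right h _ k
  constructor
  · constructor
    · intro i _
      refine graphData_lt h h1 h2 (fun k => ?_) fun k => ?_
      · have : NeZero (A₂.get k) := ⟨(h2 _ (List.get_mem _ _)).ne'⟩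
        rw [graphRows, graphList_left]
        exact ZMod.val_lt _
      · have : NeZero (A₁.get k) := ⟨(h1 _ (List.get_mem _ _)).ne'⟩
        rw [graphRows, graphList_right]
        exact ZMod.val_lt _
    · intro i _
      rw [mem_graphData, hl, hr]
    · intro i _ k hk
      omega
  · intro a
    obtain ⟨y, hy⟩ := hh (reduceHom A₂ 0 a)
    refine ⟨∑ i : Fin A₁.length, (y i).val • toZ (graphRows h i),
      sum_mem fun i _ => nsmul_mem (toZ_mem_rowSpan i.2 _) _, ?_⟩
    have hsum : reduceHom A₂ 0 ((∑ i : Fin A₁.length, (y i).val • toZ (graphRows h i)) - a) = 0 := by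
      rw [map_sub, map_sum, sub_eq_zero, ← hy]
      have : y = ∑ i : Fin A₁.length, (y i).val • unitVec A₁ i := by
        funext k
        have : NeZero (A₁.get k) := ⟨(h1 _ (List.get_mem _ _)).ne'⟩
        rw [Finset.sum_apply, Finset.sum_eq_single k]
        · simp [unitVec]
        · intro b _ hb
          have : (k : ℕ) ≠ b := fun e => hb (Fin.ext e.symm)
          simp [unitVec, this]
        · simp
      conv_rhs => rw [this]
      rw [map_sum]
      refine Finset.sum_congr rfl fun i _ => ?_
      rw [map_nsmul, map_nsmul, hl]
    intro k _ (hk : k < A₂.length)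
    have := reduceHom_eq_zero_iff.1 hsum ⟨k, hk⟩
    rw [Nat.zero_add] at this
    show (((A₂ ++ A₁).getD k 0 : ℕ) : ℤ) ∣ _
    rw [append_getD_left _ _ hk, getD_eq_get _ ⟨k, hk⟩]
    exact this

/-- The vector with the coordinates of `-x`, followed by zeros. -/
def negVec (A₁ : List ℕ) (x : AbGrp A₂) : ℕ → ℕ := fun k =>
  ((A₂ ++ A₁).getD k 0 - (abCode x).getD k 0) % (A₂ ++ A₁).getD k 0

theorem negVec_lt (x : AbGrp A₂) :
    ∀ k < (graphData h h1 h2).N, negVec A₁ x k < (graphData h h1 h2).D k :=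
  fun k hk => Nat.mod_lt _ ((graphData h h1 h2).pos k hk)

/-- Elimination turns `(-x, 0)` into some `(0, y)` without leaving its class modulo the graph. The
difference `(x, y)` lies on the graph, so `h y = x`. -/
theorem exists_of_reduced (x : AbGrp A₂) {X : ℕ → ℕ}
    (hX : (graphData h h1 h2).Reduced (negVec A₁ x) A₂.length X) :
    ∃ y : AbGrp A₁, h y = x ∧
      abCode y = (List.range A₁.length).map fun k => X (A₂.length + k) := by
  set y : AbGrp A₁ := reduceHom A₁ A₂.length (toZ X) with hy
  have e1 : reduceHom A₂ 0 (toZ X) = 0 := reduceHom_eq_zero_iff.2 fun i => by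
    simp [toZ, hX.zero i i.2]
  have e2 : reduceHom A₁ A₂.length (toZ (negVec A₁ x)) = 0 := reduceHom_eq_zero_iff.2 fun i => by
    -- Beyond the end of the code of `x` the default value `0` is read, and `(D - 0) % D = 0`.
    have : (abCode x).getD (A₂.length + i) 0 = 0 :=
      List.getD_eq_default _ _ (by rw [abCode_length]; omega)
    simp only [toZ, negVec, this, Nat.sub_zero, Nat.mod_self, Nat.cast_zero, dvd_zero]
  have e3 : reduceHom A₂ 0 (toZ (negVec A₁ x)) = -x := by
    funext i
    have : NeZero (A₂.get i) := ⟨(h2 _ (List.get_mem _ _)).ne'⟩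
    show (((negVec A₁ x (0 + i) : ℕ) : ℤ) : ZMod (A₂.get i)) = -(x i)
    rw [Nat.zero_add, negVec, append_getD_left _ _ i.2, getD_eq_get, abCode_getD, Int.cast_natCast,
      ZMod.natCast_mod, Nat.cast_sub (ZMod.val_lt _).le, ZMod.natCast_self,
      ZMod.natCast_zmod_val, zero_sub]
  have e4 := (mem_graphData h h1 h2).1 hX.mem
  rw [map_sub, map_sub, map_sub, e1, e2, e3, map_zero, sub_zero, zero_sub, neg_neg] at e4
  refine ⟨y, e4, abCode_eq_map _ _ fun i => ?_⟩
  have hlt := hX.lt (A₂.length + i) (show _ < A₂.length + A₁.length by omega)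
  have hD : (graphData h h1 h2).D (A₂.length + i) = A₁.get i := by
    show (A₂ ++ A₁).getD _ 0 = _
    rw [append_getD_right, getD_eq_get]
  rw [hD] at hlt
  show (((X (A₂.length + i) : ℕ) : ℤ) : ZMod (A₁.get i)).val = _
  rw [Int.cast_natCast, ZMod.val_natCast, Nat.mod_eq_of_lt hlt]

end Glued

/-- Compute the images of the generators. -/
def rowsCmd : Cmd :=
  .loop (.sub (.len 5) (.var 1)) (block [
    fillCmd 10 (.len 5) (.mod (.eq (.var 0) (.var 1)) (.get 5 (.var 0))),
    .call Task.preimage [0, 1, 5, 6, 10] [12],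
    fillCmd 13 matDimE (diagE 12 11),
    .call Task.image [8, 9, 2, 7, 13] [14],
    extendCmd 16 (.len 2) (.get 14 (.var 0)),
    extendCmd 16 (.len 5) (.get 10 (.var 0)),
    .assign 1 (.add (.var 1) (.lit 1))])

/-- The program for the third task. -/
def preimageProgram : Program where
  body := block (prepareCmds [.copy 15 2, extendCmd 15 (.len 5) (.get 5 (.var 0)), rowsCmd,
    fillCmd 19 (.len 15) (.mod (.sub (.get 15 (.var 0)) (.get 4 (.var 0))) (.get 15 (.var 0))),
    eliminateCmd, fillCmd 10 (.len 5) (.get 19 (.add (.len 2) (.var 0))),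
    .call Task.preimage [0, 1, 5, 6, 10] [14]])
  outs := [14]

/-! ### Specification of the program for preimages. -/

section Specs

variable {R : Type} [Ring R] {κ : RingCode R} {O : Oracle} {Z B : ℕ} {A₁ s₁ A₂ s₂ : List ℕ}
  {φ₁ : Rˣ →* Multiplicative (AbGrp A₁)}
  {φ₂ : (Matrix (Fin 4) (Fin 4) R)ˣ →* Multiplicative (AbGrp A₂)}

/-- The number of steps for the images of the generators. -/
def rowsSteps (Z : ℕ) : ℕ := ((4 * Z + 6) * 7 + 1 + 1) * Z + 1

theorem rowsSteps_le (Z : ℕ) : rowsSteps Z ≤ eliminateSteps Z := by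
  have h1 : (4 * Z + 6) * 7 + 1 + 1 ≤ (pivotSteps Z + 1) * 6 + 1 + 1 ∨ Z = 0 := by
    rcases Nat.eq_zero_or_pos Z with h0 | h0
    · exact Or.inr h0
    · left
      have := le_euclidSteps Z
      rw [pivotSteps]
      nlinarith
  rcases h1 with h1 | rfl
  · exact Nat.succ_le_succ (Nat.mul_le_mul_right _ h1)
  · simp [rowsSteps, eliminateSteps]

/-- The data are bounded. -/
structure DataBounded (κ : RingCode R) (A₁ s₁ A₂ s₂ : List ℕ) (B : ℕ) : Prop where
  dims : bitLen κ.dims ≤ B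
  table : bitLen κ.table ≤ B
  group : bitLen A₂ ≤ B
  aux : bitLen (packAux A₁ s₁ s₂) ≤ B

theorem DataBounded.group_fst (h : DataBounded κ A₁ s₁ A₂ s₂ B) : bitLen A₁ ≤ B := by
  have := h.aux
  rw [bitLen_packAux] at this
  omega

variable {h : AbGrp A₁ →+ AbGrp A₂}

theorem graphData_fits (hb : DataBounded κ A₁ s₁ A₂ s₂ B) (h1 : ∀ a ∈ A₁, 0 < a)
    (h2 : ∀ a ∈ A₂, 0 < a) {F : ℕ → List ℕ} (hF2 : F 2 = A₂) (hF5 : F 5 = A₁) :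
    (graphData h h1 h2).Fits F B where
  N_eq := rfl
  n_eq := by rw [hF2]; rfl
  m_eq := by rw [hF5]; rfl
  n_le := (length_le_bitLen A₂).trans hb.group
  m_le := (length_le_bitLen A₁).trans hb.group_fst
  size_le k hk := by
    show Nat.size ((A₂ ++ A₁).getD k 0) ≤ B
    by_cases hk2 : k < A₂.length
    · rw [append_getD_left _ _ hk2]; exact size_getD_le hb.group _
    · obtain ⟨i, rfl⟩ := Nat.exists_eq_add_of_le (not_lt.1 hk2)
      rw [append_getD_right]; exact size_getD_le hb.group_fst _

/-- The units returned by the oracle may be random, but by `hh` the image of `diag(u, w, w, w)`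
depends only on `φ₁ u`. The resulting matrix is therefore always that of `graphRows h`. -/
theorem run_rows (h1 : Solved O κ A₁ s₁ φ₁) (h2 : Solved O (matCode κ) A₂ s₂ φ₂)
    (hb : DataBounded κ A₁ s₁ A₂ s₂ B) (hZ : storeBound B ≤ Z)
    (hh : ∀ u w : Rˣ, w ∈ commutator Rˣ →
      Multiplicative.toAdd (φ₂ (diagUnit u w)) = h (Multiplicative.toAdd (φ₁ u)))
    (hsurj : Function.Surjective h) {w : Rˣ} (hw : w ∈ commutator Rˣ)
    {Q : Store → Prop} (x a10 a12 a13 a14 D a17 a18 a19 : List ℕ)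
    (hQ : ∀ i a10 a12 a13 a14, Q (mkS [0, i, 0] [κ.dims, κ.table, A₂, packAux A₁ s₁ s₂, x, A₁, s₁,
      s₂, matDims κ.dims, matTable κ.dims κ.table, a10, κ.encode w, a12, a13, a14, D,
      rowsList A₁.length (A₂.length + A₁.length) (graphRows h), a17, a18, a19])) :
    Run O Z rowsCmd (mkS [0, 0, 0] [κ.dims, κ.table, A₂, packAux A₁ s₁ s₂, x, A₁, s₁,
      s₂, matDims κ.dims, matTable κ.dims κ.table, a10, κ.encode w, a12, a13, a14, D,
      [], a17, a18, a19]) (rowsSteps Z) Q := by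
  have hBZ := le_storeBound B
  have hd := hb.dims
  have hA := hb.group_fst
  have hm := (length_le_bitLen A₁).trans hA
  have hech := graphRows_echelon h h1.pos h2.pos hsurj
  have hfit := graphData_fits (h := h) hb h1.pos h2.pos
    (F := fun k => if k = 2 then A₂ else A₁) rfl rfl
  refine (Run.loop (i := A₁.length) (b := (4 * Z + 6) * 7 + 1)
    (I := fun f σ => ∃ i a10 a12 a13 a14, i + f = A₁.length ∧ σ = mkS [0, i, 0] [κ.dims, κ.table,
      A₂, packAux A₁ s₁ s₂, x, A₁, s₁, s₂, matDims κ.dims, matTable κ.dims κ.table, a10,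
      κ.encode w, a12, a13, a14, D, rowsList i (A₂.length + A₁.length) (graphRows h), a17, a18,
      a19]) ?_ ?_ ?_ ?_).weaken ?_ fun _ h => h
  · rintro σ ⟨i, a10, a12, a13, a14, hi, rfl⟩
    show A₁.length - i = 0
    omega
  · rintro f σ ⟨i, a10, a12, a13, a14, hi, rfl⟩ -
    have hrow := (hfit.rows (i := i + 1) (show i + 1 ≤ A₁.length by omega) hech.lt).trans hZ
    have hsucc : rowsList (i + 1) (A₂.length + A₁.length) (graphRows h) =
        rowsList i (A₂.length + A₁.length) (graphRows h) ++ abCode (h (unitVec A₁ i)) ++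
          abCode (unitVec A₁ i) := by
      rw [rowsList_succ, vecList_graphRows, graphList, List.append_assoc]
    have hrow' : bitLen (rowsList i (A₂.length + A₁.length) (graphRows h) ++
        abCode (h (unitVec A₁ i)) ++ abCode (unitVec A₁ i)) ≤ Z := by rw [← hsucc]; exact hrow
    refine block_fill (S := 4 * Z + 5) (l := [.call _ _ _, fillCmd _ _ _, .call _ _ _,
      extendCmd _ _ _, extendCmd _ _ _, .assign _ _]) A₁.length
      (fun k => (if k = i then 1 else 0) % A₁.getD k 0) le_rfl (by simp) (fun _ _ => rfl)
      (fun k v _ => ?_) ?_ ?_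
    · rw [Arith.eval, Arith.eval_eq]; rfl
    · rw [← abCode_unitVec]
      have := bitLen_abCode_le h1.pos (unitVec A₁ i)
      omega
    rw [← abCode_unitVec]
    refine h1.block_preimage (l := [fillCmd _ _ _, .call _ _ _,
      extendCmd _ _ _, extendCmd _ _ _, .assign _ _]) le_rfl hZ hd (by simp) (unitVec A₁ i) rfl
      fun u hu => ?_
    refine h2.block_diag (l := [extendCmd _ _ _, extendCmd _ _ _, .assign _ _]) le_rfl hZ hd
      hb.group u w (by simp) rfl rfl rfl rfl rfl rfl rfl (by simp) (by simp) ?_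
    have hφ : Multiplicative.toAdd (φ₂ (diagUnit u w)) = h (unitVec A₁ i) := by
      rw [hh u w hw, hu, toAdd_ofAdd]
    rw [hφ]
    have e2 : (List.range A₂.length).map (fun k => (abCode (h (unitVec A₁ i))).getD k 0) =
        abCode (h (unitVec A₁ i)) := by
      have := map_getD_range (abCode (h (unitVec A₁ i)))
      rwa [abCode_length] at this
    have e1 : (List.range A₁.length).map (fun k => (abCode (unitVec A₁ i)).getD k 0) =
        abCode (unitVec A₁ i) := by
      have := map_getD_range (abCode (unitVec A₁ i))
      rwa [abCode_length] at this
    refine block_extend (l := [extendCmd _ _ _, .assign _ _]) A₂.length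
      (fun k => (abCode (h (unitVec A₁ i))).getD k 0)
      (rowsList i (A₂.length + A₁.length) (graphRows h)) le_rfl (by simp) rfl (fun _ _ => rfl)
      (fun _ _ _ => rfl) ?_ ?_
    · rw [e2]
      rw [bitLen_append] at hrow'
      omega
    rw [e2]
    refine block_extend (l := [.assign _ _]) A₁.length
      (fun k => (abCode (unitVec A₁ i)).getD k 0)
      (rowsList i (A₂.length + A₁.length) (graphRows h) ++ abCode (h (unitVec A₁ i)))
      le_rfl (by simp) rfl (fun _ _ => rfl) (fun _ _ _ => rfl) ?_ ?_
    · rw [e1]; exact hrow'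
    rw [e1, ← hsucc]
    refine block_assign (l := []) (i + 1) le_rfl (by simp) rfl ((size_le_self _).trans (by omega)) ?_
    exact block_nil ⟨f, le_rfl, i + 1, _, _, _, _, by omega, rfl⟩
  · rintro f σ ⟨i, a10, a12, a13, a14, hi, rfl⟩ h0
    replace h0 : A₁.length - i = 0 := h0
    obtain rfl : i = A₁.length := by omega
    exact hQ _ _ _ _ _
  · refine ⟨0, a10, a12, a13, a14, by omega, ?_⟩
    simp [rowsList, vecList]
  · rw [rowsSteps]
    exact Nat.succ_le_succ (Nat.mul_le_mul_left _ (by omega))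

/-- A solution `y` of `h y = x` comes from elimination on the graph of `h`, and any unit above `y`
is a preimage of `x` under `h ∘ φ₁`. -/
theorem preimageProgram_good (h1 : Solved O κ A₁ s₁ φ₁) (h2 : Solved O (matCode κ) A₂ s₂ φ₂)
    (hb : DataBounded κ A₁ s₁ A₂ s₂ B) (hZ : storeBound B ≤ Z)
    (hh : ∀ u w : Rˣ, w ∈ commutator Rˣ →
      Multiplicative.toAdd (φ₂ (diagUnit u w)) = h (Multiplicative.toAdd (φ₁ u)))
    (hsurj : Function.Surjective h) (x : AbGrp A₂) :
    Good O Z (fun σ => ∃ u : Rˣ, h (Multiplicative.toAdd (φ₁ u)) = x ∧ σ.arr 14 = κ.encode u)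
      ((eliminateSteps Z + 1) * 14 + 1) [preimageProgram.body]
      (preimageProgram.init (κ.msg ++ [A₂, packAux A₁ s₁ s₂, abCode x])).store := by
  have hBZ := le_storeBound B
  have hd := hb.dims
  have ht := hb.table
  have hA2 := hb.group
  have hA1 := hb.group_fst
  have hp := hb.aux
  have hx := bitLen_abCode_le h2.pos x
  have hfit := graphData_fits (h := h) hb h1.pos h2.pos
    (F := fun k => if k = 2 then A₂ else A₁) rfl rfl
  have hech := graphRows_echelon h h1.pos h2.pos hsurj
  have hS : 4 * Z + 5 ≤ eliminateSteps Z := by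
    refine le_trans ?_ (rowsSteps_le Z)
    have : 1 ≤ Z := by omega
    rw [rowsSteps]
    nlinarith
  have hD : vecList (A₂.length + A₁.length) (graphData h h1.pos h2.pos).D = A₂ ++ A₁ := by
    have := map_getD_range (A₂ ++ A₁)
    rwa [List.length_append] at this
  rw [mkS_append_replicate _ 15]
  refine Run.good ?_ ?_
  swap
  · refine mkS_bounded (by simp) ?_
    intro v hv
    have : v = κ.dims ∨ v = κ.table ∨ v = A₂ ∨ v = packAux A₁ s₁ s₂ ∨ v = abCode x ∨ v = [] := by
      simpa [RingCode.msg, or_assoc] using hv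
    rcases this with rfl | rfl | rfl | rfl | rfl | rfl
    · omega
    · omega
    · omega
    · omega
    · omega
    · simp [bitLen]
  refine block_prepare (l := [.copy _ _, extendCmd _ _ _, rowsCmd, fillCmd _ _ _, eliminateCmd,
    fillCmd _ _ _, .call _ _ _]) h1 hZ hd ht hp hS (abCode x) fun w hw => ?_
  refine block_copy (l := [extendCmd _ _ _, rowsCmd, fillCmd _ _ _, eliminateCmd,
    fillCmd _ _ _, .call _ _ _]) A₂ hS (by simp) rfl ?_
  refine block_extend (l := [rowsCmd, fillCmd _ _ _, eliminateCmd, fillCmd _ _ _, .call _ _ _])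
    A₁.length (fun k => A₁.getD k 0) A₂ hS (by simp) rfl (fun _ _ => rfl) (fun _ _ _ => rfl) ?_ ?_
  · rw [map_getD_range, bitLen_append]; omega
  rw [map_getD_range]
  refine block_cons (l := [fillCmd _ _ _, eliminateCmd, fillCmd _ _ _, .call _ _ _])
    (rowsSteps_le Z) (run_rows h1 h2 hb hZ hh hsurj hw (abCode x) _ _ _ _ (A₂ ++ A₁) _ _ _
    fun i a10 a12 a13 a14 => ?_)
  refine block_fill (l := [eliminateCmd, fillCmd _ _ _, .call _ _ _]) (A₂.length + A₁.length)
    (negVec A₁ x) hS (by simp) (fun _ _ => List.length_append) (fun _ _ _ => rfl)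
    ((hfit.vec fun k hk => (negVec_lt h h1.pos h2.pos x k hk).le).trans hZ) ?_
  refine block_cons (l := [fillCmd _ _ _, .call _ _ _]) le_rfl ?_
  have hel := run_eliminate (O := O) (Z := Z) (p := []) (t := []) (i := i)
    -- The first fifteen arrays, which the elimination leaves unchanged.
    (F := fun k => [κ.dims, κ.table, A₂, packAux A₁ s₁ s₂, abCode x, A₁, s₁,
      s₂, matDims κ.dims, matTable κ.dims κ.table, a10, κ.encode w, a12, a13, a14].getD k [])
    (graphData_fits (h := h) hb h1.pos h2.pos rfl rfl) hZ hech (negVec_lt h h1.pos h2.pos x)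
    (Q := fun σ' => Run O Z (block [fillCmd 10 (.len 5) (.get 19 (.add (.len 2) (.var 0))),
      .call Task.preimage [0, 1, 5, 6, 10] [14]]) σ' ((eliminateSteps Z + 1) * 2 + 1)
      fun σ => ∃ u : Rˣ, h (Multiplicative.toAdd (φ₁ u)) = x ∧ σ.arr 14 = κ.encode u) ?_
  · rw [show (graphData h h1.pos h2.pos).N = A₂.length + A₁.length from rfl, hD] at hel
    exact hel
  · intro i j v p t X hX
    obtain ⟨y, hy, hyX⟩ := exists_of_reduced h h1.pos h2.pos x hX
    refine block_fill (l := [.call _ _ _]) A₁.length (fun k => X (A₂.length + k)) hS (by simp)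
      (fun _ _ => rfl) (fun k _ hk => ?_) ?_ ?_
    · exact vecList_getD X (show A₂.length + k < A₂.length + A₁.length by omega)
    · rw [← hyX]
      have := bitLen_abCode_le h1.pos y
      omega
    rw [← hyX]
    refine h1.block_preimage (l := []) hS hZ hd (by simp) y rfl fun u hu => ?_
    exact block_nil ⟨u, by rw [hu, toAdd_ofAdd, hy], rfl⟩

end Specs

/-! ### The reduction -/

section Homomorphisms

variable {R : Type} [Ring R]

theorem diagUnit_eq_stabilize (u : Rˣ) :
    diagUnit u 1 = stabilize R 1 4 (by norm_num) (toGLOne R u) := by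
  ext i j
  show Matrix.diagonal _ i j = padMatrix 4 (Matrix.scalar (Fin 1) (u : R)) i j
  rw [Matrix.diagonal_apply, padMatrix]
  by_cases hi : i = 0
  · subst hi
    by_cases hj : 0 = j
    · subst hj; simp
    · have : ¬ (j : ℕ) < 1 := fun h => hj (Fin.ext (by simp; omega))
      simp [hj, this]
  · have : ¬ (i : ℕ) < 1 := fun h => hi (Fin.ext (by simp; omega))
    simp [hi, this]

variable {O : Oracle} {κ : RingCode R} {A₁ s₁ A₂ s₂ : List ℕ}
  {φ₁ : Rˣ →* Multiplicative (AbGrp A₁)}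
  {φ₂ : (Matrix (Fin 4) (Fin 4) R)ˣ →* Multiplicative (AbGrp A₂)}

/-- `φ₂` identifies `GL₄(R)^ab` with `A₂`, which transports the statements on `unitsToGLFourAb` to
`ψ`. As `A₂` is abelian, `ψ` kills the kernel of `φ₁` and so descends to `h`. -/
theorem exists_homs [Finite R] (h1 : Solved O κ A₁ s₁ φ₁) (h2 : Solved O (matCode κ) A₂ s₂ φ₂) :
    ∃ (ψ : Rˣ →* Multiplicative (AbGrp A₂)) (h : AbGrp A₁ →+ AbGrp A₂),
      Function.Surjective ψ ∧ ψ.ker = (unitsToK1 R).ker ∧ Function.Surjective h ∧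
      (∀ u, h (Multiplicative.toAdd (φ₁ u)) = Multiplicative.toAdd (ψ u)) ∧
      ∀ u w : Rˣ, w ∈ commutator Rˣ → φ₂ (diagUnit u w) = ψ u := by
  set F : Abelianization (Matrix.GeneralLinearGroup (Fin 4) R) →* Multiplicative (AbGrp A₂) :=
    Abelianization.lift φ₂ with hF
  have hFof : ∀ g, F (Abelianization.of g) = φ₂ g := fun g => Abelianization.lift_apply_of φ₂ g
  have hFinj : Function.Injective F := by
    rw [injective_iff_map_eq_one]
    intro a ha
    obtain ⟨g, rfl⟩ := QuotientGroup.mk_surjective a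
    replace ha : φ₂ g = 1 := (hFof g).symm.trans ha
    have : g ∈ commutator (Matrix.GeneralLinearGroup (Fin 4) R) := by
      have hk : g ∈ φ₂.ker := ha
      rwa [h2.ker] at hk
    exact (QuotientGroup.eq_one_iff g).2 this
  have hFsurj : Function.Surjective F := fun x => by
    obtain ⟨g, rfl⟩ := h2.surjective x
    exact ⟨_, hFof g⟩
  have hψ1 : ∀ u, F (unitsToGLFourAb R u) = φ₂ (diagUnit u 1) := fun u => by
    rw [diagUnit_eq_stabilize]
    exact hFof _
  set ψ := F.comp (unitsToGLFourAb R) with hψ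
  have hψs : Function.Surjective ψ := hFsurj.comp (unitsToGLFourAb_surjective R)
  have hker : φ₁.ker ≤ ψ.ker := by
    rw [h1.ker]
    exact Abelianization.commutator_subset_ker ψ
  set f := φ₁.liftOfSurjective h1.surjective ⟨ψ, hker⟩ with hf
  have hfu : ∀ u, f (φ₁ u) = ψ u := fun u =>
    MonoidHom.liftOfRightInverse_comp_apply φ₁ _ _ ⟨ψ, hker⟩ u
  refine ⟨ψ, AddMonoidHom.toMultiplicative.symm f, hψs, ?_, ?_, ?_, ?_⟩
  · rw [← ker_unitsToGLFourAb]
    ext u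
    rw [MonoidHom.mem_ker, MonoidHom.mem_ker]
    exact map_eq_one_iff F hFinj (x := unitsToGLFourAb R u)
  · intro x
    obtain ⟨u, hu⟩ := hψs (Multiplicative.ofAdd x)
    exact ⟨Multiplicative.toAdd (φ₁ u), by
      show Multiplicative.toAdd (f (φ₁ u)) = x
      rw [hfu, hu, toAdd_ofAdd]⟩
  · intro u
    show Multiplicative.toAdd (f (φ₁ u)) = _
    rw [hfu]
  · intro u w hw
    -- A homomorphism to an abelian group, hence trivial on the commutator subgroup; this is why `w`
    -- may stand for `1`.
    let G : Rˣ →* Multiplicative (AbGrp A₂) :=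
      { toFun := fun w => φ₂ (diagUnit 1 w)
        map_one' := by rw [diagUnit_one, map_one]
        map_mul' := fun a b => by rw [← map_mul, ← diagUnit_mul, one_mul] }
    have hG : φ₂ (diagUnit 1 w) = 1 := Abelianization.commutator_subset_ker G hw
    have : diagUnit u w = diagUnit u 1 * diagUnit 1 w := by rw [← diagUnit_mul, mul_one, one_mul]
    rw [this, map_mul, hG, mul_one]
    exact (hψ1 u).symm

theorem RingCode.finite (κ : RingCode R) : Finite R := by
  have : ∀ i, Finite (ZMod (κ.dims.get i)) := fun i => by
    have := κ.neZero i
    infer_instance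
  exact Finite.of_equiv _ κ.equiv.symm.toEquiv

end Homomorphisms

/-- The algorithm that computes `K₁`. -/
def kOneAlgorithm : Algorithm
  | .group => groupProgram
  | .image => imageProgram
  | .preimage => preimageProgram

/-! ### Polynomial bounds for running times and output lengths. -/

section Bounds

theorem eval_mono (p : Polynomial ℕ) {a b : ℕ} (h : a ≤ b) : p.eval a ≤ p.eval b := by
  rw [Polynomial.eval_eq_sum_range, Polynomial.eval_eq_sum_range]
  gcongr

/-- A bound for the bit lengths of the data, in terms of the length of the input. -/
def dataPoly (b : Polynomial ℕ) : Polynomial ℕ :=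
  Polynomial.X + b + b.comp (2 * (4096 * (Polynomial.X + 1) ^ 4 + 1))

theorem eval_dataPoly (b : Polynomial ℕ) (l : ℕ) :
    (dataPoly b).eval l = l + b.eval l + b.eval (2 * (storeBound l + 1)) := by
  simp [dataPoly, storeBound]

/-- A bound for the costs of the single steps. -/
def programWeight : ℕ :=
  groupProgram.body.weight + imageProgram.body.weight + preimageProgram.body.weight

/-- A bound for the running times. -/
def timePoly (b : Polynomial ℕ) : Polynomial ℕ :=
  (5000 * programWeight : ℕ) * (4096 * (dataPoly b + 1) ^ 4 + 1) ^ 6 +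
    2 * (4096 * (dataPoly b + 1) ^ 4 + 1)

theorem eval_timePoly (b : Polynomial ℕ) (l : ℕ) : (timePoly b).eval l =
    5000 * programWeight * (storeBound ((dataPoly b).eval l) + 1) ^ 6 +
      2 * (storeBound ((dataPoly b).eval l) + 1) := by
  simp only [timePoly, storeBound, Polynomial.eval_add, Polynomial.eval_mul, Polynomial.eval_pow,
    Polynomial.eval_natCast, Polynomial.eval_one, Polynomial.eval_ofNat, Nat.cast_id]

/-- One factor comes from filling an array, and one from each of the three nested loops: Euclidean
steps, rows and columns. -/
theorem eliminateSteps_le (Z : ℕ) : eliminateSteps Z ≤ 344 * (Z + 1) ^ 4 := by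
  have h1 : euclidSteps Z ≤ 26 * (Z + 1) ^ 2 := by rw [euclidSteps]; nlinarith
  have h0 : 1 ≤ (Z + 1) ^ 2 := Nat.one_le_pow _ _ (by omega)
  have h2 : pivotSteps Z ≤ 56 * (Z + 1) ^ 3 := by
    calc pivotSteps Z ≤ 56 * (Z + 1) ^ 2 * Z + 1 :=
          Nat.succ_le_succ (Nat.mul_le_mul_right _ (by omega))
      _ ≤ 56 * (Z + 1) ^ 3 := by rw [pow_succ _ 2]; nlinarith
  have h0' : 1 ≤ (Z + 1) ^ 3 := Nat.one_le_pow _ _ (by omega)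
  calc eliminateSteps Z ≤ 344 * (Z + 1) ^ 3 * Z + 1 :=
        Nat.succ_le_succ (Nat.mul_le_mul_right _ (by omega))
    _ ≤ 344 * (Z + 1) ^ 4 := by rw [pow_succ _ 3]; nlinarith

/-- The exponent is four for the number of steps and two for the cost of a step. The unused summand
`2 * (Z + 1)` of `timePoly` is for the output lengths: the first task returns two arrays. -/
theorem time_le {n w Z W : ℕ} (hn : n ≤ 5000 * (Z + 1) ^ 4) (hw : w ≤ W) :
    n * (w * (Z + 1) ^ 2) ≤ 5000 * W * (Z + 1) ^ 6 + 2 * (Z + 1) := by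
  calc n * (w * (Z + 1) ^ 2) ≤ 5000 * (Z + 1) ^ 4 * (W * (Z + 1) ^ 2) :=
        Nat.mul_le_mul hn (Nat.mul_le_mul_right _ hw)
    _ = 5000 * W * (Z + 1) ^ 6 := by ring
    _ ≤ _ := Nat.le_add_right _ _

theorem linear_steps_le (Z : ℕ) {c : ℕ} (hc : c ≤ 10) : (4 * Z + 6) * c + 1 ≤ 5000 * (Z + 1) ^ 4 := by
  have h1 : Z + 1 ≤ (Z + 1) ^ 4 := Nat.le_self_pow (by norm_num) _
  have h2 : (4 * Z + 6) * c ≤ (4 * Z + 6) * 10 := Nat.mul_le_mul_left _ hc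
  omega

theorem preimage_steps_le (Z : ℕ) : (eliminateSteps Z + 1) * 14 + 1 ≤ 5000 * (Z + 1) ^ 4 := by
  have h1 := eliminateSteps_le Z
  have h2 : 1 ≤ (Z + 1) ^ 4 := Nat.one_le_pow _ _ (by omega)
  omega

theorem msgLen_outputs_le {O : Oracle} {Z n : ℕ} {Post : Store → Prop} {P : Program} {x y : Msg}
    (h : Good O Z Post n [P.body] (P.init x).store) (hy : P.Outputs O x y) :
    msgLen y ≤ P.outs.length * (Z + 1) := by
  obtain ⟨σ, hσ, -, rfl⟩ := good_outputs h hy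
  have := msgLen_le_mul (x := P.outs.map σ.arr) (z := Z) (by
    intro w hw
    obtain ⟨a, -, rfl⟩ := List.mem_map.1 hw
    exact hσ.2 a)
  rwa [List.length_map] at this

end Bounds

/-! ### Assembly of the reduction. -/

section Reduction

variable {C : RingClass} {O : Oracle} {R : Type} [Ring R]

theorem ComputesUnitsAb.exists_solved (hO : ComputesUnitsAb C O.answers) (hR : C R)
    (κ : RingCode R) {y : Msg} (hy : y ∈ (O Task.group κ.msg).support) :
    ∃ A s, y = [A, s] ∧ ∃ φ, Solved O κ A s φ := by
  obtain ⟨A, s, rfl, hA, φ, h1, h2, h3, h4⟩ := hO R hR κ y hy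
  exact ⟨A, s, rfl, φ, hA, h1, h2, h3, h4⟩

variable {b : Polynomial ℕ}

theorem bitLen_component_le {x : Msg} {w : List ℕ} (h : w ∈ x) :
    bitLen w ≤ (dataPoly b).eval (msgLen x) := by
  have := bitLen_lt_msgLen h
  rw [eval_dataPoly]
  omega

/-- The specification of the program for the first task. -/
theorem group_good (hC : ∀ (R : Type) [Ring R], C R → C (Matrix (Fin 4) (Fin 4) R))
    (hO : ComputesUnitsAb C O.answers) (hL : LengthBounded C O.answers b) (hR : C R)
    (κ : RingCode R) :
    Good O (storeBound ((dataPoly b).eval (msgLen κ.msg)))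
      (fun σ => ∃ A₁ s₁ A₂ s₂, [A₁, s₁] ∈ (O Task.group κ.msg).support ∧
      [A₂, s₂] ∈ (O Task.group (matCode κ).msg).support ∧ σ.arr 2 = A₂ ∧
        σ.arr 3 = packAux A₁ s₁ s₂)
      ((4 * storeBound ((dataPoly b).eval (msgLen κ.msg)) + 6) * 10 + 1) [groupProgram.body]
      (groupProgram.init κ.msg).store := by
  have hd : κ.dims ∈ κ.msg := by simp [RingCode.msg]
  have ht : κ.table ∈ κ.msg := by simp [RingCode.msg]
  refine groupProgram_good κ le_rfl (bitLen_component_le hd) (bitLen_component_le ht) ?_ ?_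
  · intro y hy
    obtain ⟨A, s, rfl, -⟩ := hO.exists_solved hR κ hy
    refine ⟨?_, A, s, rfl⟩
    have := hL _ _ (IsInput.group R hR κ) _ hy
    rw [eval_dataPoly]
    omega
  · intro y hy
    obtain ⟨A, s, rfl, -⟩ := hO.exists_solved (hC R hR) (matCode κ) hy
    refine ⟨?_, A, s, rfl⟩
    have h1 := hL _ _ (IsInput.group _ (hC R hR) (matCode κ)) _ hy
    -- The question about `M₄(R)` is polynomially longer than the input; this is the reason for the
    -- composite term in `dataPoly`.
    have h2 := eval_mono b (msgLen_matCode_le κ (bitLen_lt_msgLen hd).le (bitLen_lt_msgLen ht).le)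
    rw [eval_dataPoly]
    omega

/-- The answers to the first task. -/
theorem group_answers (hC : ∀ (R : Type) [Ring R], C R → C (Matrix (Fin 4) (Fin 4) R))
    (hO : ComputesUnitsAb C O.answers) (hL : LengthBounded C O.answers b) (hR : C R)
    (κ : RingCode R) {out : Msg} (h : kOneAlgorithm.answers O Task.group κ.msg out) :
    ∃ A₁ s₁ A₂ s₂ φ₁ φ₂, Solved O κ A₁ s₁ φ₁ ∧ Solved O (matCode κ) A₂ s₂ φ₂ ∧
      out = [A₂, packAux A₁ s₁ s₂] := by
  obtain ⟨σ, -, ⟨A₁, s₁, A₂, s₂, h1, h2, h3, h4⟩, rfl⟩ := good_outputs (group_good hC hO hL hR κ) h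
  obtain ⟨A, s, he, φ₁, hφ₁⟩ := hO.exists_solved hR κ h1
  obtain ⟨rfl, rfl⟩ : A₁ = A ∧ s₁ = s := by simpa using he
  obtain ⟨A, s, he, φ₂, hφ₂⟩ := hO.exists_solved (hC R hR) (matCode κ) h2
  obtain ⟨rfl, rfl⟩ : A₂ = A ∧ s₂ = s := by simpa using he
  exact ⟨A₁, s₁, A₂, s₂, φ₁, φ₂, hφ₁, hφ₂, by simp [groupProgram, h3, h4]⟩

theorem dataBounded_of_msg (b : Polynomial ℕ) (κ : RingCode R) (A₁ s₁ A₂ s₂ x : List ℕ) :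
    DataBounded κ A₁ s₁ A₂ s₂
      ((dataPoly b).eval (msgLen (κ.msg ++ [A₂, packAux A₁ s₁ s₂, x]))) where
  dims := bitLen_component_le (by simp [RingCode.msg])
  table := bitLen_component_le (by simp [RingCode.msg])
  group := bitLen_component_le (by simp)
  aux := bitLen_component_le (by simp)

variable {κ : RingCode R} {A₁ s₁ A₂ s₂ : List ℕ} {φ₁ : Rˣ →* Multiplicative (AbGrp A₁)}
  {φ₂ : (Matrix (Fin 4) (Fin 4) R)ˣ →* Multiplicative (AbGrp A₂)}

/-- The specification of the program for the second task. -/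
theorem image_good (b : Polynomial ℕ) (h1 : Solved O κ A₁ s₁ φ₁)
    (h2 : Solved O (matCode κ) A₂ s₂ φ₂) (u : Rˣ) :
    Good O (storeBound ((dataPoly b).eval
      (msgLen (κ.msg ++ [A₂, packAux A₁ s₁ s₂, κ.encode u]))))
      (fun σ => ∃ w ∈ commutator Rˣ,
        σ.arr 14 = abCode (Multiplicative.toAdd (φ₂ (diagUnit u w))))
      ((4 * storeBound ((dataPoly b).eval
        (msgLen (κ.msg ++ [A₂, packAux A₁ s₁ s₂, κ.encode u]))) + 6) * 9 + 1) [imageProgram.body]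
      (imageProgram.init (κ.msg ++ [A₂, packAux A₁ s₁ s₂, κ.encode u])).store := by
  have hb := dataBounded_of_msg b κ A₁ s₁ A₂ s₂ (κ.encode u)
  exact imageProgram_good h1 h2 le_rfl hb.dims hb.table hb.group hb.aux u

/-- The specification of the program for the third task. -/
theorem preimage_good [Finite R] (b : Polynomial ℕ) (h1 : Solved O κ A₁ s₁ φ₁)
    (h2 : Solved O (matCode κ) A₂ s₂ φ₂) {ψ : Rˣ →* Multiplicative (AbGrp A₂)}
    {h : AbGrp A₁ →+ AbGrp A₂} (hs : Function.Surjective h)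
    (hh : ∀ u, h (Multiplicative.toAdd (φ₁ u)) = Multiplicative.toAdd (ψ u))
    (hw : ∀ u w : Rˣ, w ∈ commutator Rˣ → φ₂ (diagUnit u w) = ψ u) (x : AbGrp A₂) :
    Good O (storeBound ((dataPoly b).eval
      (msgLen (κ.msg ++ [A₂, packAux A₁ s₁ s₂, abCode x]))))
      (fun σ => ∃ u : Rˣ, ψ u = Multiplicative.ofAdd x ∧ σ.arr 14 = κ.encode u)
      ((eliminateSteps (storeBound ((dataPoly b).eval
        (msgLen (κ.msg ++ [A₂, packAux A₁ s₁ s₂, abCode x])))) + 1) * 14 + 1)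
      [preimageProgram.body]
      (preimageProgram.init (κ.msg ++ [A₂, packAux A₁ s₁ s₂, abCode x])).store := by
  have := preimageProgram_good h1 h2 (dataBounded_of_msg b κ A₁ s₁ A₂ s₂ (abCode x)) le_rfl
    (fun u w hw' => by rw [hw u w hw', hh]) hs x
  simp only [hh] at this
  exact this

/-- The oracle is asked only about `R` and `M₄(R)`, so closure under `4 × 4` matrices is all that is
required of the class; finiteness of `R` follows from the existence of an encoding. -/
theorem k1ReducesToUnitsAb (hC : ∀ (R : Type) [Ring R], C R → C (Matrix (Fin 4) (Fin 4) R)) :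
    K1ReducesToUnitsAb C := by
  refine ⟨kOneAlgorithm, fun b => ⟨timePoly b, fun O hO hL => ⟨?_, ?_, ?_, ?_⟩⟩⟩
  · intro R _ hR κ out hout
    have := κ.finite
    obtain ⟨A₁, s₁, A₂, s₂, φ₁, φ₂, h1, h2, rfl⟩ := group_answers hC hO hL hR κ hout
    obtain ⟨ψ, h, hψ, hker, hs, hh, hw⟩ := exists_homs h1 h2
    refine ⟨A₂, _, rfl, h2.pos, ψ, hψ, hker, ?_, ?_⟩
    · intro u y hy
      obtain ⟨σ, -, ⟨w, hw', h3⟩, rfl⟩ := good_outputs (image_good b h1 h2 u) hy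
      rw [hw u w hw'] at h3
      simp [imageProgram, h3]
    · intro x y hy
      obtain ⟨σ, -, ⟨u, hu, h3⟩, rfl⟩ := good_outputs (preimage_good b h1 h2 hs hh hw x) hy
      exact ⟨u, hu, by simp [preimageProgram, h3]⟩
  · rintro x ⟨R, hR, κ⟩
    refine (good_expectedTime (group_good hC hO hL hR κ)).trans (Nat.cast_le.2 ?_)
    rw [eval_timePoly]
    exact time_le (linear_steps_le _ le_rfl) (by rw [programWeight]; omega)
  · intro t ht
    refine ⟨?_, ?_⟩
    · cases t
      · exact absurd rfl ht
      · simp [kOneAlgorithm, imageProgram, block, prepareCmds, matrixCmds, fillCmd, extendCmd,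
          Cmd.CoinFree]
      · simp [kOneAlgorithm, preimageProgram, block, prepareCmds, matrixCmds, fillCmd, extendCmd,
          rowsCmd, eliminateCmd, pivotCmd, euclidCmd, Cmd.CoinFree]
    · rintro x hx
      rw [eval_timePoly]
      cases hx with
      | group R hR κ => exact absurd rfl ht
      | image R hR κ A s hA u =>
        obtain ⟨A₁, s₁, A₂, s₂, φ₁, φ₂, h1, h2, he⟩ := group_answers hC hO hL hR κ hA
        obtain ⟨rfl, rfl⟩ : A = A₂ ∧ s = packAux A₁ s₁ s₂ := by simpa using he
        intro n γ hγ
        exact (good_timeAtMost (image_good b h1 h2 u) n γ hγ).trans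
          (time_le (linear_steps_le _ (by norm_num)) (by rw [programWeight]; omega))
      | preimage R hR κ A s hA x =>
        have := κ.finite
        obtain ⟨A₁, s₁, A₂, s₂, φ₁, φ₂, h1, h2, he⟩ := group_answers hC hO hL hR κ hA
        obtain ⟨rfl, rfl⟩ : A = A₂ ∧ s = packAux A₁ s₁ s₂ := by simpa using he
        obtain ⟨ψ, h, hψ, hker, hs, hh, hw⟩ := exists_homs h1 h2
        intro n γ hγ
        exact (good_timeAtMost (preimage_good b h1 h2 hs hh hw x) n γ hγ).trans
          (time_le (preimage_steps_le _) (by rw [programWeight]; omega))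
  · intro t x hx y hy
    rw [eval_timePoly]
    cases hx with
    | group R hR κ =>
      exact (msgLen_outputs_le (group_good hC hO hL hR κ) hy).trans (Nat.le_add_left _ _)
    | image R hR κ A s hA u =>
      obtain ⟨A₁, s₁, A₂, s₂, φ₁, φ₂, h1, h2, he⟩ := group_answers hC hO hL hR κ hA
      obtain ⟨rfl, rfl⟩ : A = A₂ ∧ s = packAux A₁ s₁ s₂ := by simpa using he
      exact (msgLen_outputs_le (image_good b h1 h2 u) hy).trans
        (le_trans (Nat.mul_le_mul_right _ (by simp [imageProgram])) (Nat.le_add_left _ _))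
    | preimage R hR κ A s hA x =>
      have := κ.finite
      obtain ⟨A₁, s₁, A₂, s₂, φ₁, φ₂, h1, h2, he⟩ := group_answers hC hO hL hR κ hA
      obtain ⟨rfl, rfl⟩ : A = A₂ ∧ s = packAux A₁ s₁ s₂ := by simpa using he
      obtain ⟨ψ, h, hψ, hker, hs, hh, hw⟩ := exists_homs h1 h2
      exact (msgLen_outputs_le (preimage_good b h1 h2 hs hh hw x) hy).trans
        (le_trans (Nat.mul_le_mul_right _ (by simp [preimageProgram])) (Nat.le_add_left _ _))

theorem card_matrix (R : Type) [Ring R] : Nat.card (Matrix (Fin 4) (Fin 4) R) = Nat.card R ^ 16 := by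
  show Nat.card (Fin 4 → Fin 4 → R) = _
  rw [Nat.card_fun, Nat.card_fun, Nat.card_fin, ← pow_mul]

theorem PRings.matrix {p : ℕ} {R : Type} [Ring R] (h : PRings p R) :
    PRings p (Matrix (Fin 4) (Fin 4) R) := by
  obtain ⟨k, hk⟩ := h
  exact ⟨k * 16, by rw [card_matrix, hk, ← pow_mul]⟩

end Reduction

end FiniteRingAlg

end

theorem mainTheorem8 :
    (∀ (R : Type) [Ring R] [Finite R], Function.Surjective (FiniteRingAlg.unitsToK1 R)) ∧
    FiniteRingAlg.K1ReducesToUnitsAb FiniteRingAlg.FiniteRings ∧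
    FiniteRingAlg.K1ReducesToUnitsAb FiniteRingAlg.PrimePowerRings ∧
    (∀ p : ℕ, p.Prime → FiniteRingAlg.K1ReducesToUnitsAb (FiniteRingAlg.PRings p)) := by
  refine ⟨fun R _ _ => FiniteRingAlg.unitsToK1_surjective R, ?_, ?_, fun p _ => ?_⟩
  · refine FiniteRingAlg.k1ReducesToUnitsAb fun R _ hR => ?_
    have : Finite R := hR
    exact FiniteRingAlg.finiteMatrix R 4
  · refine FiniteRingAlg.k1ReducesToUnitsAb fun R _ hR => ?_
    obtain ⟨p, hp, h⟩ := hR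
    exact ⟨p, hp, h.matrix⟩
  · exact FiniteRingAlg.k1ReducesToUnitsAb fun R _ hR => hR.matrix
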